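/- **Setting.** Let $\mathbb R^3$ carry the Minkowski metric $\mathrm{diag}(1,-1,-1)$, let $(x\times y)_c=\epsilon_{abc}x^ay^b$ with $\epsilon_{012}=1$ (index raised with the metric), let $J_a$ be the generators of $so(2,1)$ with $n^aJ_a\,x=n\times x$, let $L_3^\uparrow$ be the proper orthochronous Lorentz group acting on $\mathbb R^3$ by $\mathrm{Ad}$, and let $P_3^\uparrow=L_3^\uparrow\ltimes\mathbb R^3$, whose elements are written $(u,-\mathrm{Ad}(u)j)$. Let $\mathbb H^2=\{x: x\cdot x=1,\ x^0>0\}$ and $g\ge 2$. Let $\Gamma\subset L_3^\uparrow$ be a cocompact Fuchsian group acting freely on $\mathbb H^2$, generated by $v_{A_1},v_{B_1},\dots,v_{A_g},v_{B_g}$, with a fundamental polygon $P$: a compact geodesic arc $4g$-gon with corners $p_0,\dots,p_{4g}=p_0$, positively oriented (near an inner point of the side from $p_k$ to $p_{k+1}$, $P$ is given by $\det(p_k,p_{k+1},y)\ge0$), whose $\Gamma$-translates tile $\mathbb H^2$, with directed sides $a_i:p_{4i-4}\to p_{4i-3}$, $b_i:p_{4i-2}\to p_{4i-3}$, $a_i':p_{4i-1}\to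 p_{4i-2}$, $b_i':p_{4i-1}\to p_{4i}$ such that $\mathrm{Ad}(v_{A_i})a_i=a_i'$, $\mathrm{Ad}(v_{B_i})b_i=b_i'$. Write $[x,y]=xyx^{-1}y^{-1}$, $v_{H_i}=[v_{B_i},v_{A_i}^{-1}]$. Let $v_{st}$ be an $L_3^\uparrow$-valued function on $P$ with $v_{st}|_{y'}=v_Y\,v_{st}|_y$ for each side $y\in\{a_1,\dots,b_g\}$ (with group element $v_Y$, $Y\in\{A_1,\dots,B_g\}$), put $v_0=v_{st}(p_0)$, and for $T>0$ let $\gamma_{st}^{-1}(x)=(v_{st}(x),Tx)$, the trivialising function of the static spacetime at cosmological time $T$. For a side $y$ from $q_i$ to $q_f$ the holonomy is $Y=\gamma(q_f)\gamma^{-1}(q_i)$, and for $\eta=y_s^{\beta_s}\circ\cdots\circ y_1^{\beta_1}$, $y_j\in\{a_1,\dots,b_g\}$, $\beta_j=\pm1$, it is $H_\eta=Y_s^{\beta_s}\cdots Y_1^{\beta_1}=(u_\eta,-\mathrm{Ad}(u_\eta)j_\eta)$. Let $\lambda$ be a simple closed geodesic on $\mathbb H^2/\Gamma$ of length $\ell>0$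 and $w>0$. Let $c_{p,q}(t)=p\cosh t+q\sinh t$, $p\in P$, be a lift of $\lambda$ that does not pass through the $\Gamma$-images of the corners, $n_{p,q}=p\times q$, and $\tilde v=e^{\ell n_{p,q}^aJ_a}\in\Gamma$ the holonomy of $\lambda$. Suppose that over one period $c_{p,q}$ traverses successively the polygons $P,\ v_{X_r}^{\alpha_r}P,\ v_{X_r}^{\alpha_r}v_{X_{r-1}}^{\alpha_{r-1}}P,\ \dots,\ v_{X_r}^{\alpha_r}\cdots v_{X_1}^{\alpha_1}P=\tilde vP$, where $X_k\in\{A_1,\dots,B_g\}$, $\alpha_k=\pm1$, and $\tilde v=v_{X_r}^{\alpha_r}\cdots v_{X_1}^{\alpha_1}$. For $x\in\mathbb H^2$ off the multicurve $\{\mathrm{Ad}(v)c_{p,q}:v\in\Gamma\}$ let $\rho(x)=w\sum\epsilon\,m$, the sum over the distinct geodesics of the multicurve that meet the geodesic arc from $p_0$ to $x$, where $m$ is the unit normal $\mathrm{Ad}(v)n_{p,q}$ of the geodesic and $\epsilon=\pm1$ is such that $\epsilon m$ points towards $x$. Grafting along $\lambda$ with weight $w$ replaces $\gamma_{st}^{-1}(x)$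 by $\gamma^{-1}(x)=(v_{st}(x),Tx+\rho(x))$. **Theorem.** (1) The sums defining $\rho$ are finite. For every side $y\in\{a_1,\dots,b_g\}$ and every $x\in y$ off the multicurve, $\gamma^{-1}(\mathrm{Ad}(v_Y)x)=(v_Y,\rho(\mathrm{Ad}(v_Y)p_0))\cdot\gamma^{-1}(x)$; and the grafted holonomies $A_i,B_i$ satisfy $[B_g,A_g^{-1}]\cdots[B_1,A_1^{-1}]=1$, so that they define the holonomies of all elements of $\pi_1(S_g)$. (2) For every $\eta=y_s^{\beta_s}\circ\cdots\circ y_1^{\beta_1}$, grafting along $\lambda$ with weight $w$ transforms the holonomy $H_\eta$ of the static spacetime by $u_\eta\mapsto u_\eta$ and $$j_\eta\mapsto j_\eta+w\sum_{i=1}^g\mathcal U_{A_i}\,\mathrm{Ad}(v_0^{-1}v_{H_1}^{-1}\cdots v_{H_{i-1}}^{-1})\,\mathcal X_{A_i}-w\sum_{i=1}^g\mathcal U_{B_i}\,\mathrm{Ad}(v_0^{-1}v_{H_1}^{-1}\cdots v_{H_{i-1}}^{-1}v_{A_i}^{-1}v_{B_i})\,\mathcal X_{B_i},$$ where, for $Y\in\{A_1,\dots,B_g\}$,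 $$\mathcal U_Y=\sum_{Y_j=Y,\ \beta_j=1}\mathrm{Ad}(u_{Y_1}^{-\beta_1}\cdots u_{Y_{j-1}}^{-\beta_{j-1}})-\sum_{Y_j=Y,\ \beta_j=-1}\mathrm{Ad}(u_{Y_1}^{-\beta_1}\cdots u_{Y_j}^{-\beta_j}),$$ $$\mathcal X_Y=\sum_{X_k=Y,\ \alpha_k=1}\mathrm{Ad}(v_{X_{k-1}}^{\alpha_{k-1}}\cdots v_{X_1}^{\alpha_1})n_{p,q}-\sum_{X_k=Y,\ \alpha_k=-1}\mathrm{Ad}(v_{X_k}^{\alpha_k}\cdots v_{X_1}^{\alpha_1})n_{p,q}.$$ (3) Define a map $Gr_{w\lambda}:(P_3^\uparrow)^{2g}\to(P_3^\uparrow)^{2g}$ as follows. For $(A_1,\dots,B_g)\in(P_3^\uparrow)^{2g}$ with Lorentz components $u_Y$, put $u_{H_i}=[u_{B_i},u_{A_i}^{-1}]$, $$v_{A_i}=v_0u_{H_1}^{-1}\cdots u_{H_i}^{-1}u_{B_i}u_{H_{i-1}}\cdots u_{H_1}v_0^{-1},\qquad v_{B_i}=v_0u_{H_1}^{-1}\cdots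 u_{H_i}^{-1}u_{A_i}u_{H_{i-1}}\cdots u_{H_1}v_0^{-1},$$ let $n_{p,q}$ be the unit spacelike vector with $v_{X_r}^{\alpha_r}\cdots v_{X_1}^{\alpha_1}=e^{\alpha n_{p,q}^aJ_a}$, $\alpha>0$ (and $n_{p,q}=0$ if this element is not hyperbolic), leave all $u_Y$ fixed, and put $$j_{A_i}\mapsto j_{A_i}+w\,\mathrm{Ad}(v_0^{-1}v_{H_1}^{-1}\cdots v_{H_{i-1}}^{-1})\mathcal X_{A_i},\qquad j_{B_i}\mapsto j_{B_i}-w\,\mathrm{Ad}(v_0^{-1}v_{H_1}^{-1}\cdots v_{H_{i-1}}^{-1}v_{A_i}^{-1}v_{B_i})\mathcal X_{B_i}.$$ Then $Gr_{w\lambda}$ maps the tuple of static holonomies to the tuple of grafted holonomies, and for every element of $(P_3^\uparrow)^{2g}$ and every $\eta$ it leaves $u_\eta$ fixed and transforms $j_\eta$ by the formula in (2), with these $u_Y$, $v_X$ and $n_{p,q}$. -/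

import Mathlib

open scoped Matrix Topology

namespace Grafting

noncomputable section

/-! ### Minkowski space and the (2+1)-dimensional Lorentz and Poincaré groups -/

/-- The underlying vector space of three-dimensional Minkowski space. -/
abbrev V : Type := Fin 3 → ℝ

/-- The Minkowski metric `diag(1,-1,-1)`. -/
def minkowski : Matrix (Fin 3) (Fin 3) ℝ := Matrix.diagonal ![1, -1, -1]

/-- The Minkowski product `x · y = x⁰y⁰ - x¹y¹ - x²y²`. -/
def mdot (x y : V) : ℝ := x 0 * y 0 - x 1 * y 1 - x 2 * y 2

/-- The Minkowski cross product `(x × y)_c = ε_{abc} x^a y^b` with `ε_{012} = 1`, index raised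
with the Minkowski metric. -/
def mcross (x y : V) : V :=
  ![x 1 * y 2 - x 2 * y 1, -(x 2 * y 0 - x 0 * y 2), -(x 0 * y 1 - x 1 * y 0)]

/-- The matrix `n^a J_a` in `so(2,1)`, where `(J_a)_{bc} = -ε_{abc}`
(as an endomorphism of Minkowski space, i.e. with the row index raised). -/
def so21 (n : V) : Matrix (Fin 3) (Fin 3) ℝ :=
  !![0, -n 2, n 1; -n 2, 0, n 0; n 1, -n 0, 0]

/-- `n^a J_a` acts on Minkowski space as the cross product with `n`. -/
theorem so21_mulVec (n x : V) : so21 n *ᵥ x = mcross n x := by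
  funext i
  fin_cases i <;> simp [so21, mcross, Matrix.mulVec, dotProduct, Fin.sum_univ_three] <;> ring

theorem minkowski_mul_self : minkowski * minkowski = 1 := by
  ext i j
  fin_cases i <;> fin_cases j <;> simp [minkowski]

theorem transpose_preserves {M : Matrix (Fin 3) (Fin 3) ℝ} (h : Mᵀ * minkowski * M = minkowski) :
    M * minkowski * Mᵀ = minkowski := by
  have h1 : (minkowski * Mᵀ * minkowski) * M = 1 := by
    calc (minkowski * Mᵀ * minkowski) * M = minkowski * (Mᵀ * minkowski * M) := by
          simp only [Matrix.mul_assoc]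
      _ = 1 := by rw [h, minkowski_mul_self]
  have h2 : M * (minkowski * Mᵀ * minkowski) = 1 := mul_eq_one_comm.mp h1
  calc M * minkowski * Mᵀ = M * (minkowski * Mᵀ * minkowski) * minkowski := by
        simp only [Matrix.mul_assoc, minkowski_mul_self, Matrix.mul_one]
    _ = minkowski := by rw [h2, Matrix.one_mul]

theorem first_column {M : Matrix (Fin 3) (Fin 3) ℝ} (h : Mᵀ * minkowski * M = minkowski) :
    M 0 0 ^ 2 - M 1 0 ^ 2 - M 2 0 ^ 2 = 1 := by
  have h0 := congrFun (congrFun h 0) 0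
  simp [minkowski, Matrix.mul_apply, Fin.sum_univ_three, Matrix.diagonal] at h0
  linarith

theorem time_orientation_mul {M N : Matrix (Fin 3) (Fin 3) ℝ}
    (hM : Mᵀ * minkowski * M = minkowski) (hN : Nᵀ * minkowski * N = minkowski)
    (hM0 : 0 < M 0 0) (hN0 : 0 < N 0 0) : 0 < (M * N) 0 0 := by
  have h1 := first_column (M := Mᵀ) (by simpa using transpose_preserves hM)
  have h2 := first_column hN
  simp only [Matrix.transpose_apply] at h1
  rw [Matrix.mul_apply, Fin.sum_univ_three]
  have hpos : 0 < M 0 0 * N 0 0 := mul_pos hM0 hN0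
  have hlt : (M 0 1 * N 1 0 + M 0 2 * N 2 0) ^ 2 < (M 0 0 * N 0 0) ^ 2 := by
    have e1 : M 0 0 ^ 2 = 1 + M 0 1 ^ 2 + M 0 2 ^ 2 := by linarith
    have e2 : N 0 0 ^ 2 = 1 + N 1 0 ^ 2 + N 2 0 ^ 2 := by linarith
    rw [mul_pow (M 0 0), e1, e2]
    nlinarith [sq_nonneg (M 0 1 * N 2 0 - M 0 2 * N 1 0), sq_nonneg (M 0 1), sq_nonneg (M 0 2),
      sq_nonneg (N 1 0), sq_nonneg (N 2 0)]
  have := (abs_lt_of_sq_lt_sq' hlt hpos.le).1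
  linarith

/-- The proper orthochronous Lorentz group: real 3×3 matrices `M` of determinant one that preserve
the Minkowski metric and the time orientation. -/
def Lorentz : Subgroup (Matrix.SpecialLinearGroup (Fin 3) ℝ) where
  carrier := {M | (M : Matrix (Fin 3) (Fin 3) ℝ)ᵀ * minkowski * M = minkowski ∧
    0 < (M : Matrix (Fin 3) (Fin 3) ℝ) 0 0}
  mul_mem' := by
    rintro M N ⟨hM, hM0⟩ ⟨hN, hN0⟩
    refine ⟨?_, ?_⟩
    · rw [Matrix.SpecialLinearGroup.coe_mul, Matrix.transpose_mul]
      calc _ = (N : Matrix (Fin 3) (Fin 3) ℝ)ᵀ *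
            ((M : Matrix (Fin 3) (Fin 3) ℝ)ᵀ * minkowski * M) * N := by
            simp only [Matrix.mul_assoc]
        _ = minkowski := by rw [hM, hN]
    · rw [Matrix.SpecialLinearGroup.coe_mul]
      exact time_orientation_mul hM hN hM0 hN0
  one_mem' := by
    simp
  inv_mem' := by
    rintro M ⟨hM, hM0⟩
    have hinv : ((M⁻¹ : Matrix.SpecialLinearGroup (Fin 3) ℝ) : Matrix (Fin 3) (Fin 3) ℝ)
        = minkowski * (M : Matrix (Fin 3) (Fin 3) ℝ)ᵀ * minkowski := by
      have h1 : (minkowski * (M : Matrix (Fin 3) (Fin 3) ℝ)ᵀ * minkowski) * M = 1 := by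
        calc _ = minkowski * ((M : Matrix (Fin 3) (Fin 3) ℝ)ᵀ * minkowski * M) := by
              simp only [Matrix.mul_assoc]
          _ = 1 := by rw [hM, minkowski_mul_self]
      have h2 : (M : Matrix (Fin 3) (Fin 3) ℝ) *
          ((M⁻¹ : Matrix.SpecialLinearGroup (Fin 3) ℝ) : Matrix (Fin 3) (Fin 3) ℝ) = 1 := by
        rw [← Matrix.SpecialLinearGroup.coe_mul, mul_inv_cancel, Matrix.SpecialLinearGroup.coe_one]
      exact (left_inv_eq_right_inv h1 h2).symm
    have hT : minkowskiᵀ = minkowski := Matrix.diagonal_transpose _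
    refine ⟨?_, ?_⟩
    · rw [hinv]
      simp only [Matrix.transpose_mul, Matrix.transpose_transpose, hT]
      calc _ = minkowski * ((M : Matrix (Fin 3) (Fin 3) ℝ) * (minkowski * minkowski) * minkowski *
            (M : Matrix (Fin 3) (Fin 3) ℝ)ᵀ) * minkowski := by
            simp only [Matrix.mul_assoc]
        _ = minkowski := by
            rw [minkowski_mul_self, Matrix.mul_one, transpose_preserves hM, minkowski_mul_self,
              Matrix.one_mul]
    · rw [hinv]
      simpa [minkowski, Matrix.mul_apply, Fin.sum_univ_three, Matrix.diagonal] using hM0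

/-- The action of the Lorentz group on Minkowski space (equivalently, the adjoint action on
`so(2,1)`). -/
def Ad (u : Lorentz) : V →ₗ[ℝ] V :=
  Matrix.toLin' ((u : Matrix.SpecialLinearGroup (Fin 3) ℝ) : Matrix (Fin 3) (Fin 3) ℝ)

theorem Ad_one (x : V) : Ad 1 x = x := by
  simp [Ad]

theorem Ad_mul (u v : Lorentz) (x : V) : Ad (u * v) x = Ad u (Ad v x) := by
  simp [Ad]

/-- The Poincaré group `L₃ ⋉ ℝ³`: pairs `(u, a)` of a Lorentz transformation and a translation. -/
@[ext]
structure Poincare where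
  u : Lorentz
  a : V

namespace Poincare

instance : Mul Poincare := ⟨fun h k => ⟨h.u * k.u, h.a + Ad h.u k.a⟩⟩
instance : One Poincare := ⟨⟨1, 0⟩⟩
instance : Inv Poincare := ⟨fun h => ⟨h.u⁻¹, -(Ad h.u⁻¹ h.a)⟩⟩

theorem mul_def (h k : Poincare) : h * k = ⟨h.u * k.u, h.a + Ad h.u k.a⟩ := rfl
theorem one_def : (1 : Poincare) = ⟨1, 0⟩ := rfl
theorem inv_def (h : Poincare) : h⁻¹ = ⟨h.u⁻¹, -(Ad h.u⁻¹ h.a)⟩ := rfl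

instance : Group Poincare :=
  Group.ofLeftAxioms
    (fun h k l => by simp [mul_def, mul_assoc, Ad_mul, add_assoc])
    (fun h => by simp [mul_def, one_def, Ad_one])
    (fun h => by simp [mul_def, one_def, inv_def])

/-- The vector `j` of a Poincaré element, defined by `(u, a) = (u, -Ad(u) j)`. -/
def j (h : Poincare) : V := -(Ad h.u⁻¹ h.a)

/-- The Poincaré element `(u, -Ad(u) j)`. -/
def ofJ (u : Lorentz) (j : V) : Poincare := ⟨u, -(Ad u j)⟩

end Poincare

/-! ### Words in the generators of the surface group -/

/-- Labels `a₁, b₁, …, a_g, b_g` of the standard generators of `π₁(S_g)`; the index `i : Fin g`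
stands for the handle number `i + 1`. -/
inductive Gen (g : ℕ) : Type
  | a (i : Fin g) : Gen g
  | b (i : Fin g) : Gen g
  deriving DecidableEq

/-- The list `[(y₁, β₁), …, (y_s, β_s)]`, `β_k = ±1`, stands for the word
`y_s^{β_s} ∘ … ∘ y₁^{β₁}`: the first letter of the list is the rightmost factor. -/
abbrev Word (g : ℕ) : Type := List (Gen g × ℤˣ)

/-- The product `Y_s^{β_s} ⋯ Y₁^{β₁}` of the group elements `Y = h y` along a word. -/
def evalWord {g : ℕ} {G : Type*} [Group G] (h : Gen g → G) (l : Word g) : G :=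
  (l.reverse.map fun x => h x.1 ^ (x.2 : ℤ)).prod

/-- The commutator `H_i = [B_i, A_i⁻¹] = B_i A_i⁻¹ B_i⁻¹ A_i`. -/
def handle {g : ℕ} {G : Type*} [Group G] (h : Gen g → G) (i : Fin g) : G :=
  h (.b i) * (h (.a i))⁻¹ * (h (.b i))⁻¹ * h (.a i)

/-- The product `H₁⁻¹ H₂⁻¹ ⋯ H_m⁻¹` over the first `m` handles. -/
def handlesInv {g : ℕ} {G : Type*} [Group G] (h : Gen g → G) (m : ℕ) : G :=
  (((List.finRange g).take m).map fun i => (handle h i)⁻¹).prod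

/-! ### The grafting transformation of the holonomies -/

section Transformation

variable {g : ℕ}

/-- The Lorentz components `v_{A_i}, v_{B_i}` of the holonomies along the dual generators,
expressed through the Lorentz components `u_{A_i}, u_{B_i}`:
`v_{A_i} = v₀ u_{H_1}⁻¹⋯u_{H_i}⁻¹ u_{B_i} u_{H_{i-1}}⋯u_{H_1} v₀⁻¹` and
`v_{B_i} = v₀ u_{H_1}⁻¹⋯u_{H_i}⁻¹ u_{A_i} u_{H_{i-1}}⋯u_{H_1} v₀⁻¹`. -/
def dual (v₀ : Lorentz) (u : Gen g → Lorentz) : Gen g → Lorentz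
  | .a i => v₀ * handlesInv u (i + 1) * u (.b i) * (handlesInv u i)⁻¹ * v₀⁻¹
  | .b i => v₀ * handlesInv u (i + 1) * u (.a i) * (handlesInv u i)⁻¹ * v₀⁻¹

/-- `u = exp(α n^a J_a)` with `α > 0` and `n` a unit spacelike vector. -/
def IsAxis (u : Lorentz) (n : V) : Prop :=
  mdot n n = -1 ∧ ∃ α : ℝ, 0 < α ∧
    ((u : Matrix.SpecialLinearGroup (Fin 3) ℝ) : Matrix (Fin 3) (Fin 3) ℝ)
      = NormedSpace.exp (α • so21 n)

open Classical in
/-- The unit spacelike vector `n` with `u = exp(α n^a J_a)`, `α > 0`, of a hyperbolic element `u`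
of the Lorentz group (by convention `0` if `u` is not hyperbolic). -/
def axis (u : Lorentz) : V := if h : ∃ n, IsAxis u n then h.choose else 0

/-- The contribution of the crossings of `λ` with the side `y`:
`∑_{k : X_k = Y, α_k = 1} Ad(v_{X_{k-1}}^{α_{k-1}} ⋯ v_{X_1}^{α_1}) n
  - ∑_{k : X_k = Y, α_k = -1} Ad(v_{X_k}^{α_k} ⋯ v_{X_1}^{α_1}) n`. -/
def crossingSum (v : Gen g → Lorentz) (n : V) (X : Word g) (y : Gen g) : V :=
  (∑ k : Fin X.length with (X.get k).1 = y ∧ (X.get k).2 = 1, Ad (evalWord v (X.take k)) n) -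
  ∑ k : Fin X.length with (X.get k).1 = y ∧ (X.get k).2 = -1, Ad (evalWord v (X.take (k + 1))) n

/-- The parallel transport to the starting point of the side `y`:
`v₀⁻¹ v_{H_1}⁻¹⋯v_{H_{i-1}}⁻¹` for `y = a_i` and
`v₀⁻¹ v_{H_1}⁻¹⋯v_{H_{i-1}}⁻¹ v_{A_i}⁻¹ v_{B_i}` for `y = b_i`. -/
def transport (v₀ : Lorentz) (v : Gen g → Lorentz) : Gen g → Lorentz
  | .a i => v₀⁻¹ * handlesInv v i
  | .b i => v₀⁻¹ * handlesInv v i * (v (.a i))⁻¹ * v (.b i)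

/-- The shift of `j_Y` for the generator `Y`: the transported crossing sum times `w` for `Y = A_i`,
times `-w` for `Y = B_i`. -/
def genShift (w : ℝ) (v₀ : Lorentz) (v : Gen g → Lorentz) (n : V) (X : Word g) : Gen g → V
  | .a i => w • Ad (transport v₀ v (.a i)) (crossingSum v n X (.a i))
  | .b i => -(w • Ad (transport v₀ v (.b i)) (crossingSum v n X (.b i)))

/-- The inverse holonomy `u_{Y_1}^{-β_1} ⋯ u_{Y_m}^{-β_m}` along the first `m` letters of `η`. -/
def prefixInv (u : Gen g → Lorentz) (η : Word g) (m : ℕ) : Lorentz :=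
  ((η.take m).map fun x => u x.1 ^ (-(x.2 : ℤ))).prod

/-- The linear map
`∑_{Y_k = Y, β_k = 1} Ad(u_{Y_1}^{-β_1} ⋯ u_{Y_{k-1}}^{-β_{k-1}})
  - ∑_{Y_k = Y, β_k = -1} Ad(u_{Y_1}^{-β_1} ⋯ u_{Y_k}^{-β_k})` along `η`. -/
def curveSum (u : Gen g → Lorentz) (η : Word g) (y : Gen g) : V →ₗ[ℝ] V :=
  (∑ k : Fin η.length with (η.get k).1 = y ∧ (η.get k).2 = 1, Ad (prefixInv u η k)) -
  ∑ k : Fin η.length with (η.get k).1 = y ∧ (η.get k).2 = -1, Ad (prefixInv u η (k + 1))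

/-- The shift of `j_η` under grafting along `λ` with weight `w`. -/
def graftShift (w : ℝ) (v₀ : Lorentz) (v : Gen g → Lorentz) (n : V) (X : Word g)
    (u : Gen g → Lorentz) (η : Word g) : V :=
  w • (∑ i : Fin g,
      curveSum u η (.a i) (Ad (v₀⁻¹ * handlesInv v i) (crossingSum v n X (.a i)))) -
  w • ∑ i : Fin g,
      curveSum u η (.b i) (Ad (v₀⁻¹ * handlesInv v i * (v (.a i))⁻¹ * v (.b i))
        (crossingSum v n X (.b i)))

/-- The grafting map on `(P₃)^{2g}`. For a tuple of holonomies `h`, the elements `v_X` are the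
Lorentz components of the dual generators and `n` is the axis of `v_{X_r}^{α_r}⋯v_{X_1}^{α_1}`. -/
def Gr (w : ℝ) (v₀ : Lorentz) (X : Word g) (h : Gen g → Poincare) : Gen g → Poincare := fun y =>
  let v := dual v₀ fun z => (h z).u
  Poincare.ofJ (h y).u ((h y).j + genShift w v₀ v (axis (evalWord v X)) X y)

end Transformation

/-! ### Fuchsian groups and their fundamental polygons -/

/-- The hyperbolic plane, realised as the forward unit hyperboloid. -/
def Hyp : Set V := {x | mdot x x = 1 ∧ 0 < x 0}

/-- The geodesic arc between two points of the hyperbolic plane. -/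
def arc (x y : V) : Set V := {z | z ∈ Hyp ∧ ∃ s t : ℝ, 0 ≤ s ∧ 0 ≤ t ∧ z = s • x + t • y}

/-- The interior of a set relative to the hyperbolic plane. -/
def relInterior (P : Set V) : Set V := {x | x ∈ Hyp ∧ P ∈ 𝓝[Hyp] x}

/-- A cocompact Fuchsian group of genus `g` given by its generators `v_{A_i}, v_{B_i}` together
with a geodesic arc `4g`-gon with corners `p₀, …, p_{4g} = p₀`, which is a fundamental region and
whose sides are, in cyclic order, `a₁, b₁, a₁', b₁', …, a_g, b_g, a_g', b_g'`. As oriented arcs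
(with `i = 0, …, g - 1` standing for the handle `i + 1`)
`a : p_{4i} → p_{4i+1}`, `b : p_{4i+2} → p_{4i+1}`, `a' : p_{4i+3} → p_{4i+2}`,
`b' : p_{4i+3} → p_{4i+4}`. -/
structure FundamentalPolygon (g : ℕ) where
  /-- the generators `v_{A_i}`, `v_{B_i}` of the Fuchsian group -/
  gen : Gen g → Lorentz
  /-- the corners -/
  corner : ℕ → V
  /-- the closed polygon -/
  region : Set V
  corner_mem : ∀ k, corner k ∈ Hyp
  corner_closed : corner (4 * g) = corner 0
  corner_inj : ∀ k < 4 * g, ∀ l < 4 * g, corner k = corner l → k = l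
  /-- distinct sides meet at most in common corners -/
  sides_disjoint : ∀ k < 4 * g, ∀ l < 4 * g, k ≠ l →
    ∀ x ∈ arc (corner k) (corner (k + 1)), x ∈ arc (corner l) (corner (l + 1)) →
      x = corner k ∨ x = corner (k + 1)
  region_subset : region ⊆ Hyp
  region_compact : IsCompact region
  /-- the boundary of the polygon is the union of its sides -/
  boundary : region \ relInterior region =
    ⋃ k ∈ Finset.range (4 * g), arc (corner k) (corner (k + 1))
  /-- the boundary is positively oriented: near an inner point of a side, the polygon is the half
  plane `det(p_k, p_{k+1}, y) ≥ 0` -/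
  orientation : ∀ k < 4 * g, ∀ x ∈ arc (corner k) (corner (k + 1)),
    x ≠ corner k → x ≠ corner (k + 1) →
      ∀ᶠ y in 𝓝[Hyp] x, y ∈ region ↔ 0 ≤ Matrix.det (Matrix.of ![corner k, corner (k + 1), y])
  /-- `v_{A_i}` maps the side `a_i` to the side `a_i'` -/
  pair_a : ∀ i : Fin g, Ad (gen (.a i)) (corner (4 * i)) = corner (4 * i + 3) ∧
    Ad (gen (.a i)) (corner (4 * i + 1)) = corner (4 * i + 2)
  /-- `v_{B_i}` maps the side `b_i` to the side `b_i'` -/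
  pair_b : ∀ i : Fin g, Ad (gen (.b i)) (corner (4 * i + 2)) = corner (4 * i + 3) ∧
    Ad (gen (.b i)) (corner (4 * i + 1)) = corner (4 * i + 4)
  /-- the group acts freely, by deck transformations -/
  free : ∀ v ∈ Subgroup.closure (Set.range gen), ∀ x ∈ Hyp, Ad v x = x → v = 1
  /-- the images of the polygon cover the hyperbolic plane … -/
  cover : ∀ x ∈ Hyp, ∃ v ∈ Subgroup.closure (Set.range gen), x ∈ Ad v '' region
  /-- … and their interiors are pairwise disjoint -/
  tile_disjoint : ∀ v ∈ Subgroup.closure (Set.range gen), v ≠ 1 →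
    Disjoint (relInterior region) (Ad v '' relInterior region)

namespace FundamentalPolygon

variable {g : ℕ} (D : FundamentalPolygon g)

/-- The Fuchsian group `Γ`. -/
def group : Subgroup Lorentz := Subgroup.closure (Set.range D.gen)

/-- The sides `a_i`, `b_i` of the polygon. -/
def side : Gen g → Set V
  | .a i => arc (D.corner (4 * i)) (D.corner (4 * i + 1))
  | .b i => arc (D.corner (4 * i + 2)) (D.corner (4 * i + 1))

/-- The holonomies `A_i = γ(p_{4i+1}) γ(p_{4i})⁻¹` and `B_i = γ(p_{4i+1}) γ(p_{4i+2})⁻¹` along the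
sides `a_i`, `b_i`, of the gauge field on the surface with trivialising function `γ` on the
polygon; the argument is the function `γ⁻¹`. -/
def holonomy (γinv : V → Poincare) : Gen g → Poincare
  | .a i => (γinv (D.corner (4 * i + 1)))⁻¹ * γinv (D.corner (4 * i))
  | .b i => (γinv (D.corner (4 * i + 1)))⁻¹ * γinv (D.corner (4 * i + 2))

end FundamentalPolygon

/-- The Lorentz component `v_st` of the trivialising function `γ_st⁻¹ = (v_st, x_st)` of the static
spacetime, subject to the overlap condition `v_st|_{y'} = v_Y v_st|_y`. -/
structure StaticFrame {g : ℕ} (D : FundamentalPolygon g) where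
  v : V → Lorentz
  overlap : ∀ y : Gen g, ∀ x ∈ D.side y, v (Ad (D.gen y) x) = D.gen y * v x

/-- The trivialising function `γ_st⁻¹(T, x) = (v_st(x), T x)` of the static spacetime. -/
def StaticFrame.static {g : ℕ} {D : FundamentalPolygon g} (F : StaticFrame D) (T : ℝ) (x : V) :
    Poincare := ⟨F.v x, T • x⟩

/-- The geodesic `c_{p,q}(t) = cosh t p + sinh t q`. -/
def geod (p q : V) (t : ℝ) : V := Real.cosh t • p + Real.sinh t • q

/-- A simple closed geodesic on the surface `Hyp / Γ`, given by a lift `c_{p,q}` that starts in the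
polygon, its length `len` and its holonomy `hol = exp(len n^a J_a) ∈ Γ` with `n = p × q`, such that
no corner of the tesselation lies on the lift. -/
structure SimpleClosedGeodesic {g : ℕ} (D : FundamentalPolygon g) where
  p : V
  q : V
  len : ℝ
  hol : Lorentz
  p_mem : p ∈ D.region
  q_unit : mdot q q = -1
  orth : mdot p q = 0
  len_pos : 0 < len
  hol_mem : hol ∈ D.group
  hol_eq : ((hol : Matrix.SpecialLinearGroup (Fin 3) ℝ) : Matrix (Fin 3) (Fin 3) ℝ)
    = NormedSpace.exp (len • so21 (mcross p q))
  /-- the projection to the surface is injective on one period -/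
  simple : ∀ s ∈ Set.Ico 0 len, ∀ t ∈ Set.Ico 0 len, ∀ v ∈ D.group,
    Ad v (geod p q s) = geod p q t → s = t
  avoids_corners : ∀ v ∈ D.group, ∀ k < 4 * g, ∀ t : ℝ, Ad v (D.corner k) ≠ geod p q t

namespace SimpleClosedGeodesic

variable {g : ℕ} {D : FundamentalPolygon g} (c : SimpleClosedGeodesic D)

/-- The unit normal vector `n_{p,q} = p × q` of the lift. -/
def normal : V := mcross c.p c.q

/-- The word `v_{X_r}^{α_r} ⋯ v_{X_1}^{α_1}` records the polygons traversed by the lift in one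
period: the holonomy is `v_{X_r}^{α_r} ⋯ v_{X_1}^{α_1}`, and there are times
`0 = s₀ ≤ s₁ < ⋯ < s_r ≤ s_{r+1} = len` such that the lift is, between the times `s_k` and
`s_{k+1}`, in the polygon `v_{X_r}^{α_r} ⋯ v_{X_{r-k+1}}^{α_{r-k+1}} P`, where `P` is the
fundamental polygon. -/
def IsItinerary (X : Word g) : Prop :=
  evalWord D.gen X = c.hol ∧
  ∃ s : ℕ → ℝ, s 0 = 0 ∧ s (X.length + 1) = c.len ∧
    (∀ k ≤ X.length, s k ≤ s (k + 1)) ∧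
    (∀ k, 1 ≤ k → k < X.length → s k < s (k + 1)) ∧
    ∀ k ≤ X.length, ∀ t ∈ Set.Icc (s k) (s (k + 1)),
      geod c.p c.q t ∈ Ad (evalWord D.gen (X.drop (X.length - k))) '' D.region

/-- The unit normal vectors `Ad(v) n_{p,q}`, `v ∈ Γ`, of the geodesics `Ad(v) c_{p,q}` of the
`Γ`-invariant multicurve lifting the closed geodesic. Each geodesic of the multicurve is the
intersection of `Hyp` with the plane orthogonal to exactly one of these vectors. -/
def normals : Set V := {m | ∃ v ∈ D.group, m = Ad v c.normal}

/-- The set of points on the geodesics of the multicurve. -/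
def multicurve : Set V := {x | ∃ v ∈ D.group, ∃ t : ℝ, x = Ad v (geod c.p c.q t)}

/-- The (normals of the) geodesics of the multicurve that intersect the arc from the base point
`p₀` to `x`. -/
def crossed (x : V) : Set V :=
  {m | m ∈ c.normals ∧ (arc (D.corner 0) x ∩ {z | mdot m z = 0}).Nonempty}

open Classical in
/-- The map `ρ(x) = w ∑ ε m`, the sum over all geodesics of the multicurve that intersect the arc
from the base point `p₀` to `x`, where `m` is the unit normal vector and the sign `ε = ±1` is such
that `ε m` points towards `x` (as `m · m = -1`, the vector `m` points into the half space
`m · z < 0`). -/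
def rho (w : ℝ) (x : V) : V :=
  w • ∑ᶠ m ∈ c.crossed x, (if mdot m x < 0 then (1 : ℝ) else -1) • m

/-- The trivialising function of the grafted spacetime at cosmological time `T`, at the points `x`
outside the multicurve: `γ⁻¹(T, x) = (v_st(x), T x + ρ(x))`. -/
def grafted (F : StaticFrame D) (w T : ℝ) (x : V) : Poincare := ⟨F.v x, T • x + c.rho w x⟩

end SimpleClosedGeodesic

end

end Grafting

namespace Grafting

noncomputable section

/-! ### Minkowski geometry -/

/-! Let `jump x y` be the sum of the unit normals of the geodesics of the multicurve that separate
`x` from `y`, each signed so as to point towards `y`. The sign is a difference of half-space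
indicators (`beyond`), so `jump` is additive in its end points and equivariant under Γ, and off the
multicurve `ρ(x) = w · jump p₀ x` (`rho_eq`). Equivariance gives `ρ(v x) = ρ(v p₀) + Ad(v) ρ(x)`
(`rho_Ad`), which is the overlap condition; finiteness of the sums comes from discreteness of Γ
(`finite_setOf_time_le`). The surface relation is then algebra at the corners: an overlap condition
makes each handle a quotient of corner values, and the product telescopes
(`CornerOverlap.prod_handle`).

Grafting shifts `j` of a side from `q_i` to `q_f` by `Ad(v_st(q_i)⁻¹)(ρ(q_f) - ρ(q_i))`. The
geometric core is that the jump along a side is the crossing sum (`Traversal.jump_eq_crossingSum`):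
the geodesics separating the two corners of the side `y` correspond one to one to the letters `X_k =
y` of the itinerary (`Traversal.bijOn`), and `α_k` is the direction of the crossing. Injectivity
rests on simplicity of λ, by which an element of Γ that takes a point of the lift to a point of the
lift is a power of the holonomy (`eq_hol_zpow`). Surjectivity holds because a lift that avoids the
corners meets a side transversally and so has to change the tile (`not_stay_in_tile`).

To recover the side from the letter, distinct generators must be distinct elements of Γ, and no
generator may be the inverse of another or of itself. As the polygon need not be convex, two tiles
might a priori share several sides; homology excludes this. Integers at the corners, interpolated
along the sides, yield a continuous Γ-invariant function with values in `ℝ/ℤ`; the increments of its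
real lift realise a character with arbitrary prescribed values on the generators
(`exists_potential`).

The rule `j(hk) = Ad(k⁻¹) j(h) + j(k)` carries the shifts from generators to words
(`evalWord_shift`). For the map on all tuples it remains to recover the generators of Γ and the
normal from the static holonomies (`CornerOverlap.dual_eq`, `axis_eq`). -/

theorem mdot_comm (x y : V) : mdot x y = mdot y x := by simp only [mdot]; ring

theorem mdot_add_left (x y z : V) : mdot (x + y) z = mdot x z + mdot y z := by
  simp only [mdot, Pi.add_apply]; ring

theorem mdot_add_right (x y z : V) : mdot x (y + z) = mdot x y + mdot x z := by
  simp only [mdot, Pi.add_apply]; ring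

theorem mdot_smul_left (s : ℝ) (x y : V) : mdot (s • x) y = s * mdot x y := by
  simp only [mdot, Pi.smul_apply, smul_eq_mul]; ring

theorem mdot_smul_right (s : ℝ) (x y : V) : mdot x (s • y) = s * mdot x y := by
  simp only [mdot, Pi.smul_apply, smul_eq_mul]; ring

theorem mdot_neg_left (x y : V) : mdot (-x) y = -mdot x y := by
  simp only [mdot, Pi.neg_apply]; ring

theorem mdot_ext {x y : V} (h : ∀ z, mdot x z = mdot y z) : x = y := by
  have h0 := h ![1, 0, 0]
  have h1 := h ![0, 1, 0]
  have h2 := h ![0, 0, 1]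
  simp [mdot] at h0 h1 h2
  funext i
  fin_cases i <;> assumption

@[fun_prop]
theorem continuous_mdot {α : Type*} [TopologicalSpace α] {f h : α → V} (hf : Continuous f)
    (hh : Continuous h) : Continuous fun a => mdot (f a) (h a) := by
  unfold mdot; fun_prop

theorem mdot_mcross_eq_det (x y z : V) :
    mdot (mcross x y) z = Matrix.det (Matrix.of ![x, y, z]) := by
  simp [mdot, mcross, Matrix.det_fin_three]; ring

theorem mdot_mcross_swap (x y z : V) : mdot (mcross x y) z = -mdot (mcross y x) z := by
  simp [mdot, mcross]; ring

theorem mdot_mcross_self_left (x y : V) : mdot (mcross x y) x = 0 := by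
  simp [mdot, mcross]; ring

theorem mdot_mcross_self_right (x y : V) : mdot (mcross x y) y = 0 := by
  simp [mdot, mcross]; ring

theorem mdot_mcross_mcross (x y : V) :
    mdot (mcross x y) (mcross x y) = mdot x x * mdot y y - mdot x y ^ 2 := by
  simp [mdot, mcross]; ring

theorem Ad_apply (u : Lorentz) (x : V) :
    Ad u x = ((u : Matrix.SpecialLinearGroup (Fin 3) ℝ) : Matrix (Fin 3) (Fin 3) ℝ) *ᵥ x := rfl

@[fun_prop]
theorem continuous_Ad (u : Lorentz) : Continuous (Ad u) :=
  LinearMap.continuous_of_finiteDimensional _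

theorem Ad_inv_Ad (u : Lorentz) (x : V) : Ad u⁻¹ (Ad u x) = x := by
  rw [← Ad_mul, inv_mul_cancel, Ad_one]

theorem Ad_Ad_inv (u : Lorentz) (x : V) : Ad u (Ad u⁻¹ x) = x := by
  rw [← Ad_mul, mul_inv_cancel, Ad_one]

theorem Ad_injective (u : Lorentz) : Function.Injective (Ad u) :=
  Function.LeftInverse.injective (Ad_inv_Ad u)

theorem mem_Ad_image {u : Lorentz} {S : Set V} {x : V} : x ∈ Ad u '' S ↔ Ad u⁻¹ x ∈ S := by
  constructor
  · rintro ⟨y, hy, rfl⟩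
    rwa [Ad_inv_Ad]
  · exact fun h => ⟨_, h, Ad_Ad_inv u x⟩

theorem mdot_eq_dotProduct (x y : V) : mdot x y = x ⬝ᵥ (minkowski *ᵥ y) := by
  simp [mdot, minkowski, dotProduct, Fin.sum_univ_three, Matrix.mulVec_diagonal]; ring

theorem mdot_Ad (u : Lorentz) (x y : V) : mdot (Ad u x) (Ad u y) = mdot x y := by
  have h := u.2.1
  rw [mdot_eq_dotProduct, mdot_eq_dotProduct, Ad_apply, Ad_apply]
  conv_rhs => rw [← h]
  rw [Matrix.mul_assoc, ← Matrix.mulVec_mulVec, Matrix.dotProduct_mulVec x, Matrix.vecMul_transpose,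
    Matrix.mulVec_mulVec]

theorem mdot_Ad_left (u : Lorentz) (x y : V) : mdot (Ad u x) y = mdot x (Ad u⁻¹ y) := by
  rw [← mdot_Ad u x, Ad_Ad_inv]

/-- Paired with a third vector the cross product is a determinant, and a Lorentz transformation has
determinant one. -/
theorem mcross_Ad (u : Lorentz) (x y : V) : mcross (Ad u x) (Ad u y) = Ad u (mcross x y) := by
  refine mdot_ext fun z => ?_
  rw [mdot_Ad_left, ← Ad_Ad_inv u z, Ad_inv_Ad]
  generalize Ad u⁻¹ z = z
  rw [mdot_mcross_eq_det, mdot_mcross_eq_det]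
  have : Matrix.of ![Ad u x, Ad u y, Ad u z] = Matrix.of ![x, y, z] *
      ((u : Matrix.SpecialLinearGroup (Fin 3) ℝ) : Matrix (Fin 3) (Fin 3) ℝ)ᵀ := by
    ext i j
    fin_cases i <;>
      simp [Ad_apply, Matrix.mul_apply, Matrix.mulVec, dotProduct, Fin.sum_univ_three] <;> ring
  rw [this, Matrix.det_mul, Matrix.det_transpose, Matrix.SpecialLinearGroup.det_coe, mul_one]

/-- Reversed Cauchy–Schwarz inequality; the product is the hyperbolic cosine of the distance. -/
theorem one_le_mdot {x y : V} (hx : x ∈ Hyp) (hy : y ∈ Hyp) : 1 ≤ mdot x y := by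
  obtain ⟨hx1, hx0⟩ := hx
  obtain ⟨hy1, hy0⟩ := hy
  simp only [mdot] at *
  have hpos : 0 < x 0 * y 0 := mul_pos hx0 hy0
  have key : (1 + x 1 * y 1 + x 2 * y 2) ^ 2 ≤ (x 0 * y 0) ^ 2 := by
    have e1 : x 0 ^ 2 = 1 + x 1 ^ 2 + x 2 ^ 2 := by linarith
    have e2 : y 0 ^ 2 = 1 + y 1 ^ 2 + y 2 ^ 2 := by linarith
    rw [mul_pow, e1, e2]
    nlinarith [sq_nonneg (x 1 * y 2 - x 2 * y 1), sq_nonneg (x 1 - y 1), sq_nonneg (x 2 - y 2)]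
  have := abs_le_of_sq_le_sq' key hpos.le
  linarith [this.2]

theorem eq_of_mdot_eq_one {x y : V} (hx : x ∈ Hyp) (hy : y ∈ Hyp) (h : mdot x y = 1) : x = y := by
  obtain ⟨hx1, hx0⟩ := hx
  obtain ⟨hy1, hy0⟩ := hy
  simp only [mdot] at *
  have e1 : x 0 ^ 2 = 1 + x 1 ^ 2 + x 2 ^ 2 := by linarith
  have e2 : y 0 ^ 2 = 1 + y 1 ^ 2 + y 2 ^ 2 := by linarith
  have key : (x 1 * y 2 - x 2 * y 1) ^ 2 + (x 1 - y 1) ^ 2 + (x 2 - y 2) ^ 2 = 0 := by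
    have h3 : x 0 * y 0 = 1 + x 1 * y 1 + x 2 * y 2 := by linarith
    have h4 : (x 0 * y 0) ^ 2 = (1 + x 1 * y 1 + x 2 * y 2) ^ 2 := by rw [h3]
    rw [mul_pow, e1, e2] at h4
    linarith
  have k1 : x 1 = y 1 := by
    nlinarith [sq_nonneg (x 1 * y 2 - x 2 * y 1), sq_nonneg (x 1 - y 1), sq_nonneg (x 2 - y 2)]
  have k2 : x 2 = y 2 := by
    nlinarith [sq_nonneg (x 1 * y 2 - x 2 * y 1), sq_nonneg (x 1 - y 1), sq_nonneg (x 2 - y 2)]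
  have k0 : x 0 = y 0 := by
    have : x 0 ^ 2 = y 0 ^ 2 := by rw [e1, e2, k1, k2]
    exact (pow_left_inj₀ hx0.le hy0.le two_ne_zero).1 this
  funext i
  fin_cases i <;> assumption

theorem one_lt_mdot {x y : V} (hx : x ∈ Hyp) (hy : y ∈ Hyp) (h : x ≠ y) : 1 < mdot x y :=
  lt_of_le_of_ne (one_le_mdot hx hy) fun e => h (eq_of_mdot_eq_one hx hy e.symm)

/-- The time component of a unit timelike vector with positive product with a point of the
hyperbolic plane is positive. -/
theorem mem_Hyp_of_mdot_pos {x y : V} (hx : x ∈ Hyp) (hy : mdot y y = 1) (h : 0 < mdot x y) :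
    y ∈ Hyp := by
  refine ⟨hy, ?_⟩
  by_contra hneg
  have h0 : y 0 ≠ 0 := by
    intro h0
    simp only [mdot, h0] at hy
    nlinarith [sq_nonneg (y 1), sq_nonneg (y 2)]
  have h1 : -y ∈ Hyp := by
    refine ⟨?_, ?_⟩
    · simpa [mdot] using hy
    · have : y 0 < 0 := lt_of_le_of_ne (not_lt.1 hneg) h0
      simpa using this
  have := one_le_mdot h1 hx
  rw [mdot_neg_left, mdot_comm] at this
  linarith

/-- A Lorentz transformation maps the base point `(1, 0, 0)` into the hyperbolic plane. -/
theorem Ad_basePoint_mem (u : Lorentz) : Ad u ![1, 0, 0] ∈ Hyp := by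
  refine ⟨?_, ?_⟩
  · rw [mdot_Ad]; simp [mdot]
  · have := u.2.2
    simpa [Ad_apply, Matrix.mulVec, dotProduct, Fin.sum_univ_three] using this

theorem basePoint_mem : (![1, 0, 0] : V) ∈ Hyp := by simp [Hyp, mdot]

theorem Ad_mem_Hyp (u : Lorentz) {x : V} (hx : x ∈ Hyp) : Ad u x ∈ Hyp := by
  refine mem_Hyp_of_mdot_pos (Ad_basePoint_mem u) (by rw [mdot_Ad]; exact hx.1) ?_
  rw [mdot_Ad]
  linarith [one_le_mdot basePoint_mem hx]

/-- The triangle inequality through the base point `(1, 0, 0)`, in the form `cosh (a + b) ≤ 2 cosh a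
cosh b`. -/
theorem time_le_mul_mdot {x y : V} (hx : x ∈ Hyp) (hy : y ∈ Hyp) : y 0 ≤ 2 * x 0 * mdot x y := by
  obtain ⟨hx1, hx0⟩ := hx
  obtain ⟨hy1, hy0⟩ := hy
  simp only [mdot] at *
  have e1 : x 1 ^ 2 + x 2 ^ 2 = x 0 ^ 2 - 1 := by linarith
  have e2 : y 1 ^ 2 + y 2 ^ 2 = y 0 ^ 2 - 1 := by linarith
  have hx1' : 1 ≤ x 0 ^ 2 := by nlinarith [sq_nonneg (x 1), sq_nonneg (x 2)]
  have hA : 0 ≤ (2 * x 0 ^ 2 - 1) * y 0 := mul_nonneg (by linarith) hy0.le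
  have cs : (2 * x 0 * (x 1 * y 1 + x 2 * y 2)) ^ 2 ≤ ((2 * x 0 ^ 2 - 1) * y 0) ^ 2 := by
    have c1 : (x 1 * y 1 + x 2 * y 2) ^ 2 ≤ (x 0 ^ 2 - 1) * (y 0 ^ 2 - 1) := by
      rw [← e1, ← e2]; nlinarith [sq_nonneg (x 1 * y 2 - x 2 * y 1)]
    have c2 : 4 * x 0 ^ 2 * (x 1 * y 1 + x 2 * y 2) ^ 2 ≤
        4 * x 0 ^ 2 * ((x 0 ^ 2 - 1) * (y 0 ^ 2 - 1)) := by gcongr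
    nlinarith [mul_nonneg (sq_nonneg (x 0)) (sub_nonneg.2 hx1'), sq_nonneg (y 0)]
  have := (abs_le_of_sq_le_sq' cs hA).2
  nlinarith

/-- A nonnegative combination of two points of the hyperbolic plane, scaled back to it. -/
theorem normalize_mem_Hyp {x y : V} (hx : x ∈ Hyp) (hy : y ∈ Hyp) {s t : ℝ} (hs : 0 ≤ s)
    (ht : 0 ≤ t) (h : 0 < s + t) :
    0 < mdot (s • x + t • y) (s • x + t • y) ∧
      (Real.sqrt (mdot (s • x + t • y) (s • x + t • y)))⁻¹ • (s • x + t • y) ∈ Hyp := by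
  have hD := one_le_mdot hx hy
  have hpos : 0 < mdot (s • x + t • y) (s • x + t • y) := by
    have e : mdot (s • x + t • y) (s • x + t • y) = (s + t) ^ 2 + 2 * (s * t) * (mdot x y - 1) := by
      simp only [mdot_add_left, mdot_add_right, mdot_smul_left, mdot_smul_right, hx.1, hy.1,
        mdot_comm y x]
      ring
    rw [e]
    have := mul_nonneg (mul_nonneg hs ht) (sub_nonneg.2 hD)
    nlinarith [pow_pos h 2]
  refine ⟨hpos, mem_Hyp_of_mdot_pos hx ?_ ?_⟩
  · rw [mdot_smul_left, mdot_smul_right]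
    have h1 := Real.mul_self_sqrt hpos.le
    have h2 := Real.sqrt_pos.2 hpos
    field_simp
    nlinarith
  · have h2 := Real.sqrt_pos.2 hpos
    have e : mdot x (s • x + t • y) = s + t * mdot x y := by
      rw [mdot_add_right, mdot_smul_right, mdot_smul_right, hx.1, mul_one]
    rw [mdot_smul_right, e]
    refine mul_pos (inv_pos.2 h2) ?_
    nlinarith [mul_nonneg ht (sub_nonneg.2 hD)]

/-! ### Geodesics -/

/-- The orthogonal expansion of a vector in the frame of a geodesic. -/
theorem frame_expansion {p q : V} (hp : mdot p p = 1) (hq : mdot q q = -1) (h : mdot p q = 0)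
    (x : V) : x = mdot x p • p - mdot x q • q - mdot x (mcross p q) • mcross p q := by
  have hn : mdot (mcross p q) (mcross p q) = -1 := by rw [mdot_mcross_mcross, hp, hq, h]; ring
  have key : mdot (mcross p q) (mcross p q) • x = mdot x (mcross p q) • mcross p q +
      (mdot x p * mdot q q - mdot x q * mdot p q) • p +
      (mdot x q * mdot p p - mdot x p * mdot p q) • q := by
    funext i
    fin_cases i <;> simp [mdot, mcross, Matrix.vecHead, Matrix.vecTail] <;> ring
  rw [hn, hp, hq, h] at key
  calc x = -((-1 : ℝ) • x) := by module
    _ = _ := by rw [key]; module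

theorem mdot_geod {p q : V} (hp : mdot p p = 1) (hq : mdot q q = -1) (h : mdot p q = 0) (t : ℝ) :
    mdot (geod p q t) (geod p q t) = 1 := by
  simp only [geod, mdot_add_left, mdot_add_right, mdot_smul_left, mdot_smul_right, hp, hq, h,
    mdot_comm q p]
  linarith [Real.cosh_sq_sub_sinh_sq t]

theorem geod_mem_Hyp {p q : V} (hp : p ∈ Hyp) (hq : mdot q q = -1) (h : mdot p q = 0) (t : ℝ) :
    geod p q t ∈ Hyp := by
  refine mem_Hyp_of_mdot_pos hp (mdot_geod hp.1 hq h t) ?_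
  simp only [geod, mdot_add_right, mdot_smul_right, hp.1, h]
  linarith [Real.cosh_pos t]

/-- The unit tangent vector of the geodesic `c_{p,q}`. -/
def geodTangent (p q : V) (t : ℝ) : V := Real.sinh t • p + Real.cosh t • q

theorem geod_add (p q : V) (t h : ℝ) :
    geod p q (t + h) = Real.cosh h • geod p q t + Real.sinh h • geodTangent p q t := by
  simp only [geod, geodTangent, Real.cosh_add, Real.sinh_add]
  module

theorem mcross_geod (p q : V) (t : ℝ) : mcross (geod p q t) (geodTangent p q t) = mcross p q := by
  have h := Real.cosh_sq_sub_sinh_sq t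
  simp only [mcross, geod, geodTangent, Pi.add_apply, Pi.smul_apply, smul_eq_mul]
  funext i
  fin_cases i <;> simp
  · linear_combination (p 1 * q 2 - p 2 * q 1) * h
  · linear_combination (p 0 * q 2 - p 2 * q 0) * h
  · linear_combination (p 1 * q 0 - p 0 * q 1) * h

theorem mdot_normal_geod (p q : V) (t : ℝ) : mdot (mcross p q) (geod p q t) = 0 := by
  rw [geod, mdot_add_right, mdot_smul_right, mdot_smul_right, mdot_mcross_self_left,
    mdot_mcross_self_right]
  ring

/-- A geodesic is the intersection of the hyperbolic plane with the plane orthogonal to its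
normal vector. -/
theorem exists_geod_eq {p q : V} (hp : p ∈ Hyp) (hq : mdot q q = -1) (h : mdot p q = 0) {x : V}
    (hx : x ∈ Hyp) (hn : mdot (mcross p q) x = 0) : ∃ t, x = geod p q t := by
  have e := frame_expansion hp.1 hq h x
  rw [mdot_comm x (mcross p q), hn, zero_smul, sub_zero] at e
  have h1 := one_le_mdot hx hp
  have h2 : mdot x p ^ 2 - mdot x q ^ 2 = 1 := by
    have h3 := hx.1
    rw [e] at h3
    simp only [sub_eq_add_neg, ← neg_smul, mdot_add_left, mdot_add_right, mdot_smul_left,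
      mdot_smul_right, hp.1, hq, h, mdot_comm q p] at h3
    linarith
  refine ⟨Real.arsinh (-mdot x q), ?_⟩
  rw [geod, Real.sinh_arsinh, Real.cosh_arsinh]
  have : Real.sqrt (1 + (-mdot x q) ^ 2) = mdot x p := by
    rw [show 1 + (-mdot x q) ^ 2 = mdot x p ^ 2 by linarith]
    exact Real.sqrt_sq (by linarith)
  rw [this, neg_smul, ← sub_eq_add_neg]
  exact e

theorem geod_injective {p q : V} (hq : mdot q q = -1) (h : mdot p q = 0) :
    Function.Injective (geod p q) := by
  intro s t hst
  have := congrArg (mdot q) hst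
  simp only [geod, mdot_add_right, mdot_smul_right, mdot_comm q p, h, hq] at this
  exact Real.sinh_injective (by linarith)

@[fun_prop]
theorem continuous_geod (p q : V) : Continuous (geod p q) := by
  unfold geod
  have := Real.continuous_cosh
  have := Real.continuous_sinh
  fun_prop

/-! ### Geodesic arcs -/

theorem left_mem_arc {x : V} (hx : x ∈ Hyp) (y : V) : x ∈ arc x y :=
  ⟨hx, 1, 0, by norm_num, le_rfl, by simp⟩

theorem arc_comm (x y : V) : arc x y = arc y x := by
  ext z
  constructor <;> rintro ⟨h, s, t, hs, ht, rfl⟩ <;> exact ⟨h, t, s, ht, hs, add_comm _ _⟩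

theorem right_mem_arc (x : V) {y : V} (hy : y ∈ Hyp) : y ∈ arc x y :=
  arc_comm y x ▸ left_mem_arc hy x

theorem Ad_mem_arc (u : Lorentz) {x y z : V} (h : z ∈ arc x y) : Ad u z ∈ arc (Ad u x) (Ad u y) := by
  obtain ⟨hz, s, t, hs, ht, rfl⟩ := h
  exact ⟨Ad_mem_Hyp u hz, s, t, hs, ht, by simp⟩

theorem Ad_mem_arc_iff (u : Lorentz) {x y z : V} : Ad u z ∈ arc (Ad u x) (Ad u y) ↔ z ∈ arc x y :=
  ⟨fun h => by simpa [Ad_inv_Ad] using Ad_mem_arc u⁻¹ h, Ad_mem_arc u⟩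

theorem zero_notMem_Hyp : (0 : V) ∉ Hyp := by simp [Hyp, mdot]

/-- An inner point of an arc is a positive combination of its end points. -/
theorem exists_pos_of_mem_arc {x y z : V} (hx : x ∈ Hyp) (hy : y ∈ Hyp) (hz : z ∈ arc x y)
    (hzx : z ≠ x) (hzy : z ≠ y) : ∃ s t : ℝ, 0 < s ∧ 0 < t ∧ z = s • x + t • y := by
  obtain ⟨h, s, t, hs, ht, rfl⟩ := hz
  have aux : ∀ {a : V} {r : ℝ}, a ∈ Hyp → 0 ≤ r → r • a ∈ Hyp → r • a = a := by
    intro a r ha hr hra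
    have h1 := hra.1
    rw [mdot_smul_left, mdot_smul_right, ha.1] at h1
    have : r = 1 := by nlinarith
    rw [this, one_smul]
  refine ⟨s, t, lt_of_le_of_ne hs ?_, lt_of_le_of_ne ht ?_, rfl⟩
  · rintro rfl
    rw [zero_smul, zero_add] at h hzy
    exact hzy (aux hy ht h)
  · rintro rfl
    rw [zero_smul, add_zero] at h hzx
    exact hzx (aux hx hs h)

/-- Since `s² + t² + 2 s t (x · y) = 1` and `x · y ≥ 1`, both coefficients are at most one. -/
theorem mem_arc_time_le {x y z : V} (hx : x ∈ Hyp) (hy : y ∈ Hyp) (hz : z ∈ arc x y) :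
    z 0 ≤ x 0 + y 0 := by
  obtain ⟨h, s, t, hs, ht, rfl⟩ := hz
  have h1 := h.1
  simp only [mdot_add_left, mdot_add_right, mdot_smul_left, mdot_smul_right, hx.1, hy.1,
    mdot_comm y x] at h1
  have h2 := mul_nonneg (mul_nonneg hs ht) (sub_nonneg.2 (one_le_mdot hx hy))
  have h3 := mul_nonneg hs ht
  have hs1 : s ≤ 1 := by nlinarith
  have ht1 : t ≤ 1 := by nlinarith
  simp only [Pi.add_apply, Pi.smul_apply, smul_eq_mul]
  nlinarith [hx.2, hy.2]

/-! ### The exponential of a hyperbolic generator -/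

section Exp

attribute [local instance] Matrix.linftyOpNormedRing Matrix.linftyOpNormedAlgebra

/-- The columns of `E` are annihilated by `A - μ`, so the exponential series acts on them as the
scalar series. -/
theorem exp_mul_of_mul_eq_smul {A E : Matrix (Fin 3) (Fin 3) ℝ} {μ : ℝ} (h : A * E = μ • E) :
    NormedSpace.exp A * E = Real.exp μ • E := by
  have h1 : ∀ k : ℕ, A ^ k * E = μ ^ k • E := by
    intro k
    induction k with
    | zero => simp
    | succ k ih => rw [pow_succ', Matrix.mul_assoc, ih, Matrix.mul_smul, h, smul_smul, pow_succ]
  have hA := (NormedSpace.exp_series_hasSum_exp' (𝕂 := ℝ) A).mul_right E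
  have hμ := (NormedSpace.exp_series_hasSum_exp' (𝕂 := ℝ) μ).smul_const E
  rw [Real.exp_eq_exp_ℝ]
  have e : (fun k : ℕ => ((k.factorial : ℝ)⁻¹ • A ^ k) * E) =
      fun k : ℕ => ((k.factorial : ℝ)⁻¹ • μ ^ k) • E := by
    funext k
    rw [Matrix.smul_mul, h1, smul_smul, smul_eq_mul]
  rw [e] at hA
  exact hA.unique hμ

end Exp

theorem so21_cube {n : V} (hn : mdot n n = -1) : so21 n * (so21 n * so21 n) = so21 n := by
  have h : n 0 * n 0 - n 1 * n 1 - n 2 * n 2 = -1 := hn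
  ext i j
  fin_cases i <;> fin_cases j <;> simp [so21, Matrix.mul_apply, Fin.sum_univ_three]
  · ring
  · linear_combination n 2 * h
  · linear_combination -n 1 * h
  · linear_combination n 2 * h
  · ring
  · linear_combination -n 0 * h
  · linear_combination -n 1 * h
  · linear_combination n 0 * h
  · ring

theorem exp_smul_so21 {n : V} (hn : mdot n n = -1) (α : ℝ) :
    NormedSpace.exp (α • so21 n) =
      1 + Real.sinh α • so21 n + (Real.cosh α - 1) • (so21 n * so21 n) := by
  set N := so21 n with hN
  have h3 : N * (N * N) = N := so21_cube hn
  have hp : NormedSpace.exp (α • N) * (N * N + N) = Real.exp α • (N * N + N) :=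
    exp_mul_of_mul_eq_smul (by
      rw [Matrix.smul_mul, Matrix.mul_add, h3, add_comm])
  have hm : NormedSpace.exp (α • N) * (N * N - N) = Real.exp (-α) • (N * N - N) :=
    exp_mul_of_mul_eq_smul (by
      rw [Matrix.smul_mul, Matrix.mul_sub, h3]; module)
  have h0 : NormedSpace.exp (α • N) * (1 - N * N) = Real.exp 0 • (1 - N * N) :=
    exp_mul_of_mul_eq_smul (by
      rw [Matrix.smul_mul, Matrix.mul_sub, h3, Matrix.mul_one, sub_self, smul_zero, zero_smul])
  -- The splitting `1 = (1 - N²) + (N² + N)/2 + (N² - N)/2` is into the spectral projections for the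
  -- eigenvalues `0`, `1`, `-1`.
  have e : NormedSpace.exp (α • N) = NormedSpace.exp (α • N) * (1 - N * N) +
      (2⁻¹ : ℝ) • (NormedSpace.exp (α • N) * (N * N + N)) +
      (2⁻¹ : ℝ) • (NormedSpace.exp (α • N) * (N * N - N)) := by
    rw [← Matrix.mul_smul, ← Matrix.mul_smul, ← Matrix.mul_add, ← Matrix.mul_add]
    conv_lhs => rw [← Matrix.mul_one (NormedSpace.exp (α • N))]
    congr 1
    module
  rw [e, hp, hm, h0, Real.sinh_eq, Real.cosh_eq, Real.exp_zero]
  module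

/-- The trace `1 + 2 cosh α` determines `α > 0`. Suitable combinations of opposite off-diagonal
entries cancel the part quadratic in the axis and leave `sinh α` times its components. Since `axis`
is a choice, this uniqueness is what identifies it. -/
theorem IsAxis.unique {u : Lorentz} {m n : V} (hm : IsAxis u m) (hn : IsAxis u n) : m = n := by
  obtain ⟨hm1, α, hα, hu⟩ := hm
  obtain ⟨hn1, β, hβ, hu'⟩ := hn
  have h := hu.symm.trans hu'
  rw [exp_smul_so21 hm1, exp_smul_so21 hn1] at h
  have hm2 : m 0 * m 0 - m 1 * m 1 - m 2 * m 2 = -1 := hm1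
  have hn2 : n 0 * n 0 - n 1 * n 1 - n 2 * n 2 = -1 := hn1
  have hij : ∀ i j, _ := fun i j => congrFun (congrFun h i) j
  simp only [so21, Matrix.add_apply, Matrix.smul_apply, smul_eq_mul, Matrix.mul_apply,
    Fin.sum_univ_three] at hij
  have h00 := hij 0 0
  have h11 := hij 1 1
  have h22 := hij 2 2
  have h01 := hij 0 1
  have h10 := hij 1 0
  have h02 := hij 0 2
  have h20 := hij 2 0
  have h12 := hij 1 2
  have h21 := hij 2 1
  simp at h00 h11 h22 h01 h10 h02 h20 h12 h21
  have hcosh : Real.cosh α = Real.cosh β := by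
    linear_combination (1 / 2) * (h00 + h11 + h22) + (Real.cosh α - 1) * hm2 -
      (Real.cosh β - 1) * hn2
  have hαβ : α = β := by
    have := Real.cosh_abs α ▸ Real.cosh_abs β ▸ hcosh
    have h1 : |α| ≤ |β| := Real.cosh_le_cosh.1 hcosh.le
    have h2 : |β| ≤ |α| := Real.cosh_le_cosh.1 hcosh.ge
    rw [abs_of_pos hα, abs_of_pos hβ] at h1 h2
    exact le_antisymm h1 h2
  subst hαβ
  have hs : Real.sinh α ≠ 0 := (Real.sinh_pos_iff.2 hα).ne'
  funext i
  fin_cases i <;> refine mul_left_cancel₀ hs ?_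
  · show Real.sinh α * m 0 = Real.sinh α * n 0
    linear_combination (1 / 2) * (h12 - h21)
  · show Real.sinh α * m 1 = Real.sinh α * n 1
    linear_combination (1 / 2) * (h02 + h20)
  · show Real.sinh α * m 2 = Real.sinh α * n 2
    linear_combination (-1 / 2) * (h01 + h10)

theorem axis_eq {u : Lorentz} {n : V} (h : IsAxis u n) : axis u = n := by
  have hex : ∃ m, IsAxis u m := ⟨n, h⟩
  rw [axis, dif_pos hex]
  exact hex.choose_spec.unique h

theorem mcross_mcross_left {p q : V} (hp : mdot p p = 1) (h : mdot p q = 0) :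
    mcross (mcross p q) p = q := by
  simp only [mdot] at hp h
  funext i
  fin_cases i <;> simp [mcross]
  · linear_combination q 0 * hp - p 0 * h
  · linear_combination q 1 * hp - p 1 * h
  · linear_combination q 2 * hp - p 2 * h

theorem mcross_mcross_right {p q : V} (hq : mdot q q = -1) (h : mdot p q = 0) :
    mcross (mcross p q) q = p := by
  simp only [mdot] at hq h
  funext i
  fin_cases i <;> simp [mcross]
  · linear_combination -p 0 * hq + q 0 * h
  · linear_combination -p 1 * hq + q 1 * h
  · linear_combination -p 2 * hq + q 2 * h

theorem exp_so21_mulVec {n x y : V} (hn : mdot n n = -1) (hx : mcross n x = y)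
    (hy : mcross n y = x) (α : ℝ) :
    NormedSpace.exp (α • so21 n) *ᵥ x = Real.cosh α • x + Real.sinh α • y := by
  rw [exp_smul_so21 hn, Matrix.add_mulVec, Matrix.add_mulVec, Matrix.one_mulVec,
    Matrix.smul_mulVec, Matrix.smul_mulVec, ← Matrix.mulVec_mulVec, so21_mulVec, hx,
    so21_mulVec, hy]
  module

/-! ### The closed geodesic -/

namespace SimpleClosedGeodesic

variable {g : ℕ} {D : FundamentalPolygon g} (c : SimpleClosedGeodesic D)

/-- The lift of the closed geodesic that starts in the polygon. -/
def lift (t : ℝ) : V := geod c.p c.q t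

theorem p_mem_Hyp : c.p ∈ Hyp := D.region_subset c.p_mem

theorem lift_mem_Hyp (t : ℝ) : c.lift t ∈ Hyp := geod_mem_Hyp c.p_mem_Hyp c.q_unit c.orth t

theorem lift_injective : Function.Injective c.lift := geod_injective c.q_unit c.orth

theorem continuous_lift : Continuous c.lift := continuous_geod _ _

theorem normal_unit : mdot c.normal c.normal = -1 := by
  rw [normal, mdot_mcross_mcross, c.p_mem_Hyp.1, c.q_unit, c.orth]; ring

theorem mdot_normal_lift (t : ℝ) : mdot c.normal (c.lift t) = 0 := mdot_normal_geod _ _ t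

theorem exists_lift_eq {x : V} (hx : x ∈ Hyp) (h : mdot c.normal x = 0) : ∃ t, x = c.lift t :=
  exists_geod_eq c.p_mem_Hyp c.q_unit c.orth hx h

/-- As `n × p = q` and `n × q = p`, the one-parameter group generated by `n` is the boost in the
plane of `p` and `q`. -/
theorem hol_lift (t : ℝ) : Ad c.hol (c.lift t) = c.lift (t + c.len) := by
  have h1 := mcross_mcross_left c.p_mem_Hyp.1 c.orth
  have h2 := mcross_mcross_right c.q_unit c.orth
  have hn : mdot (mcross c.p c.q) (mcross c.p c.q) = -1 := c.normal_unit
  rw [lift, lift, geod, map_add, map_smul, map_smul, Ad_apply, Ad_apply, c.hol_eq,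
    exp_so21_mulVec hn h1 h2, exp_so21_mulVec hn h2 h1, geod, Real.cosh_add,
    Real.sinh_add]
  module

theorem hol_zpow_lift (b : ℤ) (t : ℝ) : Ad (c.hol ^ b) (c.lift t) = c.lift (t + b * c.len) := by
  have hinv : ∀ t, Ad c.hol⁻¹ (c.lift t) = c.lift (t - c.len) := fun t => by
    rw [← sub_add_cancel t c.len, ← c.hol_lift, Ad_inv_Ad]
    simp
  induction b with
  | zero => simp [Ad_one]
  | succ n ih => rw [zpow_add_one, ← Commute.eq (Commute.self_zpow c.hol n).eq, Ad_mul, ih,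
      c.hol_lift]; push_cast; ring_nf
  | pred n ih =>
      rw [zpow_sub_one, ← Commute.eq ((Commute.refl c.hol).inv_left.zpow_right _).eq, Ad_mul, ih,
        hinv]
      push_cast; ring_nf

theorem hol_zpow_mem (b : ℤ) : c.hol ^ b ∈ D.group := D.group.zpow_mem c.hol_mem b

/-- The elements of the group that map a point of the lift to a point of the lift are the powers
of the holonomy of the geodesic. -/
theorem eq_hol_zpow {v : Lorentz} (hv : v ∈ D.group) {s t : ℝ} (h : Ad v (c.lift s) = c.lift t) :
    ∃ b : ℤ, v = c.hol ^ b ∧ t = s + b * c.len := by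
  -- Powers of the holonomy move both times into one period; there simplicity makes them equal, and
  -- freeness makes the conjugated element trivial.
  have key : ∀ r : ℝ, ∃ b : ℤ, r + b * c.len ∈ Set.Ico 0 c.len := fun r => by
    obtain ⟨b, hb, -⟩ := existsUnique_add_zsmul_mem_Ico c.len_pos r 0
    exact ⟨b, by simpa using hb⟩
  obtain ⟨a, ha⟩ := key s
  obtain ⟨b, hb⟩ := key t
  have h1 : Ad (c.hol ^ b * v * c.hol ^ (-a)) (c.lift (s + a * c.len)) =
      c.lift (t + b * c.len) := by
    rw [Ad_mul, c.hol_zpow_lift, Ad_mul, ← c.hol_zpow_lift b t, ← h]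
    congr 3
    push_cast; ring
  have hmem : c.hol ^ b * v * c.hol ^ (-a) ∈ D.group :=
    D.group.mul_mem (D.group.mul_mem (c.hol_zpow_mem b) hv) (c.hol_zpow_mem _)
  have hst := c.simple _ ha _ hb _ hmem h1
  rw [← hst] at h1
  have h2 := D.free _ hmem _ (c.lift_mem_Hyp _) h1
  refine ⟨a - b, ?_, ?_⟩
  · have : v = (c.hol ^ b)⁻¹ * (c.hol ^ b * v * c.hol ^ (-a)) * c.hol ^ a := by group
    rw [this, h2]
    group
  · push_cast; linarith

/-- The elements of the group that fix the normal vector are the powers of the holonomy. -/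
theorem eq_hol_zpow_of_Ad_normal {v : Lorentz} (hv : v ∈ D.group)
    (h : mdot c.normal (Ad v (c.lift 0)) = 0) : ∃ b : ℤ, v = c.hol ^ b := by
  obtain ⟨t, ht⟩ := c.exists_lift_eq (Ad_mem_Hyp v (c.lift_mem_Hyp 0)) h
  obtain ⟨b, hb, -⟩ := c.eq_hol_zpow hv ht
  exact ⟨b, hb⟩

theorem Ad_hol_zpow_normal (b : ℤ) : Ad (c.hol ^ b) c.normal = c.normal := by
  have h1 : Ad c.hol c.normal = c.normal := by
    have hn : mdot (mcross c.p c.q) (mcross c.p c.q) = -1 := c.normal_unit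
    rw [Ad_apply, c.hol_eq, exp_smul_so21 hn, Matrix.add_mulVec, Matrix.add_mulVec,
      Matrix.one_mulVec, Matrix.smul_mulVec, Matrix.smul_mulVec, ← Matrix.mulVec_mulVec]
    have : so21 (mcross c.p c.q) *ᵥ c.normal = 0 := by
      rw [so21_mulVec, normal]
      funext i
      fin_cases i <;> simp [mcross] <;> ring
    rw [this]
    simp
  have h2 : Ad c.hol⁻¹ c.normal = c.normal := by
    conv_lhs => rw [← h1, Ad_inv_Ad]
  induction b with
  | zero => simp [Ad_one]
  | succ n ih => rw [zpow_add_one, Ad_mul, h1, ih]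
  | pred n ih => rw [zpow_sub_one, Ad_mul, h2, ih]

/-- The element `u⁻¹ v` keeps a point of the lift in the plane of the lift. Hence a normal
determines its group element up to the cyclic group of the holonomy. -/
theorem eq_mul_hol_zpow {u v : Lorentz} (hu : u ∈ D.group) (hv : v ∈ D.group)
    (h : Ad u c.normal = Ad v c.normal) : ∃ b : ℤ, v = u * c.hol ^ b := by
  obtain ⟨b, hb⟩ := c.eq_hol_zpow_of_Ad_normal (D.group.mul_mem (D.group.inv_mem hu) hv) (by
    rw [Ad_mul, ← mdot_Ad u, Ad_Ad_inv, h, mdot_Ad, c.mdot_normal_lift])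
  exact ⟨b, by rw [← hb]; group⟩

theorem isAxis_hol : IsAxis c.hol c.normal := ⟨c.normal_unit, c.len, c.len_pos, c.hol_eq⟩

end SimpleClosedGeodesic

/-! ### Words, handles and the Poincaré group -/

section Words

variable {g : ℕ} {G : Type*} [Group G]

theorem evalWord_nil (h : Gen g → G) : evalWord h [] = 1 := rfl

theorem evalWord_append (h : Gen g → G) (l m : Word g) :
    evalWord h (l ++ m) = evalWord h m * evalWord h l := by
  simp [evalWord]

theorem evalWord_cons (h : Gen g → G) (x : Gen g × ℤˣ) (l : Word g) :
    evalWord h (x :: l) = evalWord h l * h x.1 ^ (x.2 : ℤ) := by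
  simp [evalWord]

theorem evalWord_take_succ (h : Gen g → G) (l : Word g) (k : Fin l.length) :
    evalWord h (l.take (k + 1)) =
      h (l.get k).1 ^ ((l.get k).2 : ℤ) * evalWord h (l.take k) := by
  rw [List.take_add_one, evalWord_append]
  simp [evalWord]

theorem evalWord_mem {h : Gen g → G} {S : Subgroup G} (hS : ∀ y, h y ∈ S) (l : Word g) :
    evalWord h l ∈ S := by
  induction l with
  | nil => exact S.one_mem
  | cons x l ih =>
    rw [evalWord_cons]
    exact S.mul_mem ih (S.zpow_mem (hS _) _)

theorem handlesInv_zero (h : Gen g → G) : handlesInv h 0 = 1 := rfl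

theorem handlesInv_succ (h : Gen g → G) (i : Fin g) :
    handlesInv h (i + 1) = handlesInv h i * (handle h i)⁻¹ := by
  rw [handlesInv, List.take_add_one, List.map_append, List.prod_append, ← handlesInv]
  simp

/-- If the handles are quotients of consecutive terms of a sequence, the product telescopes. -/
theorem handlesInv_eq_of_handle_eq_inv_mul {h : Gen g → G} {γ : ℕ → G}
    (hh : ∀ i : Fin g, handle h i = (γ (4 * i + 4))⁻¹ * γ (4 * i)) {m : ℕ} (hm : m ≤ g) :
    handlesInv h m = (γ 0)⁻¹ * γ (4 * m) := by
  induction m with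
  | zero => simp [handlesInv_zero]
  | succ m ih =>
    rw [handlesInv_succ h ⟨m, hm⟩, ih (by omega), hh]
    simp [mul_add, mul_assoc]

theorem handlesInv_eq_of_handle_eq_mul_inv {h : Gen g → G} {γ : ℕ → G}
    (hh : ∀ i : Fin g, handle h i = γ (4 * i + 4) * (γ (4 * i))⁻¹) {m : ℕ} (hm : m ≤ g) :
    handlesInv h m = γ 0 * (γ (4 * m))⁻¹ :=
  (handlesInv_eq_of_handle_eq_inv_mul (γ := fun k => (γ k)⁻¹) (by simpa using hh) hm).trans
    (by simp)

theorem prod_reverse_handle (h : Gen g → G) :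
    ((List.finRange g).reverse.map (handle h)).prod = (handlesInv h g)⁻¹ := by
  rw [handlesInv, List.prod_inv_reverse, List.take_of_length_le (by simp), List.map_map,
    List.map_reverse]
  congr 2
  exact List.map_congr_left fun i _ => by simp

end Words

namespace Poincare

@[simp] theorem mul_u (h k : Poincare) : (h * k).u = h.u * k.u := rfl
@[simp] theorem mul_a (h k : Poincare) : (h * k).a = h.a + Ad h.u k.a := rfl
@[simp] theorem one_u : (1 : Poincare).u = 1 := rfl
@[simp] theorem inv_u (h : Poincare) : h⁻¹.u = h.u⁻¹ := rfl
@[simp] theorem inv_a (h : Poincare) : h⁻¹.a = -(Ad h.u⁻¹ h.a) := rfl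
@[simp] theorem ofJ_u (u : Lorentz) (x : V) : (ofJ u x).u = u := rfl

@[simp] theorem ofJ_j (u : Lorentz) (x : V) : (ofJ u x).j = x := by
  simp [ofJ, j, Ad_inv_Ad]

theorem j_mul (h k : Poincare) : (h * k).j = Ad k.u⁻¹ h.j + k.j := by
  simp only [j, mul_u, mul_a, mul_inv_rev, Ad_mul, map_add, map_neg, Ad_inv_Ad, neg_add]

theorem j_inv (h : Poincare) : h⁻¹.j = -(Ad h.u h.j) := by
  simp [j, Ad_Ad_inv]

/-- The projection to the Lorentz component. -/
def lorentzHom : Poincare →* Lorentz where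
  toFun := u
  map_one' := rfl
  map_mul' _ _ := rfl

theorem u_zpow (h : Poincare) (k : ℤ) : (h ^ k).u = h.u ^ k := map_zpow lorentzHom h k

end Poincare

/-! ### Propagation of shifts from generators to words -/

section Shift

variable {g : ℕ}

theorem evalWord_u (h : Gen g → Poincare) (η : Word g) :
    (evalWord h η).u = evalWord (fun y => (h y).u) η := by
  induction η with
  | nil => rfl
  | cons x η ih => rw [evalWord_cons, evalWord_cons, Poincare.mul_u, ih, Poincare.u_zpow]

theorem prefixInv_cons_succ (u : Gen g → Lorentz) (x : Gen g × ℤˣ) (η : Word g) (m : ℕ) :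
    prefixInv u (x :: η) (m + 1) = u x.1 ^ (-(x.2 : ℤ)) * prefixInv u η m := by
  simp [prefixInv]

theorem prefixInv_zero (u : Gen g → Lorentz) (η : Word g) : prefixInv u η 0 = 1 := by
  simp [prefixInv]

theorem curveSum_nil (u : Gen g → Lorentz) (y : Gen g) (z : V) : curveSum u [] y z = 0 := by
  simp [curveSum]

theorem curveSum_apply (u : Gen g → Lorentz) (η : Word g) (y : Gen g) (z : V) :
    curveSum u η y z = ∑ k : Fin η.length, ((if (η.get k).1 = y ∧ (η.get k).2 = 1 then
      Ad (prefixInv u η k) z else 0) - if (η.get k).1 = y ∧ (η.get k).2 = -1 then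
      Ad (prefixInv u η (k + 1)) z else 0) := by
  rw [curveSum, LinearMap.sub_apply, LinearMap.sum_apply, LinearMap.sum_apply, Finset.sum_filter,
    Finset.sum_filter, Finset.sum_sub_distrib]

/-- The shift of `j` by one letter of a word, for a shift `z` of the corresponding generator. -/
def letterShift (u : Lorentz) (β : ℤˣ) (z : V) : V := if β = 1 then z else -(Ad u z)

theorem letterShift_neg (u : Lorentz) (β : ℤˣ) (z : V) :
    letterShift u β (-z) = -letterShift u β z := by
  unfold letterShift; split_ifs <;> simp

theorem letterShift_smul (u : Lorentz) (β : ℤˣ) (w : ℝ) (z : V) :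
    letterShift u β (w • z) = w • letterShift u β z := by
  unfold letterShift; split_ifs <;> simp

/-- The head of the list is the rightmost factor, so its inverse transports all later contributions.
For exponent `-1` the longer prefix in the sum matches the extra `Ad` in `j` of an inverse. -/
theorem curveSum_cons (u : Gen g → Lorentz) (x : Gen g × ℤˣ) (η : Word g) (y : Gen g) (z : V) :
    curveSum u (x :: η) y z = (if x.1 = y then letterShift (u x.1) x.2 z else 0) +
      Ad (u x.1 ^ (-(x.2 : ℤ))) (curveSum u η y z) := by
  rw [curveSum_apply, curveSum_apply, map_sum]
  refine (Fin.sum_univ_succ (n := η.length) _).trans ?_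
  congr 1
  · rcases Int.units_eq_one_or x.2 with h | h <;> by_cases hy : x.1 = y <;>
      simp [h, hy, letterShift, prefixInv_zero, Ad_one, prefixInv_cons_succ]
  · refine Finset.sum_congr rfl fun k _ => ?_
    rw [map_sub, apply_ite (Ad _), apply_ite (Ad _), map_zero, ← Ad_mul, ← Ad_mul,
      ← prefixInv_cons_succ, ← prefixInv_cons_succ]
    rfl

theorem j_zpow_unit (h : Poincare) (β : ℤˣ) : (h ^ (β : ℤ)).j = letterShift h.u β h.j := by
  rcases Int.units_eq_one_or β with rfl | rfl
  · simp [letterShift]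
  · simp [letterShift, Poincare.j_inv]

theorem letterShift_add (u : Lorentz) (β : ℤˣ) (y z : V) :
    letterShift u β (y + z) = letterShift u β y + letterShift u β z := by
  unfold letterShift; split_ifs <;> simp [add_comm]

theorem graftShift_cons (w : ℝ) (v₀ : Lorentz) (v : Gen g → Lorentz) (n : V) (X : Word g)
    (u : Gen g → Lorentz) (x : Gen g × ℤˣ) (η : Word g) :
    graftShift w v₀ v n X u (x :: η) = letterShift (u x.1) x.2 (genShift w v₀ v n X x.1) +
      Ad (u x.1 ^ (-(x.2 : ℤ))) (graftShift w v₀ v n X u η) := by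
  simp only [graftShift, curveSum_cons, Finset.sum_add_distrib, smul_add, map_sub, map_smul,
    map_sum]
  obtain ⟨i | i, β⟩ := x
  · simp only [Gen.a.injEq, Finset.sum_ite_eq, Finset.mem_univ, if_true, reduceCtorEq, if_false,
      Finset.sum_const_zero, genShift, transport, letterShift_smul, smul_zero]
    abel
  · simp only [Gen.b.injEq, Finset.sum_ite_eq, Finset.mem_univ, if_true, reduceCtorEq, if_false,
      Finset.sum_const_zero, genShift, transport, letterShift_smul, letterShift_neg, smul_zero]
    abel

/-- The effect on the holonomies of all words of a shift of the vectors `j` of the generators. -/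
theorem evalWord_shift {h h' : Gen g → Poincare} (w : ℝ) (v₀ : Lorentz) (v : Gen g → Lorentz)
    (n : V) (X : Word g)
    (hs : ∀ y, h' y = Poincare.ofJ (h y).u ((h y).j + genShift w v₀ v n X y)) (η : Word g) :
    (evalWord h' η).u = (evalWord h η).u ∧ (evalWord h' η).j = (evalWord h η).j +
      graftShift w v₀ v n X (fun y => (h y).u) η := by
  have hu : ∀ η, (evalWord h' η).u = (evalWord h η).u := fun η => by
    rw [evalWord_u, evalWord_u]
    congr 1
    funext y
    rw [hs, Poincare.ofJ_u]
  refine ⟨hu η, ?_⟩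
  induction η with
  | nil => simp [evalWord_nil, graftShift, curveSum_nil]
  | cons x η ih =>
    rw [evalWord_cons, evalWord_cons, Poincare.j_mul, Poincare.j_mul, ih, graftShift_cons,
      j_zpow_unit, j_zpow_unit, Poincare.u_zpow, Poincare.u_zpow, hs, Poincare.ofJ_u,
      Poincare.ofJ_j, letterShift_add, map_add, ← zpow_neg]
    abel

theorem evalWord_Gr (w : ℝ) (v₀ : Lorentz) (X : Word g) (h : Gen g → Poincare) (η : Word g) :
    let u : Gen g → Lorentz := fun y => (h y).u
    let v : Gen g → Lorentz := dual v₀ u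
    (evalWord (Gr w v₀ X h) η).u = (evalWord h η).u ∧
    (evalWord (Gr w v₀ X h) η).j = (evalWord h η).j +
      graftShift w v₀ v (axis (evalWord v X)) X u η :=
  evalWord_shift w v₀ _ _ X (fun _ => rfl) η

end Shift

/-! ### Points near an arc -/

/-- A point of the hyperbolic plane on the plane orthogonal to a spacelike vector is a limit of
points on either side of the plane. -/
theorem frequently_mdot_pos {m x : V} (hx : x ∈ Hyp) (hm : mdot m m < 0) (h : mdot m x = 0) :
    ∃ᶠ z in 𝓝[Hyp] x, 0 < mdot m z := by
  -- Normalising `m` gives the geodesic through `x` perpendicular to the plane; since `m · m < 0`,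
  -- the product with `m` is positive at negative times.
  set r : ℝ := (Real.sqrt (-mdot m m))⁻¹ with hr
  have hr0 : 0 < r := inv_pos.2 (Real.sqrt_pos.2 (by linarith))
  have hrm : r * (r * mdot m m) = -1 := by
    have h1 := Real.mul_self_sqrt (show 0 ≤ -mdot m m by linarith)
    have h2 := Real.sqrt_pos.2 (show 0 < -mdot m m by linarith)
    rw [hr]
    field_simp
    nlinarith
  have hgeod : ∀ t, geod x (r • m) t ∈ Hyp := geod_mem_Hyp hx
    (by rw [mdot_smul_left, mdot_smul_right, hrm])
    (by rw [mdot_smul_right, mdot_comm, h, mul_zero])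
  have ht : Filter.Tendsto (geod x (r • m)) (𝓝[<] 0) (𝓝[Hyp] x) := by
    refine tendsto_nhdsWithin_iff.2 ⟨?_, Filter.Eventually.of_forall hgeod⟩
    have := ((continuous_geod x (r • m)).tendsto 0).mono_left (nhdsWithin_le_nhds (s := Set.Iio 0))
    simpa [geod] using this
  refine ht.frequently (Filter.Eventually.frequently ?_)
  filter_upwards [self_mem_nhdsWithin] with t (ht : t < 0)
  rw [geod, mdot_add_right, mdot_smul_right, mdot_smul_right, h, mdot_smul_right, mul_zero,
    zero_add]
  have := Real.sinh_neg_iff.2 ht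
  exact mul_pos_of_neg_of_neg this (mul_neg_of_pos_of_neg hr0 hm)

/-- A parametrisation of the geodesic arc between two points. -/
def arcPath (x y : V) (t : ℝ) : V :=
  (Real.sqrt (mdot ((1 - t) • x + t • y) ((1 - t) • x + t • y)))⁻¹ • ((1 - t) • x + t • y)

section ArcPath

variable {x y : V}

theorem arcPath_zero (hx : x ∈ Hyp) : arcPath x y 0 = x := by simp [arcPath, hx.1]

theorem arcPath_one (hy : y ∈ Hyp) : arcPath x y 1 = y := by simp [arcPath, hy.1]

theorem continuousOn_arcPath (hx : x ∈ Hyp) (hy : y ∈ Hyp) :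
    ContinuousOn (arcPath x y) (Set.Icc 0 1) := by
  unfold arcPath
  have h1 : Continuous fun t : ℝ => (1 - t) • x + t • y := by fun_prop
  have h2 : Continuous fun t : ℝ =>
      Real.sqrt (mdot ((1 - t) • x + t • y) ((1 - t) • x + t • y)) :=
    (continuous_mdot h1 h1).sqrt
  refine ContinuousOn.smul (ContinuousOn.inv₀ h2.continuousOn fun t ht => ?_) h1.continuousOn
  exact (Real.sqrt_pos.2 (normalize_mem_Hyp hx hy (sub_nonneg.2 ht.2) ht.1 (by linarith)).1).ne'

theorem arcPath_mem (hx : x ∈ Hyp) (hy : y ∈ Hyp) {t : ℝ} (ht : t ∈ Set.Icc (0 : ℝ) 1) :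
    arcPath x y t ∈ arc x y := by
  obtain ⟨h1, h2⟩ := normalize_mem_Hyp hx hy (sub_nonneg.2 ht.2) ht.1 (by linarith)
  have h3 := inv_nonneg.2 (Real.sqrt_nonneg
    (mdot ((1 - t) • x + t • y) ((1 - t) • x + t • y)))
  refine ⟨h2, _, _, mul_nonneg h3 (sub_nonneg.2 ht.2), mul_nonneg h3 ht.1, ?_⟩
  rw [arcPath, smul_add, smul_smul, smul_smul]

/-- Distinct points are linearly independent, as their Gram determinant `1 - (x · y)²` is nonzero.
-/
theorem eq_zero_of_combination_eq_left (hx : x ∈ Hyp) (hy : y ∈ Hyp) (hxy : x ≠ y) {s t : ℝ}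
    (h : s • x + t • y = x) : t = 0 := by
  have hD := one_lt_mdot hx hy hxy
  have h1 := congrArg (mdot x) h
  have h2 := congrArg (mdot y) h
  simp only [mdot_add_right, mdot_smul_right, hx.1, hy.1, mdot_comm y x] at h1 h2
  have h3 : t * (mdot x y ^ 2 - 1) = 0 := by linear_combination mdot x y * h1 - h2
  rcases mul_eq_zero.1 h3 with h4 | h4
  · exact h4
  · nlinarith

theorem arcPath_ne_left (hx : x ∈ Hyp) (hy : y ∈ Hyp) (hxy : x ≠ y) {t : ℝ}
    (ht : t ∈ Set.Ioc (0 : ℝ) 1) : arcPath x y t ≠ x := by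
  intro h
  have hpos := Real.sqrt_pos.2 (normalize_mem_Hyp hx hy (sub_nonneg.2 ht.2) ht.1.le (by linarith)).1
  rw [arcPath, smul_add, smul_smul, smul_smul] at h
  have := eq_zero_of_combination_eq_left hx hy hxy h
  rcases mul_eq_zero.1 this with h1 | h1
  · exact (inv_pos.2 hpos).ne' h1
  · exact ht.1.ne' h1

theorem arcPath_ne_right (hx : x ∈ Hyp) (hy : y ∈ Hyp) (hxy : x ≠ y) {t : ℝ}
    (ht : t ∈ Set.Ico (0 : ℝ) 1) : arcPath x y t ≠ y := by
  intro h
  have hpos := Real.sqrt_pos.2 (normalize_mem_Hyp hx hy (sub_nonneg.2 ht.2.le) ht.1 (by linarith)).1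
  rw [arcPath, smul_add, smul_smul, smul_smul, add_comm] at h
  have := eq_zero_of_combination_eq_left hy hx hxy.symm h
  rcases mul_eq_zero.1 this with h1 | h1
  · exact (inv_pos.2 hpos).ne' h1
  · linarith [ht.2]

end ArcPath

theorem relInterior_mem_nhdsWithin {P : Set V} {x : V} (h : x ∈ relInterior P) :
    relInterior P ∈ 𝓝[Hyp] x := by
  have := eventually_eventually_nhdsWithin.2 h.2
  filter_upwards [this, self_mem_nhdsWithin] with y hy hy'
  exact ⟨hy', hy⟩

theorem tendsto_Ad_nhdsWithin (v : Lorentz) (x : V) :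
    Filter.Tendsto (Ad v) (𝓝[Hyp] x) (𝓝[Hyp] (Ad v x)) :=
  tendsto_nhdsWithin_iff.2 ⟨((continuous_Ad v).tendsto x).mono_left nhdsWithin_le_nhds,
    by filter_upwards [self_mem_nhdsWithin] with y hy using Ad_mem_Hyp v hy⟩

/-! ### The tesselation -/

namespace FundamentalPolygon

variable {g : ℕ} (D : FundamentalPolygon g)

theorem gen_mem (y : Gen g) : D.gen y ∈ D.group := Subgroup.subset_closure ⟨y, rfl⟩

/-- The side with number `k`. -/
def edge (k : ℕ) : Set V := arc (D.corner k) (D.corner (k + 1))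

/-- The inner points of the side with number `k`. -/
def innerEdge (k : ℕ) : Set V := {x | x ∈ D.edge k ∧ x ≠ D.corner k ∧ x ≠ D.corner (k + 1)}

/-- The oriented distance (up to monotone rescaling) from the geodesic through the side with
number `k`. -/
def height (k : ℕ) (x : V) : ℝ := mdot (mcross (D.corner k) (D.corner (k + 1))) x

variable {D}

theorem corner_ne_corner_succ (hg : 2 ≤ g) {k : ℕ} (hk : k < 4 * g) :
    D.corner k ≠ D.corner (k + 1) := by
  intro h
  rcases Nat.lt_or_ge (k + 1) (4 * g) with h1 | h1
  · have := D.corner_inj k hk (k + 1) h1 h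
    omega
  · have h2 : k + 1 = 4 * g := by omega
    rw [h2, D.corner_closed] at h
    have := D.corner_inj k hk 0 (by omega) h
    omega

theorem height_eq_zero {k : ℕ} {x : V} (hx : x ∈ D.edge k) : D.height k x = 0 := by
  obtain ⟨-, s, t, -, -, rfl⟩ := hx
  rw [height, mdot_add_right, mdot_smul_right, mdot_smul_right, mdot_mcross_self_left,
    mdot_mcross_self_right]
  ring

theorem continuous_height (k : ℕ) : Continuous (D.height k) := by
  unfold height; fun_prop

theorem eventually_mem_region_iff {k : ℕ} (hk : k < 4 * g) {x : V} (hx : x ∈ D.innerEdge k) :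
    ∀ᶠ y in 𝓝[Hyp] x, y ∈ D.region ↔ 0 ≤ D.height k y := by
  simpa only [height, mdot_mcross_eq_det] using D.orientation k hk x hx.1 hx.2.1 hx.2.2

theorem normal_spacelike (hg : 2 ≤ g) {k : ℕ} (hk : k < 4 * g) :
    mdot (mcross (D.corner k) (D.corner (k + 1))) (mcross (D.corner k) (D.corner (k + 1))) < 0 := by
  rw [mdot_mcross_mcross, (D.corner_mem _).1, (D.corner_mem _).1]
  nlinarith [one_lt_mdot (D.corner_mem k) (D.corner_mem (k + 1)) (corner_ne_corner_succ hg hk)]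

theorem mem_relInterior_of_height_pos {k : ℕ} {z : V} (hz : z ∈ Hyp)
    (h : ∀ᶠ y in 𝓝[Hyp] z, y ∈ D.region ↔ 0 ≤ D.height k y) (hpos : 0 < D.height k z) :
    z ∈ relInterior D.region := by
  refine ⟨hz, ?_⟩
  have : Filter.Tendsto (D.height k) (𝓝[Hyp] z) (𝓝 (D.height k z)) :=
    ((continuous_height k).tendsto z).mono_left nhdsWithin_le_nhds
  filter_upwards [h, this.eventually (lt_mem_nhds hpos)] with y hy hy'
  exact hy.2 hy'.le

theorem edge_subset_boundary {k : ℕ} (hk : k < 4 * g) :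
    D.edge k ⊆ D.region \ relInterior D.region := by
  rw [D.boundary]
  exact Set.subset_biUnion_of_mem (u := fun k => arc (D.corner k) (D.corner (k + 1)))
    (Finset.mem_coe.2 (Finset.mem_range.2 hk))

theorem edge_subset_region {k : ℕ} (hk : k < 4 * g) : D.edge k ⊆ D.region :=
  fun _ hx => (edge_subset_boundary hk hx).1

theorem exists_mem_edge {x : V} (hx : x ∈ D.region) (hx' : x ∉ relInterior D.region) :
    ∃ k < 4 * g, x ∈ D.edge k := by
  have : x ∈ D.region \ relInterior D.region := ⟨hx, hx'⟩
  rw [D.boundary] at this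
  simpa [edge] using this

theorem mem_innerEdge_or_corner {x : V} (hx : x ∈ D.region) (hx' : x ∉ relInterior D.region) :
    (∃ k < 4 * g, x ∈ D.innerEdge k) ∨ ∃ k < 4 * g, x = D.corner k := by
  obtain ⟨k, hk, hxk⟩ := exists_mem_edge hx hx'
  by_cases h0 : x = D.corner k
  · exact Or.inr ⟨k, hk, h0⟩
  by_cases h1 : x = D.corner (k + 1)
  · rcases Nat.lt_or_ge (k + 1) (4 * g) with h2 | h2
    · exact Or.inr ⟨k + 1, h2, h1⟩
    · have h3 : k + 1 = 4 * g := by omega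
      rw [h3, D.corner_closed] at h1
      exact Or.inr ⟨0, by omega, h1⟩
  · exact Or.inl ⟨k, hk, hxk, h0, h1⟩

/-- The polygon is contained in the closure of its interior. -/
theorem frequently_mem_relInterior (hg : 2 ≤ g) {x : V} (hx : x ∈ D.region) :
    ∃ᶠ z in 𝓝[Hyp] x, z ∈ relInterior D.region := by
  have hinner : ∀ k < 4 * g, ∀ x ∈ D.innerEdge k,
      ∃ᶠ z in 𝓝[Hyp] x, z ∈ relInterior D.region := by
    intro k hk x hx
    have hev := eventually_eventually_nhdsWithin.2 (eventually_mem_region_iff hk hx)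
    refine ((frequently_mdot_pos hx.1.1 (normal_spacelike hg hk)
      (height_eq_zero hx.1)).and_eventually (hev.and self_mem_nhdsWithin)).mono ?_
    rintro z ⟨h1, h2, h3⟩
    exact mem_relInterior_of_height_pos h3 h2 h1
  by_cases hx' : x ∈ relInterior D.region
  · have : (𝓝[Hyp] x).NeBot := mem_closure_iff_nhdsWithin_neBot.1 (subset_closure hx'.1)
    exact Filter.Eventually.frequently (relInterior_mem_nhdsWithin hx')
  rcases mem_innerEdge_or_corner hx hx' with ⟨k, hk, h⟩ | ⟨k, hk, rfl⟩
  · exact hinner k hk x h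
  -- A corner is a limit of inner points of the side that starts there, and near those the interior
  -- is already known to be present.
  · intro hcon
    have hcon' := eventually_eventually_nhdsWithin.2 hcon
    have hP := D.corner_mem k
    have hQ := D.corner_mem (k + 1)
    have hne := corner_ne_corner_succ (D := D) hg hk
    have ht : Filter.Tendsto (arcPath (D.corner k) (D.corner (k + 1))) (𝓝[>] 0)
        (𝓝[Hyp] (D.corner k)) := by
      have h01 : Set.Ioo (0 : ℝ) 1 ∈ 𝓝[>] (0 : ℝ) := Ioo_mem_nhdsGT one_pos
      refine tendsto_nhdsWithin_iff.2 ⟨?_, ?_⟩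
      · have := (continuousOn_arcPath hP hQ) 0 ⟨le_rfl, zero_le_one⟩
        rw [ContinuousWithinAt, arcPath_zero hP] at this
        refine this.mono_left (nhdsWithin_le_of_mem ?_)
        filter_upwards [h01] with t ht using ⟨ht.1.le, ht.2.le⟩
      · filter_upwards [h01] with t ht
        exact (arcPath_mem hP hQ ⟨ht.1.le, ht.2.le⟩).1
    obtain ⟨t, h1, h2⟩ := ((ht.eventually hcon').and (Ioo_mem_nhdsGT one_pos)).exists
    exact hinner k hk _ ⟨arcPath_mem hP hQ ⟨h2.1.le, h2.2.le⟩,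
      arcPath_ne_left hP hQ hne ⟨h2.1, h2.2.le⟩, arcPath_ne_right hP hQ hne ⟨h2.1.le, h2.2⟩⟩ h1

theorem corner_mem_region {k : ℕ} (hk : k < 4 * g) : D.corner k ∈ D.region :=
  edge_subset_region hk (left_mem_arc (D.corner_mem k) _)

theorem relInterior_nonempty (hg : 2 ≤ g) : (relInterior D.region).Nonempty :=
  (frequently_mem_relInterior hg (corner_mem_region (D := D) (k := 0) (by omega))).exists

/-! ### Discreteness of the Fuchsian group -/

theorem eq_one_of_mem_relInterior {v : Lorentz} (hv : v ∈ D.group) {x : V}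
    (hx : x ∈ relInterior D.region) (hvx : Ad v x ∈ relInterior D.region) : v = 1 := by
  by_contra h
  exact Set.disjoint_left.1 (D.tile_disjoint v hv h) hvx ⟨x, hx, rfl⟩

end FundamentalPolygon

/-- The Lorentz relation for the first column bounds the time column by `M 0 0`, and the relations
for the rows bound the remaining entries by the time column. -/
theorem abs_entry_le (v : Lorentz) (i j : Fin 3) :
    |((v : Matrix.SpecialLinearGroup (Fin 3) ℝ) : Matrix (Fin 3) (Fin 3) ℝ) i j| ≤
      ((v : Matrix.SpecialLinearGroup (Fin 3) ℝ) : Matrix (Fin 3) (Fin 3) ℝ) 0 0 + 1 := by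
  obtain ⟨h, h0⟩ := v.2
  set M := ((v : Matrix.SpecialLinearGroup (Fin 3) ℝ) : Matrix (Fin 3) (Fin 3) ℝ)
  have hcol := first_column h
  have hrow : ∀ i, M i 0 ^ 2 - M i 1 ^ 2 - M i 2 ^ 2 = minkowski i i := fun i => by
    have := congrFun (congrFun (transpose_preserves h) i) i
    rw [← this]
    simp [minkowski, Matrix.mul_apply, Fin.sum_univ_three, Matrix.diagonal]
    ring
  have hdiag : ∀ i, -1 ≤ minkowski i i := fun i => by
    fin_cases i <;> simp [minkowski]
  have hi0 : M i 0 ^ 2 ≤ M 0 0 ^ 2 := by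
    fin_cases i <;> simp <;> nlinarith [sq_nonneg (M 1 0), sq_nonneg (M 2 0)]
  refine abs_le_of_sq_le_sq ?_ (by linarith)
  have h1 := hrow i
  have h2 := hdiag i
  fin_cases j <;> simp <;> nlinarith [sq_nonneg (M i 1), sq_nonneg (M i 2)]

theorem minkowski_transpose_mulVec (u v : Lorentz) (x : V) :
    (minkowski * ((u : Matrix.SpecialLinearGroup (Fin 3) ℝ) : Matrix (Fin 3) (Fin 3) ℝ)ᵀ *
      minkowski * ((v : Matrix.SpecialLinearGroup (Fin 3) ℝ) : Matrix (Fin 3) (Fin 3) ℝ)) *ᵥ x =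
      Ad (u⁻¹ * v) x := by
  rw [Ad_mul]
  apply Ad_injective u
  rw [Ad_Ad_inv, Ad_apply, Ad_apply, Matrix.mulVec_mulVec]
  congr 1
  calc _ = (((u : Matrix.SpecialLinearGroup (Fin 3) ℝ) : Matrix (Fin 3) (Fin 3) ℝ) * minkowski *
        ((u : Matrix.SpecialLinearGroup (Fin 3) ℝ) : Matrix (Fin 3) (Fin 3) ℝ)ᵀ) * minkowski *
        ((v : Matrix.SpecialLinearGroup (Fin 3) ℝ) : Matrix (Fin 3) (Fin 3) ℝ) := by
        simp only [Matrix.mul_assoc]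
    _ = _ := by rw [transpose_preserves u.2.1, minkowski_mul_self, Matrix.one_mul]

/-- The two time bounds confine the matrix of `v` to a compact set. An infinite family would
accumulate; for two distinct members `u, v` near the accumulation point, `u⁻¹ v` moves an interior
point of the polygon so little that it stays interior, against disjointness of the tiles. -/
theorem FundamentalPolygon.finite_setOf_time_le {g : ℕ} {D : FundamentalPolygon g} (hg : 2 ≤ g)
    (C : ℝ) : {v : Lorentz | v ∈ D.group ∧ ∃ y ∈ Hyp, y 0 ≤ C ∧ Ad v y 0 ≤ C}.Finite := by
  by_contra hinf
  set S := {v : Lorentz | v ∈ D.group ∧ ∃ y ∈ Hyp, y 0 ≤ C ∧ Ad v y 0 ≤ C} with hS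
  set toM : Lorentz → Matrix (Fin 3) (Fin 3) ℝ :=
    fun v => ((v : Matrix.SpecialLinearGroup (Fin 3) ℝ) : Matrix (Fin 3) (Fin 3) ℝ) with htoM
  have hinj : Function.Injective toM := fun u v h => Subtype.ext (Subtype.ext h)
  have hinf' : (toM '' S).Infinite := Set.Infinite.image hinj.injOn hinf
  set K : Set (Matrix (Fin 3) (Fin 3) ℝ) := Set.pi Set.univ fun _ : Fin 3 =>
    Set.pi Set.univ fun _ : Fin 3 => Set.Icc (-(2 * C * C + 1)) (2 * C * C + 1) with hK
  have hKc : IsCompact K := isCompact_univ_pi fun _ => isCompact_univ_pi fun _ => isCompact_Icc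
  have hSK : toM '' S ⊆ K := by
    rintro _ ⟨v, ⟨-, y, hy, hyC, hvC⟩, rfl⟩ i - j -
    refine abs_le.1 ?_
    refine (abs_entry_le v i j).trans ?_
    have h1 := time_le_mul_mdot (Ad_mem_Hyp v hy) (Ad_basePoint_mem v)
    rw [mdot_Ad] at h1
    have h2 : Ad v ![1, 0, 0] 0 = toM v 0 0 := by
      simp [Ad_apply, htoM, Matrix.mulVec, dotProduct, Fin.sum_univ_three]
    have h3 : mdot y ![1, 0, 0] = y 0 := by simp [mdot]
    rw [h2, h3] at h1
    have h4 := hy.2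
    have h5 := (Ad_mem_Hyp v hy).2
    have : 2 * Ad v y 0 * y 0 ≤ 2 * C * C := by gcongr; linarith
    change toM v 0 0 + 1 ≤ _
    linarith
  obtain ⟨L, -, hL⟩ := hinf'.exists_accPt_of_subset_isCompact hKc hSK
  rw [accPt_iff_frequently] at hL
  obtain ⟨x₀, hx₀⟩ := relInterior_nonempty (D := D) hg
  have hLη : Lᵀ * minkowski * L = minkowski := by
    have hcl : IsClosed {M : Matrix (Fin 3) (Fin 3) ℝ | Mᵀ * minkowski * M = minkowski} :=
      isClosed_eq (by fun_prop) continuous_const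
    refine hcl.mem_of_frequently_of_tendsto (hL.mono ?_) Filter.tendsto_id
    rintro _ ⟨-, v, -, rfl⟩
    exact v.2.1
  -- Writing the inverse of a Lorentz matrix as `η uᵀ η` extends `u⁻¹ v x₀` continuously to all
  -- pairs of matrices, so it can be evaluated at the limit `L`, for which only `Lᵀ η L = η` is
  -- needed.
  set Φ : Matrix (Fin 3) (Fin 3) ℝ × Matrix (Fin 3) (Fin 3) ℝ → V :=
    fun p => (minkowski * p.1ᵀ * minkowski * p.2) *ᵥ x₀ with hΦ
  have hΦc : Continuous Φ := by fun_prop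
  have hΦL : Φ (L, L) = x₀ := by
    simp only [hΦ]
    rw [Matrix.mul_assoc, Matrix.mul_assoc, ← Matrix.mul_assoc _ minkowski L, hLη,
      minkowski_mul_self, Matrix.one_mulVec]
  have hW : {z | z ∈ Hyp → z ∈ relInterior D.region} ∈ 𝓝 x₀ :=
    eventually_nhdsWithin_iff.1 (relInterior_mem_nhdsWithin hx₀)
  have hW' := (hΦc.tendsto (L, L)).eventually (hΦL ▸ hW)
  rw [nhds_prod_eq] at hW'
  obtain ⟨U, hU, hUW⟩ := Filter.mem_prod_same_iff.1 hW'
  obtain ⟨_, ⟨hML, u, hu, rfl⟩, hMU⟩ := (hL.and_eventually hU).exists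
  obtain ⟨_, ⟨hNL, v, hv, rfl⟩, hNU, hNM⟩ :=
    (hL.and_eventually (Filter.inter_mem hU (isOpen_compl_singleton.mem_nhds hML.symm))).exists
  have h1 : Φ (toM u, toM v) ∈ {z | z ∈ Hyp → z ∈ relInterior D.region} :=
    hUW (Set.mk_mem_prod hMU hNU)
  have h2 : Φ (toM u, toM v) = Ad (u⁻¹ * v) x₀ := minkowski_transpose_mulVec u v x₀
  rw [h2] at h1
  have h3 := eq_one_of_mem_relInterior (D.group.mul_mem (D.group.inv_mem hu.1) hv.1) hx₀
    (h1 (Ad_mem_Hyp _ hx₀.1))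
  rw [inv_mul_eq_one] at h3
  exact hNM (by rw [h3]; rfl)

/-! ### Adjacent tiles -/

/-- The number of the side `a_i` or `b_i`. The paired side has the number two higher. -/
def Gen.idx {g : ℕ} : Gen g → ℕ
  | .a i => 4 * i
  | .b i => 4 * i + 1

theorem Gen.idx_add_two_lt {g : ℕ} (y : Gen g) : y.idx + 2 < 4 * g := by
  obtain i | i := y <;> simp only [Gen.idx] <;> omega

theorem Gen.idx_lt {g : ℕ} (y : Gen g) : y.idx < 4 * g := by
  have := y.idx_add_two_lt
  omega

theorem Gen.exists_idx {g k : ℕ} (hk : k < 4 * g) :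
    ∃ y : Gen g, k = y.idx ∨ k = y.idx + 2 := by
  have hi : k / 4 < g := by omega
  have h4 := Nat.div_add_mod k 4
  have : k % 4 = 0 ∨ k % 4 = 1 ∨ k % 4 = 2 ∨ k % 4 = 3 := by omega
  rcases this with h | h | h | h
  · exact ⟨.a ⟨k / 4, hi⟩, Or.inl (by simp only [Gen.idx]; omega)⟩
  · exact ⟨.b ⟨k / 4, hi⟩, Or.inl (by simp only [Gen.idx]; omega)⟩
  · exact ⟨.a ⟨k / 4, hi⟩, Or.inr (by simp only [Gen.idx]; omega)⟩
  · exact ⟨.b ⟨k / 4, hi⟩, Or.inr (by simp only [Gen.idx]; omega)⟩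

namespace FundamentalPolygon

variable {g : ℕ} {D : FundamentalPolygon g}

theorem gen_corner (y : Gen g) :
    Ad (D.gen y) (D.corner y.idx) = D.corner (y.idx + 3) ∧
      Ad (D.gen y) (D.corner (y.idx + 1)) = D.corner (y.idx + 2) := by
  obtain i | i := y
  · exact D.pair_a i
  · exact (D.pair_b i).symm

theorem side_eq (y : Gen g) : D.side y = D.edge y.idx := by
  obtain i | i := y
  · rfl
  · exact arc_comm _ _

/-- The pairing reverses the cyclic order of the two corners; the sign puts the two tiles on
opposite sides of the arc. -/
theorem height_gen (y : Gen g) (x : V) :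
    D.height (y.idx + 2) (Ad (D.gen y) x) = -D.height y.idx x := by
  rw [height, height, ← (gen_corner y).1, ← (gen_corner y).2, mcross_Ad, mdot_Ad, mdot_mcross_swap]

theorem gen_mem_innerEdge_iff (y : Gen g) {x : V} :
    Ad (D.gen y) x ∈ D.innerEdge (y.idx + 2) ↔ x ∈ D.innerEdge y.idx := by
  simp only [innerEdge, Set.mem_ofPred_eq, edge, ne_eq]
  rw [show y.idx + 2 + 1 = y.idx + 3 from rfl, ← (gen_corner y).1, ← (gen_corner y).2,
    Ad_mem_arc_iff, arc_comm, (Ad_injective _).eq_iff, (Ad_injective _).eq_iff,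
    and_comm (a := ¬ x = D.corner (y.idx + 1))]

/-- A paired polygon lies near an inner point of a side on the other side of the arc. -/
theorem eventually_gen_mem_region_iff (y : Gen g) {x : V} (hx : x ∈ D.innerEdge y.idx) :
    ∀ᶠ z in 𝓝[Hyp] x, Ad (D.gen y) z ∈ D.region ↔ D.height y.idx z ≤ 0 := by
  filter_upwards [(tendsto_Ad_nhdsWithin (D.gen y) x).eventually
    (eventually_mem_region_iff y.idx_add_two_lt ((gen_mem_innerEdge_iff y).2 hx))] with z hz
  rw [hz, height_gen, Left.nonneg_neg_iff]

theorem frequently_Ad_mem_relInterior (hg : 2 ≤ g) {u : Lorentz} {x : V}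
    (hx : Ad u x ∈ D.region) : ∃ᶠ z in 𝓝[Hyp] x, Ad u z ∈ relInterior D.region := by
  have ht := tendsto_Ad_nhdsWithin u⁻¹ (Ad u x)
  rw [Ad_inv_Ad] at ht
  refine ht.frequently ((frequently_mem_relInterior hg hx).mono fun z hz => ?_)
  rwa [Ad_Ad_inv]

/-- The polygon lies in the closure of its interior, so otherwise two open tiles would meet near
`x`. -/
theorem notMem_relInterior (hg : 2 ≤ g) {u : Lorentz} (hu : u ∈ D.group) (hu1 : u ≠ 1) {x : V}
    (hux : Ad u x ∈ D.region) : x ∉ relInterior D.region := by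
  intro hx
  obtain ⟨z, hz, hz'⟩ := ((frequently_Ad_mem_relInterior hg hux).and_eventually
    (relInterior_mem_nhdsWithin hx)).exists
  exact hu1 (eq_one_of_mem_relInterior hu hz' hz)

/-- At an inner point of a side there are only two tiles. -/
theorem eq_one_or_eq_gen (hg : 2 ≤ g) (y : Gen g) {x : V} (hx : x ∈ D.innerEdge y.idx)
    {u : Lorentz} (hu : u ∈ D.group) (hux : Ad u x ∈ D.region) : u = 1 ∨ u = D.gen y := by
  have h1 := eventually_eventually_nhdsWithin.2 (eventually_mem_region_iff y.idx_lt hx)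
  have h2 := eventually_eventually_nhdsWithin.2 (eventually_mem_region_iff y.idx_add_two_lt
    ((gen_mem_innerEdge_iff y).2 hx))
  have h2' := (tendsto_Ad_nhdsWithin (D.gen y) x).eventually h2
  have hpos : ∀ z ∈ Hyp, Ad u z ∈ relInterior D.region →
      (∀ᶠ w in 𝓝[Hyp] z, w ∈ D.region ↔ 0 ≤ D.height y.idx w) → 0 < D.height y.idx z →
      u = 1 := fun z hz huz hor h =>
    eq_one_of_mem_relInterior hu (mem_relInterior_of_height_pos hz hor h) huz
  obtain ⟨z, huz, ⟨hz1, hz2⟩, hz⟩ := ((frequently_Ad_mem_relInterior hg hux).and_eventually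
    ((h1.and h2').and self_mem_nhdsWithin)).exists
  -- The point `z` near `x` lies in the interior of the tile of `u`. With positive height it is
  -- interior to the polygon, with negative height to the paired tile; at height zero a small push
  -- to the positive side stays in the open tile of `u`.
  rcases lt_trichotomy (D.height y.idx z) 0 with hneg | h0 | h
  · right
    have h3 : Ad (D.gen y) z ∈ relInterior D.region :=
      mem_relInterior_of_height_pos (Ad_mem_Hyp _ hz) hz2 (by rw [height_gen]; linarith)
    have h4 := eq_one_of_mem_relInterior (D.group.mul_mem hu (D.group.inv_mem (D.gen_mem y))) h3
      (by rwa [Ad_mul, Ad_inv_Ad])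
    exact mul_inv_eq_one.1 h4
  · left
    have h5 := (tendsto_Ad_nhdsWithin u z).eventually (relInterior_mem_nhdsWithin huz)
    obtain ⟨z', hz', ⟨h6, h7⟩, h8⟩ := ((frequently_mdot_pos hz (normal_spacelike hg y.idx_lt)
      h0).and_eventually ((h5.and (eventually_eventually_nhdsWithin.2 hz1)).and
        self_mem_nhdsWithin)).exists
    exact hpos z' h8 h6 h7 hz'
  · exact Or.inl (hpos z hz huz hz1 h)

theorem eq_one_or_eq_gen_inv (hg : 2 ≤ g) (y : Gen g) {x : V} (hx : x ∈ D.innerEdge (y.idx + 2))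
    {u : Lorentz} (hu : u ∈ D.group) (hux : Ad u x ∈ D.region) : u = 1 ∨ u = (D.gen y)⁻¹ := by
  have hx' : Ad (D.gen y)⁻¹ x ∈ D.innerEdge y.idx := by
    rwa [← gen_mem_innerEdge_iff, Ad_Ad_inv]
  rcases eq_one_or_eq_gen hg y hx' (D.group.mul_mem hu (D.gen_mem y))
    (by rwa [Ad_mul, Ad_Ad_inv]) with h | h
  · exact Or.inr (mul_eq_one_iff_eq_inv.1 h)
  · exact Or.inl (by simpa using h)

end FundamentalPolygon

/-! ### Integer characters of the Fuchsian group -/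

/-- The difference is continuous with integer values, hence constant on a preconnected set. -/
theorem sub_eq_sub_of_coe_addCircle_eq {α : Type*} [TopologicalSpace α] {S : Set α}
    (hS : IsPreconnected S) {f h : α → ℝ} (hf : ContinuousOn f S) (hh : ContinuousOn h S)
    (heq : ∀ z ∈ S, (f z : AddCircle (1 : ℝ)) = h z) {x y : α} (hx : x ∈ S) (hy : y ∈ S) :
    f x - h x = f y - h y := by
  have hT : IsDiscrete (AddSubgroup.zmultiples (1 : ℝ) : Set ℝ) :=
    isDiscrete_iff_discreteTopology.2
      (inferInstanceAs (DiscreteTopology (AddSubgroup.zmultiples (1 : ℝ))))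
  refine hS.constant_of_mapsTo hT (hf.sub hh) (fun z hz => ?_) hx hy
  have := (QuotientAddGroup.eq (s := AddSubgroup.zmultiples (1 : ℝ))).1 (heq z hz).symm
  simpa [sub_eq_neg_add] using this

theorem coe_add_intCast (x : ℝ) (n : ℤ) : ((x + n : ℝ) : AddCircle (1 : ℝ)) = x := by
  rw [AddCircle.coe_add, add_eq_left, AddCircle.coe_eq_zero_iff]
  exact ⟨n, by simp⟩

theorem coe_intCast (n : ℤ) : ((n : ℝ) : AddCircle (1 : ℝ)) = 0 := by
  rw [AddCircle.coe_eq_zero_iff]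
  exact ⟨n, by simp⟩

/-- An affine parameter along the arc between two points, `0` at `x` and `1` at `y`. -/
def arcParam (x y z : V) : ℝ :=
  (mdot x y * mdot z x - mdot z y) / ((mdot x y - 1) * (mdot z x + mdot z y))

section ArcParam

variable {x y : V}

theorem arcParam_left (hx : x ∈ Hyp) : arcParam x y x = 0 := by
  simp [arcParam, hx.1]

theorem arcParam_right (hx : x ∈ Hyp) (hy : y ∈ Hyp) (hxy : x ≠ y) : arcParam x y y = 1 := by
  have hD := one_lt_mdot hx hy hxy
  rw [arcParam, hy.1, mdot_comm y x, div_eq_one_iff_eq]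
  · ring
  · exact mul_ne_zero (by linarith) (by linarith)

/-- Needed because the side pairings reverse the numbering of the corners. -/
theorem arcParam_swap (hx : x ∈ Hyp) (hy : y ∈ Hyp) (hxy : x ≠ y) {z : V} (hz : z ∈ Hyp) :
    arcParam y x z = 1 - arcParam x y z := by
  have hD : mdot x y - 1 ≠ 0 := by linarith [one_lt_mdot hx hy hxy]
  have h2 : mdot z x + mdot z y ≠ 0 := by linarith [one_le_mdot hz hx, one_le_mdot hz hy]
  rw [arcParam, arcParam, mdot_comm y x, add_comm (mdot z y)]
  field_simp
  ring

theorem arcParam_Ad (u : Lorentz) (x y z : V) :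
    arcParam (Ad u x) (Ad u y) (Ad u z) = arcParam x y z := by
  simp only [arcParam, mdot_Ad]

theorem continuousOn_arcParam (hx : x ∈ Hyp) (hy : y ∈ Hyp) (hxy : x ≠ y) :
    ContinuousOn (arcParam x y) Hyp := by
  unfold arcParam
  have hzx : Continuous fun z => mdot z x := continuous_mdot continuous_id continuous_const
  have hzy : Continuous fun z => mdot z y := continuous_mdot continuous_id continuous_const
  refine ContinuousOn.div (by fun_prop) (by fun_prop) fun z hz => ?_
  have hD := one_lt_mdot hx hy hxy
  have := one_le_mdot hz hx
  have := one_le_mdot hz hy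
  exact mul_ne_zero (by linarith) (by linarith)

theorem isClosed_arc (hx : x ∈ Hyp) (hy : y ∈ Hyp) : IsClosed (arc x y) := by
  have : arc x y = arcPath x y '' Set.Icc 0 1 := by
    refine Set.Subset.antisymm ?_ (Set.image_subset_iff.2 fun t ht => arcPath_mem hx hy ht)
    rintro z ⟨hz, s, t, hs, ht, rfl⟩
    have hr : 0 < s + t := by
      rcases hs.eq_or_lt with rfl | hs
      · rcases ht.eq_or_lt with rfl | ht
        · simp at hz
          exact absurd hz zero_notMem_Hyp
        · linarith
      · linarith
    refine ⟨t / (s + t), ⟨by positivity, by rw [div_le_one hr]; linarith⟩, ?_⟩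
    have e : (1 - t / (s + t)) • x + (t / (s + t)) • y = (s + t)⁻¹ • (s • x + t • y) := by
      rw [smul_add, smul_smul, smul_smul]
      congr 2 <;> field_simp
      ring
    rw [arcPath, e, mdot_smul_left, mdot_smul_right, hz.1, mul_one, Real.sqrt_mul_self (by positivity),
      inv_inv, smul_smul, mul_inv_cancel₀ hr.ne', one_smul]
  rw [this]
  exact (isCompact_Icc.image_of_continuousOn (continuousOn_arcPath hx hy)).isClosed

end ArcParam

namespace FundamentalPolygon

variable {g : ℕ} {D : FundamentalPolygon g}

/-- The interpolation along the side with number `k` between the values `n k` and `n (k + 1)`. -/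
def interp (D : FundamentalPolygon g) (n : ℕ → ℤ) (k : ℕ) (z : V) : ℝ :=
  n k + arcParam (D.corner k) (D.corner (k + 1)) z * (n (k + 1) - n k)

/-! ### Integer levels at the corners and their interpolation -/

section Interp

variable {n : ℕ → ℤ}

theorem interp_left (k : ℕ) : D.interp n k (D.corner k) = n k := by
  simp [interp, arcParam_left (D.corner_mem k)]

theorem interp_right (hg : 2 ≤ g) {k : ℕ} (hk : k < 4 * g) :
    D.interp n k (D.corner (k + 1)) = n (k + 1) := by
  simp [interp, arcParam_right (D.corner_mem k) (D.corner_mem _) (corner_ne_corner_succ hg hk)]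

theorem continuousOn_interp (hg : 2 ≤ g) {k : ℕ} (hk : k < 4 * g) :
    ContinuousOn (D.interp n k) Hyp := by
  unfold interp
  exact continuousOn_const.add ((continuousOn_arcParam (D.corner_mem k) (D.corner_mem _)
    (corner_ne_corner_succ hg hk)).mul continuousOn_const)

theorem eq_of_corner_eq (hn : n (4 * g) = n 0) {i j : ℕ} (hi : i ≤ 4 * g) (hj : j ≤ 4 * g)
    (h : D.corner i = D.corner j) : n i = n j := by
  rcases hi.eq_or_lt with rfl | hi <;> rcases hj.eq_or_lt with rfl | hj
  · rfl
  · rw [D.corner_closed] at h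
    rw [hn, D.corner_inj 0 (by omega) j hj h]
  · rw [D.corner_closed] at h
    rw [hn, D.corner_inj i hi 0 (by omega) h]
  · rw [D.corner_inj i hi j hj h]

theorem interp_eq_interp (hg : 2 ≤ g) (hn : n (4 * g) = n 0) {k l : ℕ} (hk : k < 4 * g)
    (hl : l < 4 * g) {z : V} (hzk : z ∈ D.edge k) (hzl : z ∈ D.edge l) :
    D.interp n k z = D.interp n l z := by
  by_cases hkl : k = l
  · rw [hkl]
  have aux : ∀ {k}, k < 4 * g → z = D.corner k ∨ z = D.corner (k + 1) →
      ∃ i ≤ 4 * g, z = D.corner i ∧ D.interp n k z = n i := by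
    rintro k hk (rfl | rfl)
    · exact ⟨k, hk.le, rfl, interp_left k⟩
    · exact ⟨k + 1, hk, rfl, interp_right hg hk⟩
  obtain ⟨i, hi, hzi, e1⟩ := aux hk (D.sides_disjoint k hk l hl hkl z hzk hzl)
  obtain ⟨j, hj, hzj, e2⟩ := aux hl (D.sides_disjoint l hl k hk (Ne.symm hkl) z hzl hzk)
  rw [e1, e2, eq_of_corner_eq hn hi hj (hzi.symm.trans hzj)]

/-- A continuous function that interpolates along all sides of the polygon. -/
theorem exists_continuous_eq_interp (hg : 2 ≤ g) (hn : n (4 * g) = n 0) :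
    ∃ f : V → ℝ, Continuous f ∧ ∀ k < 4 * g, ∀ z ∈ D.edge k, f z = D.interp n k z := by
  classical
  let F : V → ℝ := fun z => if h : ∃ k, k < 4 * g ∧ z ∈ D.edge k then D.interp n h.choose z else 0
  have hF : ∀ k < 4 * g, ∀ z ∈ D.edge k, F z = D.interp n k z := by
    intro k hk z hz
    have h : ∃ k, k < 4 * g ∧ z ∈ D.edge k := ⟨k, hk, hz⟩
    simp only [F, dif_pos h]
    exact interp_eq_interp hg hn h.choose_spec.1 hk h.choose_spec.2 hz
  let B : Set V := ⋃ k : Fin (4 * g), D.edge k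
  have hcl : ∀ k : Fin (4 * g), IsClosed (D.edge k) := fun k =>
    isClosed_arc (D.corner_mem _) (D.corner_mem _)
  have hFB : ContinuousOn F B := by
    refine (locallyFinite_of_finite _).continuousOn_iUnion hcl fun k => ?_
    exact ((continuousOn_interp hg k.2).mono fun z hz => hz.1).congr fun z hz => hF k k.2 z hz
  have hB : IsClosed B := isClosed_iUnion_of_finite hcl
  -- Tietze extension from the closed boundary. The values inside the polygon are irrelevant.
  obtain ⟨f, hf⟩ := ContinuousMap.exists_restrict_eq hB ⟨B.domRestrict F, hFB.domRestrict⟩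
  refine ⟨f, f.continuous, fun k hk z hz => ?_⟩
  rw [← hF k hk z hz]
  exact congrArg (fun φ => φ ⟨z, Set.mem_iUnion.2 ⟨⟨k, hk⟩, hz⟩⟩) hf

theorem interp_gen (hg : 2 ≤ g) {y : Gen g} {χ : ℤ} (h3 : n (y.idx + 3) = n y.idx + χ)
    (h2 : n (y.idx + 2) = n (y.idx + 1) + χ) {x : V} (hx : x ∈ Hyp) :
    D.interp n (y.idx + 2) (Ad (D.gen y) x) = D.interp n y.idx x + χ := by
  rw [interp, interp, show y.idx + 2 + 1 = y.idx + 3 from rfl, ← (gen_corner y).1,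
    ← (gen_corner y).2, arcParam_Ad, arcParam_swap (D.corner_mem _) (D.corner_mem _)
      (corner_ne_corner_succ hg y.idx_lt) hx, h2, h3]
  push_cast
  ring

/-- The values modulo `1` of an interpolating function are compatible with the tesselation. -/
theorem coe_eq_coe_of_Ad (hg : 2 ≤ g) {χ : Gen g → ℤ} {f : V → ℝ}
    (hf : ∀ k < 4 * g, ∀ z ∈ D.edge k, f z = D.interp n k z)
    (h3 : ∀ y : Gen g, n (y.idx + 3) = n y.idx + χ y)
    (h2 : ∀ y : Gen g, n (y.idx + 2) = n (y.idx + 1) + χ y) {u : Lorentz} (hu : u ∈ D.group)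
    {x : V} (hx : x ∈ D.region) (hux : Ad u x ∈ D.region) :
    (f (Ad u x) : AddCircle (1 : ℝ)) = f x := by
  by_cases hu1 : u = 1
  · rw [hu1, Ad_one]
  have hgen : ∀ y : Gen g, ∀ z ∈ D.innerEdge y.idx, f (Ad (D.gen y) z) = f z + χ y := by
    intro y z hz
    rw [hf _ y.idx_add_two_lt _ ((gen_mem_innerEdge_iff y).2 hz).1, hf _ y.idx_lt _ hz.1,
      interp_gen hg (h3 y) (h2 y) hz.1.1]
  have hinner : ∀ u ∈ D.group, u ≠ 1 → ∀ k < 4 * g, ∀ x ∈ D.innerEdge k, Ad u x ∈ D.region →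
      (f (Ad u x) : AddCircle (1 : ℝ)) = f x := by
    intro u hu hu1 k hk x hx hux
    obtain ⟨y, rfl | rfl⟩ := Gen.exists_idx hk
    · obtain rfl := (eq_one_or_eq_gen hg y hx hu hux).resolve_left hu1
      rw [hgen y x hx, coe_add_intCast]
    · obtain rfl := (eq_one_or_eq_gen_inv hg y hx hu hux).resolve_left hu1
      have hx' : Ad (D.gen y)⁻¹ x ∈ D.innerEdge y.idx := by
        rwa [← gen_mem_innerEdge_iff, Ad_Ad_inv]
      have := hgen y _ hx'
      rw [Ad_Ad_inv] at this
      rw [this, coe_add_intCast]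
  have hx1 := notMem_relInterior hg hu hu1 hux
  have hinv : Ad u⁻¹ (Ad u x) ∈ D.region := by rwa [Ad_inv_Ad]
  have hu2 := notMem_relInterior hg (D.group.inv_mem hu) (inv_ne_one.2 hu1) hinv
  rcases mem_innerEdge_or_corner hx hx1 with ⟨k, hk, h⟩ | ⟨k, hk, rfl⟩
  · exact hinner u hu hu1 k hk x h hux
  rcases mem_innerEdge_or_corner hux hu2 with ⟨l, hl, h⟩ | ⟨l, hl, h⟩
  · have := hinner u⁻¹ (D.group.inv_mem hu) (inv_ne_one.2 hu1) l hl _ h hinv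
    rw [Ad_inv_Ad] at this
    exact this.symm
  -- All corner values are integers and vanish modulo `1`, so the cycle of tiles around a corner
  -- need not be analysed.
  · rw [h, hf l hl _ (left_mem_arc (D.corner_mem l) _), hf k hk _ (left_mem_arc (D.corner_mem k) _),
      interp_left, interp_left, coe_intCast, coe_intCast]

end Interp

/-- The points of a tile as a family of closed sets in the hyperbolic plane. -/
theorem locallyFinite_tiles (hg : 2 ≤ g) :
    LocallyFinite fun u : D.group => {x : Hyp | Ad (u : Lorentz) x ∈ D.region} := by
  intro x
  obtain ⟨C, hC⟩ : ∃ C : ℝ, ∀ z ∈ D.region, z 0 ≤ C := by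
    obtain ⟨C, hC⟩ := (D.region_compact.image (continuous_apply (0 : Fin 3))).bddAbove
    exact ⟨C, fun z hz => hC ⟨z, hz, rfl⟩⟩
  have hcont : Continuous fun z : Hyp => (z : V) 0 :=
    (continuous_apply (0 : Fin 3)).comp continuous_subtype_val
  refine ⟨{z | (z : V) 0 < (x : V) 0 + 1}, (isOpen_lt hcont continuous_const).mem_nhds
    (by simp), ?_⟩
  have hfin := finite_setOf_time_le (D := D) hg (max ((x : V) 0 + 1) C)
  refine Set.Finite.subset (hfin.preimage Subtype.val_injective.injOn) ?_
  rintro u ⟨z, hz1, hz2⟩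
  exact ⟨u.2, z, z.2, le_max_of_le_left (le_of_lt hz2), le_max_of_le_right (hC _ hz1)⟩

/-- A parametrisation of the hyperbolic plane by the Euclidean plane. -/
def hypParam (a : ℝ × ℝ) : Hyp :=
  ⟨![Real.sqrt (1 + a.1 ^ 2 + a.2 ^ 2), a.1, a.2], by
    have h : 0 < 1 + a.1 ^ 2 + a.2 ^ 2 := by positivity
    refine ⟨?_, Real.sqrt_pos.2 h⟩
    simp only [mdot, Matrix.cons_val_zero, Matrix.cons_val_one, Matrix.cons_val]
    rw [Real.mul_self_sqrt h.le]
    ring⟩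

theorem continuous_hypParam : Continuous hypParam := by
  refine Continuous.subtype_mk (continuous_pi fun i => ?_) _
  fin_cases i
  · exact Continuous.sqrt (by fun_prop)
  · exact continuous_fst
  · exact continuous_snd

theorem hypParam_eq (x : Hyp) : hypParam ((x : V) 1, (x : V) 2) = x := by
  ext i
  have h := x.2.1
  simp only [mdot] at h
  fin_cases i
  · change Real.sqrt (1 + (x : V) 1 ^ 2 + (x : V) 2 ^ 2) = (x : V) 0
    rw [show 1 + (x : V) 1 ^ 2 + (x : V) 2 ^ 2 = (x : V) 0 ^ 2 by linarith]
    exact Real.sqrt_sq x.2.2.le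
  · rfl
  · rfl

/-- The hyperbolic plane is parametrised by the simply connected Euclidean plane, so `φ` lifts
through the covering `ℝ → ℝ/ℤ`. -/
theorem exists_lift_hyp {φ : Hyp → AddCircle (1 : ℝ)} (hφ : Continuous φ) :
    ∃ G : V → ℝ, Continuous G ∧ ∀ x : Hyp, (G x : AddCircle (1 : ℝ)) = φ x := by
  have cov := AddCircle.isCoveringMap_coe (1 : ℝ)
  obtain ⟨e, he⟩ := QuotientAddGroup.mk_surjective (φ (hypParam 0))
  obtain ⟨G, ⟨-, hG⟩, -⟩ := cov.existsUnique_continuousMap_lifts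
    ⟨fun a => φ (hypParam a), hφ.comp continuous_hypParam⟩ 0 e he
  refine ⟨fun x => G (x 1, x 2), by fun_prop, fun x => ?_⟩
  have := congrFun hG ((x : V) 1, (x : V) 2)
  simp only [Function.comp_apply, ContinuousMap.coe_mk, hypParam_eq] at this
  exact this

theorem isPreconnected_Hyp : IsPreconnected Hyp := by
  have : Hyp = (fun a => (hypParam a : V)) '' Set.univ := by
    ext x
    constructor
    · exact fun hx => ⟨_, trivial, congrArg Subtype.val (hypParam_eq ⟨x, hx⟩)⟩
    · rintro ⟨a, -, rfl⟩
      exact (hypParam a).2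
  rw [this]
  exact isPreconnected_univ.image _ (continuous_subtype_val.comp continuous_hypParam).continuousOn

/-- A function on the hyperbolic plane that realises a character of the Fuchsian group. -/
theorem exists_potential (hg : 2 ≤ g) {n : ℕ → ℤ} (hn : n (4 * g) = n 0) {χ : Gen g → ℤ}
    (h3 : ∀ y : Gen g, n (y.idx + 3) = n y.idx + χ y)
    (h2 : ∀ y : Gen g, n (y.idx + 2) = n (y.idx + 1) + χ y) :
    ∃ G : V → ℝ, (∀ v ∈ D.group, ∀ x ∈ Hyp, ∀ y ∈ Hyp, G (Ad v x) - G x = G (Ad v y) - G y) ∧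
      ∀ y, G (Ad (D.gen y) (D.corner y.idx)) - G (D.corner y.idx) = χ y := by
  classical
  obtain ⟨f, hfc, hf⟩ := exists_continuous_eq_interp (D := D) hg hn
  have hcov : ∀ x : Hyp, ∃ u ∈ D.group, Ad u x ∈ D.region := fun x => by
    obtain ⟨v, hv, hx⟩ := D.cover x x.2
    exact ⟨v⁻¹, D.group.inv_mem hv, mem_Ad_image.1 hx⟩
  choose t ht ht' using hcov
  -- Modulo `1` the value does not depend on the element `t x` that brings `x` into the polygon.
  let φ : Hyp → AddCircle (1 : ℝ) := fun x => f (Ad (t x) x)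
  have hφ : ∀ x : Hyp, ∀ u ∈ D.group, Ad u x ∈ D.region → φ x = f (Ad u x) := by
    intro x u hu hux
    have h := coe_eq_coe_of_Ad hg hf h3 h2 (D.group.mul_mem (ht x) (D.group.inv_mem hu)) hux
      (by rw [Ad_mul, Ad_inv_Ad]; exact ht' x)
    rwa [Ad_mul, Ad_inv_Ad] at h
  have hφc : Continuous φ := by
    refine (locallyFinite_tiles (D := D) hg).continuous ?_ ?_ ?_
    · exact Set.eq_univ_of_forall fun x => Set.mem_iUnion.2 ⟨⟨t x, ht x⟩, ht' x⟩
    · exact fun u => D.region_compact.isClosed.preimage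
        ((continuous_Ad (u : Lorentz)).comp continuous_subtype_val)
    · intro u
      refine ContinuousOn.congr (f := fun x : Hyp => (f (Ad (u : Lorentz) x) : AddCircle (1 : ℝ)))
        ?_ fun x hx => hφ x u u.2 hx
      exact ((AddCircle.continuous_mk' 1).comp (hfc.comp
        ((continuous_Ad (u : Lorentz)).comp continuous_subtype_val))).continuousOn
  obtain ⟨G, hGc, hG⟩ := exists_lift_hyp hφc
  have hGinv : ∀ v ∈ D.group, ∀ x ∈ Hyp, (G (Ad v x) : AddCircle (1 : ℝ)) = G x := by
    intro v hv x hx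
    rw [hG ⟨x, hx⟩, hG ⟨Ad v x, Ad_mem_Hyp v hx⟩]
    rw [hφ ⟨x, hx⟩ (t ⟨Ad v x, Ad_mem_Hyp v hx⟩ * v) (D.group.mul_mem (ht _) hv)
      (by rw [Ad_mul]; exact ht' ⟨Ad v x, Ad_mem_Hyp v hx⟩), Ad_mul]
  -- The lift is compared with the interpolation side by side, so connectedness of the polygon is
  -- not required.
  have hstep : ∀ k < 4 * g, G (D.corner (k + 1)) - n (k + 1) = G (D.corner k) - n k := by
    intro k hk
    have hP := D.corner_mem k
    have hQ := D.corner_mem (k + 1)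
    have hpath := continuousOn_arcPath hP hQ
    have key := sub_eq_sub_of_coe_addCircle_eq (S := Set.Icc (0 : ℝ) 1) isPreconnected_Icc
      (f := fun s => G (arcPath (D.corner k) (D.corner (k + 1)) s))
      (h := fun s => D.interp n k (arcPath (D.corner k) (D.corner (k + 1)) s))
      (hGc.comp_continuousOn hpath)
      ((continuousOn_interp hg hk).comp hpath fun s hs => (arcPath_mem hP hQ hs).1)
      (fun s hs => by
        have hmem : arcPath (D.corner k) (D.corner (k + 1)) s ∈ D.edge k := arcPath_mem hP hQ hs
        rw [← hf k hk _ hmem, hG ⟨_, hmem.1⟩, hφ _ 1 D.group.one_mem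
          (by rw [Ad_one]; exact edge_subset_region hk hmem), Ad_one])
      (x := 1) (y := 0) ⟨zero_le_one, le_rfl⟩ ⟨le_rfl, zero_le_one⟩
    simpa only [arcPath_zero hP, arcPath_one hQ, interp_left, interp_right hg hk] using key
  refine ⟨G, fun v hv x hx y hy => ?_, fun y => ?_⟩
  · exact sub_eq_sub_of_coe_addCircle_eq isPreconnected_Hyp (f := fun x => G (Ad v x)) (h := G)
      (hGc.comp (continuous_Ad v)).continuousOn hGc.continuousOn (hGinv v hv) hx hy
  · rw [(gen_corner y).1]
    have hlt := y.idx_add_two_lt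
    have e0 := hstep y.idx (by omega)
    have e1 := hstep (y.idx + 1) (by omega)
    have e2 := hstep (y.idx + 2) (by omega)
    have e3 : (n (y.idx + 3) : ℝ) = n y.idx + χ y := by exact_mod_cast h3 y
    simp only [add_assoc, Nat.reduceAdd] at e1 e2
    linarith

/-- Corner values with prescribed differences along paired sides. -/
theorem exists_levels (χ : Gen g → ℤ) : ∃ n : ℕ → ℤ, n (4 * g) = n 0 ∧
    (∀ y : Gen g, n (y.idx + 3) = n y.idx + χ y) ∧
    ∀ y : Gen g, n (y.idx + 2) = n (y.idx + 1) + χ y := by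
  let α : ℕ → ℤ := fun i => if h : i < g then χ (.a ⟨i, h⟩) else 0
  let β : ℕ → ℤ := fun i => if h : i < g then χ (.b ⟨i, h⟩) else 0
  -- Around one handle the levels are `0, -β, α - β, α, 0`: they close up within each handle, as a
  -- commutator dies in the abelianisation.
  let n : ℕ → ℤ := fun k => if k % 4 = 0 then 0 else if k % 4 = 1 then -β (k / 4) else
    if k % 4 = 2 then α (k / 4) - β (k / 4) else α (k / 4)
  have n0 : ∀ i, n (4 * i) = 0 := fun i => by simp [n]
  have n1 : ∀ i, n (4 * i + 1) = -β i := fun i => by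
    simp [n, Nat.add_mod, show (4 * i + 1) / 4 = i by omega]
  have n2 : ∀ i, n (4 * i + 2) = α i - β i := fun i => by
    simp [n, Nat.add_mod, show (4 * i + 2) / 4 = i by omega]
  have n3 : ∀ i, n (4 * i + 3) = α i := fun i => by
    simp [n, Nat.add_mod, show (4 * i + 3) / 4 = i by omega]
  have n4 : ∀ i, n (4 * i + 4) = 0 := fun i => n0 (i + 1)
  have hα : ∀ i : Fin g, α i = χ (.a i) := fun i => by simp [α]
  have hβ : ∀ i : Fin g, β i = χ (.b i) := fun i => by simp [β]
  refine ⟨n, by rw [n0]; exact (n0 0).symm, ?_, ?_⟩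
  · rintro (i | i)
    · simp only [Gen.idx, n0, n3, hα]; ring
    · simp only [Gen.idx, add_assoc, Nat.reduceAdd, n1, n4, hβ]; ring
  · rintro (i | i)
    · simp only [Gen.idx, n1, n2, hα, hβ]; ring
    · simp only [Gen.idx, add_assoc, Nat.reduceAdd, n2, n3, hα, hβ]; ring

/-- The character that is `1` on one generator and `0` on the others tells them apart. -/
theorem gen_injective (hg : 2 ≤ g) : Function.Injective D.gen := by
  intro y z h
  obtain ⟨n, hn, h3, h2⟩ := exists_levels (Pi.single y 1 : Gen g → ℤ)
  obtain ⟨G, hG, hχ⟩ := exists_potential (D := D) hg hn h3 h2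
  have h1 := hG _ (D.gen_mem y) _ (D.corner_mem y.idx) _ (D.corner_mem z.idx)
  rw [hχ, h, hχ, Pi.single_eq_same] at h1
  by_contra hne
  rw [Pi.single_eq_of_ne (Ne.symm hne)] at h1
  norm_num at h1

/-- The same character takes the value `-1` on the inverse, but only `0` or `1` on generators. -/
theorem gen_inv_ne_gen (hg : 2 ≤ g) (y z : Gen g) : (D.gen y)⁻¹ ≠ D.gen z := by
  intro h
  obtain ⟨n, hn, h3, h2⟩ := exists_levels (Pi.single y 1 : Gen g → ℤ)
  obtain ⟨G, hG, hχ⟩ := exists_potential (D := D) hg hn h3 h2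
  have h1 := hG _ (D.gen_mem z) _ (D.corner_mem z.idx) _ (Ad_mem_Hyp (D.gen y) (D.corner_mem y.idx))
  have h4 := hχ y
  rw [hχ, ← h, Ad_inv_Ad] at h1
  rw [Pi.single_eq_same] at h4
  by_cases hyz : z = y
  · rw [hyz, Pi.single_eq_same] at h1
    push_cast at *
    linarith
  · rw [Pi.single_eq_of_ne hyz] at h1
    push_cast at *
    linarith

theorem gen_ne_one (hg : 2 ≤ g) (y : Gen g) : D.gen y ≠ 1 := fun h =>
  gen_inv_ne_gen (D := D) hg y y (by rw [h, inv_one])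

end FundamentalPolygon

/-! ### The translation map of the grafting construction -/

/-- The indicator function of the half space into which `m` points. -/
def beyond (m x : V) : ℝ := if mdot m x < 0 then 1 else 0

theorem beyond_Ad (v : Lorentz) (m x : V) : beyond (Ad v m) (Ad v x) = beyond m x := by
  simp only [beyond, mdot_Ad]

/-- An arc meets a plane that contains neither end point if and only if the end points lie on
different sides of the plane. -/
theorem arc_inter_nonempty_iff {m x y : V} (hx : x ∈ Hyp) (hy : y ∈ Hyp) (hmx : mdot m x ≠ 0)
    (hmy : mdot m y ≠ 0) :
    (arc x y ∩ {z | mdot m z = 0}).Nonempty ↔ beyond m y - beyond m x ≠ 0 := by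
  have key : beyond m y - beyond m x ≠ 0 ↔ mdot m x * mdot m y < 0 := by
    rcases hmx.lt_or_gt with h1 | h1 <;> rcases hmy.lt_or_gt with h2 | h2
    · simp [beyond, h1, h2, mul_pos_of_neg_of_neg h1 h2, le_of_lt]
    · simp [beyond, h1, h2.not_gt, mul_neg_of_neg_of_pos h1 h2]
    · simp [beyond, h1.not_gt, h2, mul_neg_of_pos_of_neg h1 h2]
    · simp [beyond, h1.not_gt, h2.not_gt, mul_pos h1 h2, le_of_lt]
  rw [key]
  constructor
  · rintro ⟨z, ⟨hz, s, t, hs, ht, rfl⟩, h0⟩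
    simp only [Set.mem_ofPred_eq, mdot_add_right, mdot_smul_right] at h0
    by_contra hcon
    have hpos : 0 < mdot m x * mdot m y := lt_of_le_of_ne (not_lt.1 hcon) (mul_ne_zero hmx hmy).symm
    have hs0 : s * (mdot m x * mdot m x) + t * (mdot m x * mdot m y) = 0 := by
      linear_combination mdot m x * h0
    have h3 := mul_nonneg hs (mul_self_nonneg (mdot m x))
    have h4 := mul_nonneg ht hpos.le
    have hs' : s = 0 := by
      have : s * (mdot m x * mdot m x) = 0 := by linarith
      simpa [hmx] using this
    have ht' : t = 0 := by
      have : t * (mdot m x * mdot m y) = 0 := by linarith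
      simpa [hmx, hmy] using this
    rw [hs', ht', zero_smul, zero_smul, add_zero] at hz
    exact zero_notMem_Hyp hz
  · intro hneg
    -- The weights `|m · y|` and `|m · x|` balance the two products of opposite sign.
    obtain ⟨-, hmem⟩ := normalize_mem_Hyp hx hy (abs_nonneg (mdot m y)) (abs_nonneg (mdot m x))
      (by positivity)
    have hr := inv_nonneg.2 (Real.sqrt_nonneg (mdot (|mdot m y| • x + |mdot m x| • y)
      (|mdot m y| • x + |mdot m x| • y)))
    refine ⟨_, ⟨hmem, _, _, mul_nonneg hr (abs_nonneg (mdot m y)),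
      mul_nonneg hr (abs_nonneg (mdot m x)), by rw [smul_add, smul_smul, smul_smul]⟩, ?_⟩
    have : |mdot m y| * mdot m x + |mdot m x| * mdot m y = 0 := by
      rcases hmx.lt_or_gt with h1 | h1 <;> rcases hmy.lt_or_gt with h2 | h2
      · nlinarith [mul_pos_of_neg_of_neg h1 h2]
      · rw [abs_of_neg h1, abs_of_pos h2]; ring
      · rw [abs_of_pos h1, abs_of_neg h2]; ring
      · nlinarith [mul_pos h1 h2]
    simp only [Set.mem_ofPred_eq, mdot_add_right, mdot_smul_right]
    rw [this, mul_zero]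

namespace SimpleClosedGeodesic

variable {g : ℕ} {D : FundamentalPolygon g} (c : SimpleClosedGeodesic D)

theorem mem_multicurve {x m : V} (hx : x ∈ Hyp) (hm : m ∈ c.normals) (h : mdot m x = 0) :
    x ∈ c.multicurve := by
  obtain ⟨v, hv, rfl⟩ := hm
  rw [mdot_Ad_left] at h
  obtain ⟨t, ht⟩ := c.exists_lift_eq (Ad_mem_Hyp v⁻¹ hx) h
  exact ⟨v, hv, t, by rw [← lift, ← ht, Ad_Ad_inv]⟩

theorem mdot_ne_zero {x m : V} (hx : x ∈ Hyp) (hxc : x ∉ c.multicurve) (hm : m ∈ c.normals) :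
    mdot m x ≠ 0 := fun h => hxc (c.mem_multicurve hx hm h)

theorem Ad_mem_multicurve_iff {v : Lorentz} (hv : v ∈ D.group) {x : V} :
    Ad v x ∈ c.multicurve ↔ x ∈ c.multicurve := by
  constructor
  · rintro ⟨u, hu, t, h⟩
    exact ⟨v⁻¹ * u, D.group.mul_mem (D.group.inv_mem hv) hu, t, by
      rw [Ad_mul, ← h, Ad_inv_Ad]⟩
  · rintro ⟨u, hu, t, rfl⟩
    exact ⟨v * u, D.group.mul_mem hv hu, t, by rw [Ad_mul]⟩

theorem corner_notMem_multicurve (hg : 2 ≤ g) {k : ℕ} (hk : k ≤ 4 * g) :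
    D.corner k ∉ c.multicurve := by
  have aux : ∀ k < 4 * g, D.corner k ∉ c.multicurve := by
    rintro k hk ⟨v, hv, t, h⟩
    exact c.avoids_corners v⁻¹ (D.group.inv_mem hv) k hk t (by rw [h, Ad_inv_Ad])
  rcases hk.eq_or_lt with rfl | hk
  · rw [D.corner_closed]
    exact aux 0 (by omega)
  · exact aux k hk

theorem Ad_mem_normals_iff {v : Lorentz} (hv : v ∈ D.group) {m : V} :
    Ad v m ∈ c.normals ↔ m ∈ c.normals := by
  constructor
  · rintro ⟨u, hu, h⟩
    exact ⟨v⁻¹ * u, D.group.mul_mem (D.group.inv_mem hv) hu, by rw [Ad_mul, ← h, Ad_inv_Ad]⟩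
  · rintro ⟨u, hu, rfl⟩
    exact ⟨v * u, D.group.mul_mem hv hu, by rw [Ad_mul]⟩

/-- A power of the holonomy moves the meeting point into one compact period of the lift without
changing the normal. The group element then maps a point of bounded time to a point of the bounded
arc, and discreteness applies. -/
theorem crossed_finite (hg : 2 ≤ g) {x : V} (hx : x ∈ Hyp) : (c.crossed x).Finite := by
  obtain ⟨C₀, hC₀⟩ : ∃ C : ℝ, ∀ t ∈ Set.Icc 0 c.len, c.lift t 0 ≤ C := by
    obtain ⟨C, hC⟩ := (isCompact_Icc.image (f := fun t => c.lift t 0)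
      ((continuous_apply (0 : Fin 3)).comp c.continuous_lift)).bddAbove
    exact ⟨C, fun t ht => hC ⟨t, ht, rfl⟩⟩
  set C := max C₀ (D.corner 0 0 + x 0)
  refine ((FundamentalPolygon.finite_setOf_time_le (D := D) hg C).image
    fun v => Ad v c.normal).subset ?_
  rintro m ⟨⟨v, hv, rfl⟩, z, hz, h0⟩
  have h0' : mdot c.normal (Ad v⁻¹ z) = 0 := by rwa [← mdot_Ad_left]
  obtain ⟨t, ht⟩ := c.exists_lift_eq (Ad_mem_Hyp _ hz.1) h0'
  obtain ⟨b, hb, -⟩ := existsUnique_add_zsmul_mem_Ico c.len_pos t 0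
  rw [zero_add, zsmul_eq_mul] at hb
  refine ⟨v * c.hol ^ (-b), ⟨D.group.mul_mem hv (c.hol_zpow_mem _), c.lift (t + b * c.len),
    c.lift_mem_Hyp _, le_max_of_le_left (hC₀ _ ⟨hb.1, hb.2.le⟩), le_max_of_le_right ?_⟩, ?_⟩
  · rw [Ad_mul, c.hol_zpow_lift]
    have : t + b * c.len + ((-b : ℤ) : ℝ) * c.len = t := by push_cast; ring
    rw [this, ← ht, Ad_Ad_inv]
    exact mem_arc_time_le (D.corner_mem 0) hx hz
  · simp only [Ad_mul, c.Ad_hol_zpow_normal]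

/-- The sum over all geodesics of the multicurve that separate `x` from `y` of the unit normal
vectors that point towards `y`. -/
def jump (x y : V) : V := ∑ᶠ m ∈ c.normals, (beyond m y - beyond m x) • m

theorem jump_Ad {v : Lorentz} (hv : v ∈ D.group) (x y : V)
    (hfin : (c.normals ∩ Function.support fun m => (beyond m y - beyond m x) • m).Finite) :
    c.jump (Ad v x) (Ad v y) = Ad v (c.jump x y) := by
  rw [jump, jump]
  have h1 := AddMonoidHom.map_finsum_mem' (Ad v : V →+ V) hfin
  simp only [AddMonoidHom.coe_coe] at h1
  rw [h1]
  refine (finsum_mem_eq_of_bijOn (Ad v) ⟨fun m hm => (c.Ad_mem_normals_iff hv).2 hm,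
    (Ad_injective v).injOn, fun m hm => ⟨Ad v⁻¹ m, ?_, Ad_Ad_inv v m⟩⟩ fun m _ => ?_).symm
  · rwa [← c.Ad_mem_normals_iff hv, Ad_Ad_inv]
  · rw [map_smul, beyond_Ad, beyond_Ad]

/-! ### The cocycle property of `ρ` -/

section OffMulticurve

variable {x y : V}

theorem mem_crossed_iff (hg : 2 ≤ g) (hx : x ∈ Hyp) (hxc : x ∉ c.multicurve) {m : V}
    (hm : m ∈ c.normals) : m ∈ c.crossed x ↔ beyond m x - beyond m (D.corner 0) ≠ 0 := by
  rw [← arc_inter_nonempty_iff (D.corner_mem 0) hx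
    (c.mdot_ne_zero (D.corner_mem 0) (c.corner_notMem_multicurve hg (by omega)) hm)
    (c.mdot_ne_zero hx hxc hm)]
  exact ⟨fun h => h.2, fun h => ⟨hm, h⟩⟩

/-- For a crossed geodesic the sign `ε` is the change of the half-space indicator from `p₀` to `x`;
for all others this change is zero. -/
theorem rho_eq (hg : 2 ≤ g) (w : ℝ) (hx : x ∈ Hyp) (hxc : x ∉ c.multicurve) :
    c.rho w x = w • c.jump (D.corner 0) x := by
  rw [rho, jump]
  congr 1
  have h1 : ∑ᶠ m ∈ c.normals, (beyond m x - beyond m (D.corner 0)) • m =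
      ∑ᶠ m ∈ c.crossed x, (beyond m x - beyond m (D.corner 0)) • m := by
    refine finsum_mem_inter_support_eq _ _ _ (Set.ext fun m => ⟨fun h => ⟨?_, h.2⟩,
      fun h => ⟨h.1.1, h.2⟩⟩)
    exact (c.mem_crossed_iff hg hx hxc h.1).2 fun h0 => h.2 (by simp only [h0, zero_smul])
  rw [h1]
  refine finsum_mem_congr rfl fun m hm => ?_
  have h2 := (c.mem_crossed_iff hg hx hxc hm.1).1 hm
  congr 1
  unfold beyond at *
  split_ifs at * <;> simp_all

theorem jump_support_finite (hg : 2 ≤ g) (hx : x ∈ Hyp) (hxc : x ∉ c.multicurve) :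
    (c.normals ∩ Function.support fun m => (beyond m x - beyond m (D.corner 0)) • m).Finite := by
  refine (c.crossed_finite hg hx).subset fun m hm => ?_
  exact (c.mem_crossed_iff hg hx hxc hm.1).2 fun h0 => hm.2 (by simp only [h0, zero_smul])

theorem jump_sub_jump (hg : 2 ≤ g) (hx : x ∈ Hyp) (hxc : x ∉ c.multicurve) (hy : y ∈ Hyp)
    (hyc : y ∉ c.multicurve) :
    c.jump (D.corner 0) y - c.jump (D.corner 0) x = c.jump x y := by
  have hneg := AddMonoidHom.map_finsum_mem' (negAddMonoidHom (α := V))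
    (c.jump_support_finite hg hx hxc)
  simp only [negAddMonoidHom_apply] at hneg
  rw [jump, jump, jump, sub_eq_add_neg, hneg, ← finsum_mem_add_distrib'
    (c.jump_support_finite hg hy hyc) (by
      simpa only [Function.support_fun_neg] using c.jump_support_finite hg hx hxc)]
  refine finsum_mem_congr rfl fun m _ => ?_
  module

theorem rho_sub_rho (hg : 2 ≤ g) (w : ℝ) (hx : x ∈ Hyp) (hxc : x ∉ c.multicurve) (hy : y ∈ Hyp)
    (hyc : y ∉ c.multicurve) : c.rho w y - c.rho w x = w • c.jump x y := by
  rw [c.rho_eq hg w hx hxc, c.rho_eq hg w hy hyc, ← smul_sub, c.jump_sub_jump hg hx hxc hy hyc]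

/-- Γ permutes the normals, so the jump from `v p₀` to `v x` is `Ad v` of the jump from `p₀` to `x`.
-/
theorem rho_Ad (hg : 2 ≤ g) (w : ℝ) {v : Lorentz} (hv : v ∈ D.group) (hx : x ∈ Hyp)
    (hxc : x ∉ c.multicurve) :
    c.rho w (Ad v x) = c.rho w (Ad v (D.corner 0)) + Ad v (c.rho w x) := by
  have h0 := c.corner_notMem_multicurve hg (Nat.zero_le _)
  have h1 := c.rho_sub_rho hg w (Ad_mem_Hyp v (D.corner_mem 0))
    (mt (c.Ad_mem_multicurve_iff hv).1 h0) (Ad_mem_Hyp v hx) (mt (c.Ad_mem_multicurve_iff hv).1 hxc)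
  rw [c.jump_Ad hv _ _ (c.jump_support_finite hg hx hxc), ← map_smul, ← c.rho_eq hg w hx hxc] at h1
  rw [← h1]
  abel

theorem grafted_gen (hg : 2 ≤ g) (F : StaticFrame D) (w T : ℝ) (z : Gen g) (hx : x ∈ D.side z)
    (hxc : x ∉ c.multicurve) : c.grafted F w T (Ad (D.gen z) x) =
      ⟨D.gen z, c.rho w (Ad (D.gen z) (D.corner 0))⟩ * c.grafted F w T x := by
  have hx' : x ∈ Hyp := by
    rw [FundamentalPolygon.side_eq] at hx
    exact hx.1
  rw [grafted, grafted, F.overlap z x hx, c.rho_Ad hg w (D.gen_mem z) hx' hxc]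
  ext1
  · rfl
  · simp only [Poincare.mul_a, map_add, map_smul]
    abel

end OffMulticurve

end SimpleClosedGeodesic

/-! ### Crossings of the closed geodesic with the sides of the polygon -/

namespace SimpleClosedGeodesic

variable {g : ℕ} {D : FundamentalPolygon g} (c : SimpleClosedGeodesic D)

/-- The velocity with which the geodesic `Ad(v) c_{p,q}` moves away from the side `y` at the
time `t`. -/
def speed (v : Lorentz) (y : Gen g) (t : ℝ) : ℝ :=
  D.height y.idx (Ad v (geodTangent c.p c.q t))

section Crossing

variable {v : Lorentz} {y : Gen g} {t : ℝ}

theorem height_lift (hx : Ad v (c.lift t) ∈ D.innerEdge y.idx) (h : ℝ) :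
    D.height y.idx (Ad v (c.lift (t + h))) = Real.sinh h * c.speed v y t := by
  have h0 := FundamentalPolygon.height_eq_zero hx.1
  rw [FundamentalPolygon.height, lift] at h0
  rw [lift, geod_add, map_add, map_smul, map_smul, FundamentalPolygon.height, mdot_add_right,
    mdot_smul_right, mdot_smul_right, h0, speed, FundamentalPolygon.height]
  ring

/-- The normal is position times velocity at the crossing. With the position a positive combination
of the corners, its products with them are determinants of opposite sign proportional to the speed.
-/
theorem exists_mdot_normal_corner (hx : Ad v (c.lift t) ∈ D.innerEdge y.idx) :
    ∃ r s : ℝ, 0 < r ∧ 0 < s ∧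
      mdot (Ad v c.normal) (D.corner y.idx) = s * c.speed v y t ∧
      mdot (Ad v c.normal) (D.corner (y.idx + 1)) = -(r * c.speed v y t) := by
  obtain ⟨r, s, hr, hs, h⟩ := exists_pos_of_mem_arc (D.corner_mem _) (D.corner_mem _) hx.1 hx.2.1
    hx.2.2
  refine ⟨r, s, hr, hs, ?_⟩
  rw [normal, ← mcross_geod c.p c.q t, ← mcross_Ad, ← lift, h, speed, FundamentalPolygon.height]
  constructor <;> simp [mdot, mcross] <;> ring

/-- Transversality: with zero speed the geodesic would contain a corner. -/
theorem speed_ne_zero (hg : 2 ≤ g) (hv : v ∈ D.group)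
    (hx : Ad v (c.lift t) ∈ D.innerEdge y.idx) : c.speed v y t ≠ 0 := by
  intro h0
  obtain ⟨r, s, -, -, h, -⟩ := c.exists_mdot_normal_corner hx
  rw [h0, mul_zero] at h
  exact c.mdot_ne_zero (D.corner_mem _) (c.corner_notMem_multicurve hg y.idx_lt.le) ⟨v, hv, rfl⟩ h

/-- The side of the geodesic on which the end points of a crossed side lie. -/
theorem beyond_sub_beyond (hx : Ad v (c.lift t) ∈ D.innerEdge y.idx) (σ : ℤˣ)
    (h : 0 < ((σ : ℤ) : ℝ) * c.speed v y t) :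
    beyond (Ad v c.normal) (D.corner (y.idx + 1)) - beyond (Ad v c.normal) (D.corner y.idx) =
      ((σ : ℤ) : ℝ) := by
  obtain ⟨r, s, hr, hs, h1, h2⟩ := c.exists_mdot_normal_corner hx
  rw [beyond, beyond, h1, h2]
  rcases Int.units_eq_one_or σ with rfl | rfl
  · simp only [Units.val_one, Int.cast_one, one_mul] at h ⊢
    rw [if_pos (neg_neg_of_pos (mul_pos hr h)), if_neg (mul_pos hs h).not_gt]
    ring
  · have h' : c.speed v y t < 0 := by simpa using h
    rw [if_neg (neg_pos.2 (mul_neg_of_pos_of_neg hr h')).not_gt,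
      if_pos (mul_neg_of_pos_of_neg hs h')]
    simp

theorem tendsto_lift (v : Lorentz) (t : ℝ) :
    Filter.Tendsto (fun h => Ad v (c.lift (t + h))) (𝓝 0) (𝓝[Hyp] (Ad v (c.lift t))) := by
  refine tendsto_nhdsWithin_iff.2 ⟨?_, Filter.Eventually.of_forall fun h =>
    Ad_mem_Hyp v (c.lift_mem_Hyp _)⟩
  have hc : Continuous fun h => Ad v (c.lift (t + h)) :=
    (continuous_Ad v).comp (c.continuous_lift.comp (by fun_prop))
  simpa using hc.tendsto 0

theorem eventually_lift_mem_iff (hx : Ad v (c.lift t) ∈ D.innerEdge y.idx) :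
    ∀ᶠ h in 𝓝 (0 : ℝ), Ad v (c.lift (t + h)) ∈ D.region ↔ 0 ≤ Real.sinh h * c.speed v y t := by
  filter_upwards [(c.tendsto_lift v t).eventually
    (FundamentalPolygon.eventually_mem_region_iff y.idx_lt hx)] with h hh
  rw [hh, c.height_lift hx]

theorem eventually_gen_lift_mem_iff (hx : Ad v (c.lift t) ∈ D.innerEdge y.idx) :
    ∀ᶠ h in 𝓝 (0 : ℝ), Ad (D.gen y * v) (c.lift (t + h)) ∈ D.region ↔
      Real.sinh h * c.speed v y t ≤ 0 := by
  filter_upwards [(c.tendsto_lift v t).eventually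
    (FundamentalPolygon.eventually_gen_mem_region_iff y hx)] with h hh
  rw [Ad_mul, hh, c.height_lift hx]

/-- A geodesic that is in the polygon immediately after it crosses a side or in the paired polygon
immediately before crosses the side in the direction of the polygon. -/
theorem speed_pos (hg : 2 ≤ g) (hv : v ∈ D.group) (hx : Ad v (c.lift t) ∈ D.innerEdge y.idx)
    {ε : ℝ} (hε : 0 < ε)
    (h : (∀ h ∈ Set.Icc 0 ε, Ad v (c.lift (t + h)) ∈ D.region) ∨
      ∀ h ∈ Set.Icc (-ε) 0, Ad (D.gen y * v) (c.lift (t + h)) ∈ D.region) :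
    0 < c.speed v y t := by
  refine lt_of_le_of_ne ?_ (c.speed_ne_zero hg hv hx).symm
  rcases h with h | h
  · obtain ⟨s, hs, hs'⟩ := (((c.eventually_lift_mem_iff hx).filter_mono nhdsWithin_le_nhds).and
      (Ioo_mem_nhdsGT hε)).exists
    exact nonneg_of_mul_nonneg_right (hs.1 (h s ⟨hs'.1.le, hs'.2.le⟩)) (Real.sinh_pos_iff.2 hs'.1)
  · obtain ⟨s, hs, hs'⟩ := (((c.eventually_gen_lift_mem_iff hx).filter_mono
      nhdsWithin_le_nhds).and (Ioo_mem_nhdsLT (neg_lt_zero.2 hε))).exists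
    have h1 := hs.1 (h s ⟨hs'.1.le, hs'.2.le⟩)
    have h2 := Real.sinh_neg_iff.2 hs'.2
    by_contra hneg
    exact absurd h1 (not_le.2 (mul_pos_of_neg_of_neg h2 (not_le.1 hneg)))

theorem speed_neg (hg : 2 ≤ g) (hv : v ∈ D.group) (hx : Ad v (c.lift t) ∈ D.innerEdge y.idx)
    {ε : ℝ} (hε : 0 < ε)
    (h : (∀ h ∈ Set.Icc 0 ε, Ad (D.gen y * v) (c.lift (t + h)) ∈ D.region) ∨
      ∀ h ∈ Set.Icc (-ε) 0, Ad v (c.lift (t + h)) ∈ D.region) :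
    c.speed v y t < 0 := by
  refine lt_of_le_of_ne ?_ (c.speed_ne_zero hg hv hx)
  by_contra hpos
  rw [not_le] at hpos
  rcases h with h | h
  · obtain ⟨s, hs, hs'⟩ := (((c.eventually_gen_lift_mem_iff hx).filter_mono
      nhdsWithin_le_nhds).and (Ioo_mem_nhdsGT hε)).exists
    exact absurd (hs.1 (h s ⟨hs'.1.le, hs'.2.le⟩))
      (not_le.2 (mul_pos (Real.sinh_pos_iff.2 hs'.1) hpos))
  · obtain ⟨s, hs, hs'⟩ := (((c.eventually_lift_mem_iff hx).filter_mono
      nhdsWithin_le_nhds).and (Ioo_mem_nhdsLT (neg_lt_zero.2 hε))).exists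
    exact absurd (hs.1 (h s ⟨hs'.1.le, hs'.2.le⟩))
      (not_le.2 (mul_neg_of_neg_of_pos (Real.sinh_neg_iff.2 hs'.2) hpos))

/-- The two tiles that meet in an inner point of the side `y`, seen from a group element `v`. -/
theorem eq_or_eq_gen_mul (hg : 2 ≤ g) (hv : v ∈ D.group)
    (hx : Ad v (c.lift t) ∈ D.innerEdge y.idx) {E : Lorentz} (hE : E ∈ D.group)
    (hEx : Ad E (c.lift t) ∈ D.region) : E = v ∨ E = D.gen y * v := by
  rcases FundamentalPolygon.eq_one_or_eq_gen hg y hx (D.group.mul_mem hE (D.group.inv_mem hv))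
    (by rwa [Ad_mul, Ad_inv_Ad]) with h | h
  · exact Or.inl (mul_inv_eq_one.1 h)
  · exact Or.inr (mul_inv_eq_iff_eq_mul.1 h)

/-- A geodesic that crosses a side changes the tile. -/
theorem not_stay_in_tile (hg : 2 ≤ g) (hv : v ∈ D.group)
    (hx : Ad v (c.lift t) ∈ D.innerEdge y.idx) {E : Lorentz} (hE : E ∈ D.group) {ε : ℝ}
    (hε : 0 < ε) (h : ∀ h ∈ Set.Icc (-ε) ε, Ad E (c.lift (t + h)) ∈ D.region) : False := by
  have h1 : ∀ h ∈ Set.Icc 0 ε, Ad E (c.lift (t + h)) ∈ D.region := fun s hs =>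
    h s ⟨by linarith [hs.1], hs.2⟩
  have h2 : ∀ h ∈ Set.Icc (-ε) 0, Ad E (c.lift (t + h)) ∈ D.region := fun s hs =>
    h s ⟨hs.1, by linarith [hs.2]⟩
  rcases c.eq_or_eq_gen_mul hg hv hx hE (by simpa using h 0 ⟨by linarith, hε.le⟩) with rfl | rfl
  · linarith [c.speed_pos hg hv hx hε (Or.inl h1), c.speed_neg hg hv hx hε (Or.inr h2)]
  · linarith [c.speed_pos hg hv hx hε (Or.inr h2), c.speed_neg hg hv hx hε (Or.inl h1)]

end Crossing

/-- Two tiles meet at `x`, so it is a boundary point, and it is not a corner. The second tile at an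
inner point of a side determines the side, since generators and their inverses are distinct. -/
theorem mem_innerEdge (hg : 2 ≤ g) {y : Gen g} {x : V} (hx : x ∈ D.region)
    (hyx : Ad (D.gen y) x ∈ D.region) (hxc : x ∈ c.multicurve) : x ∈ D.innerEdge y.idx := by
  have h1 := FundamentalPolygon.notMem_relInterior hg (D.gen_mem y)
    (FundamentalPolygon.gen_ne_one hg y) hyx
  rcases FundamentalPolygon.mem_innerEdge_or_corner hx h1 with ⟨k, hk, h⟩ | ⟨k, hk, rfl⟩
  · obtain ⟨z, rfl | rfl⟩ := Gen.exists_idx hk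
    · have := (FundamentalPolygon.eq_one_or_eq_gen hg z h (D.gen_mem y) hyx).resolve_left
        (FundamentalPolygon.gen_ne_one hg y)
      rwa [FundamentalPolygon.gen_injective hg this]
    · have := (FundamentalPolygon.eq_one_or_eq_gen_inv hg z h (D.gen_mem y) hyx).resolve_left
        (FundamentalPolygon.gen_ne_one hg y)
      exact absurd this.symm (FundamentalPolygon.gen_inv_ne_gen hg z y)
  · exact absurd hxc (c.corner_notMem_multicurve hg hk.le)

/-! ### Letters of the itinerary and crossings of the sides -/

/-- The times, counted backwards, at which the lift changes the tile. -/
structure Traversal (X : Word g) (θ : ℕ → ℝ) : Prop where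
  eval : evalWord D.gen X = c.hol
  zero : θ 0 = 0
  last : θ (X.length + 1) = c.len
  le_succ : ∀ k ≤ X.length, θ k ≤ θ (k + 1)
  lt_succ : ∀ k, 1 ≤ k → k < X.length → θ k < θ (k + 1)
  mem : ∀ k ≤ X.length, ∀ t ∈ Set.Icc (θ k) (θ (k + 1)),
    Ad (evalWord D.gen (X.take k)) (c.lift (-t)) ∈ D.region

/-- Translating the period by the inverse holonomy and reversing time cancels the suffix of the
word. The tile at step `k` is then described by the prefix `X.take k`, as in `crossingSum`. -/
theorem IsItinerary.exists_traversal {c : SimpleClosedGeodesic D} {X : Word g}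
    (hX : c.IsItinerary X) : ∃ θ, c.Traversal X θ := by
  obtain ⟨heval, s, s0, s1, hle, hlt, hmem⟩ := hX
  refine ⟨fun k => c.len - s (X.length + 1 - k), heval, ?_, ?_, fun k hk => ?_, fun k h1 h2 => ?_,
    fun k hk t ht => ?_⟩
  · simp [s1]
  · simp [s0]
  · have := hle (X.length - k) (by omega)
    rw [show X.length - k + 1 = X.length + 1 - k by omega] at this
    rw [show X.length + 1 - (k + 1) = X.length - k by omega]
    linarith
  · have := hlt (X.length - k) (by omega) (by omega)
    rw [show X.length - k + 1 = X.length + 1 - k by omega] at this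
    rw [show X.length + 1 - (k + 1) = X.length - k by omega]
    linarith
  · rw [show X.length + 1 - (k + 1) = X.length - k by omega] at ht
    have h := hmem (X.length - k) (by omega) (c.len - t) ⟨by linarith [ht.2], by
      rw [show X.length - k + 1 = X.length + 1 - k by omega]; linarith [ht.1]⟩
    rw [mem_Ad_image, show X.length - (X.length - k) = k by omega] at h
    have e : geod c.p c.q (c.len - t) = Ad c.hol (c.lift (-t)) := by
      rw [c.hol_lift, lift]; ring_nf
    rw [e, ← heval, ← Ad_mul] at h
    have e2 : evalWord D.gen X = evalWord D.gen (X.drop k) * evalWord D.gen (X.take k) := by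
      rw [← evalWord_append, List.take_append_drop]
    rwa [e2, inv_mul_cancel_left] at h

/-- The group element that moves the crossing with number `k` to the polygon. -/
def crossElt (D : FundamentalPolygon g) (X : Word g) (k : Fin X.length) : Lorentz :=
  if (X.get k).2 = 1 then evalWord D.gen (X.take k) else evalWord D.gen (X.take (k + 1))

theorem crossElt_mem (X : Word g) (k : Fin X.length) : crossElt D X k ∈ D.group := by
  unfold crossElt
  split_ifs <;> exact evalWord_mem D.gen_mem _

/-- Both signs merge once each crossing is moved to the side `y` itself and not to its partner; for
exponent `-1` this takes the longer prefix. -/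
theorem crossingSum_eq (n : V) (X : Word g) (y : Gen g) :
    crossingSum D.gen n X y = ∑ k : Fin X.length with (X.get k).1 = y,
      (((X.get k).2 : ℤ) : ℝ) • Ad (crossElt D X k) n := by
  rw [crossingSum, Finset.sum_filter, Finset.sum_filter, Finset.sum_filter,
    ← Finset.sum_sub_distrib]
  refine Finset.sum_congr rfl fun k _ => ?_
  by_cases hy : (X.get k).1 = y
  · rcases Int.units_eq_one_or (X.get k).2 with h | h
    · simp only [hy, h, crossElt]; simp
    · simp only [hy, h, crossElt]; simp
  · simp only [hy]; simp

namespace Traversal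

variable {c} {X : Word g} {θ : ℕ → ℝ} (hθ : c.Traversal X θ)

include hθ

theorem length_pos : 0 < X.length := by
  rcases Nat.eq_zero_or_pos X.length with h | h
  · have hX := List.length_eq_zero_iff.1 h
    have h1 := hθ.eval
    rw [hX, evalWord_nil] at h1
    have h2 := c.hol_lift 0
    rw [← h1, Ad_one] at h2
    have := c.lift_injective h2
    linarith [c.len_pos]
  · exact h

theorem le {i j : ℕ} (hij : i ≤ j) (hj : j ≤ X.length + 1) : θ i ≤ θ j := by
  induction j, hij using Nat.le_induction with
  | base => exact le_rfl
  | succ j _ ih => exact (ih (by omega)).trans (hθ.le_succ j (by omega))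

theorem lt {i j : ℕ} (hi : 1 ≤ i) (hij : i < j) (hj : j ≤ X.length) : θ i < θ j :=
  (hθ.lt_succ i hi (by omega)).trans_le (hθ.le hij (by omega))

theorem nonneg {i : ℕ} (hi : i ≤ X.length + 1) : 0 ≤ θ i :=
  hθ.zero.symm.le.trans (hθ.le (Nat.zero_le i) hi)

theorem le_len {i : ℕ} (hi : i ≤ X.length + 1) : θ i ≤ c.len :=
  (hθ.le hi le_rfl).trans hθ.last.le

theorem mem_left (k : Fin X.length) :
    Ad (evalWord D.gen (X.take k)) (c.lift (-θ (k + 1))) ∈ D.region :=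
  hθ.mem k k.2.le _ ⟨hθ.le_succ k k.2.le, le_rfl⟩

theorem mem_right (k : Fin X.length) :
    Ad (evalWord D.gen (X.take (k + 1))) (c.lift (-θ (k + 1))) ∈ D.region :=
  hθ.mem (k + 1) k.2 _ ⟨le_rfl, hθ.le_succ (k + 1) k.2⟩

omit hθ in
theorem take_eq_of_pos {k : Fin X.length} (h : (X.get k).2 = 1) :
    crossElt D X k = evalWord D.gen (X.take k) ∧
    D.gen (X.get k).1 * crossElt D X k = evalWord D.gen (X.take (k + 1)) := by
  rw [evalWord_take_succ, crossElt, if_pos h, h]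
  simp

omit hθ in
theorem take_eq_of_neg {k : Fin X.length} (h : (X.get k).2 = -1) :
    crossElt D X k = evalWord D.gen (X.take (k + 1)) ∧
    D.gen (X.get k).1 * crossElt D X k = evalWord D.gen (X.take k) := by
  rw [crossElt, if_neg (by rw [h]; decide), evalWord_take_succ, h]
  simp

theorem crossElt_mem_innerEdge (hg : 2 ≤ g) (k : Fin X.length) :
    Ad (crossElt D X k) (c.lift (-θ (k + 1))) ∈ D.innerEdge (X.get k).1.idx := by
  refine c.mem_innerEdge hg ?_ ?_ ⟨_, crossElt_mem X k, _, rfl⟩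
  · rcases Int.units_eq_one_or (X.get k).2 with h | h
    · rw [(take_eq_of_pos h).1]; exact hθ.mem_left k
    · rw [(take_eq_of_neg h).1]; exact hθ.mem_right k
  · rw [← Ad_mul]
    rcases Int.units_eq_one_or (X.get k).2 with h | h
    · rw [(take_eq_of_pos h).2]; exact hθ.mem_right k
    · rw [(take_eq_of_neg h).2]; exact hθ.mem_left k

theorem mem_after (k : Fin X.length) : ∀ h ∈ Set.Icc 0 (θ (k + 1) - θ k),
    Ad (evalWord D.gen (X.take k)) (c.lift (-θ (k + 1) + h)) ∈ D.region := fun h hh => by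
  have := hθ.mem k k.2.le (θ (k + 1) - h) ⟨by linarith [hh.2], by linarith [hh.1]⟩
  rwa [neg_sub, sub_eq_neg_add] at this

theorem mem_before (k : Fin X.length) : ∀ h ∈ Set.Icc (-(θ (k + 2) - θ (k + 1))) 0,
    Ad (evalWord D.gen (X.take (k + 1))) (c.lift (-θ (k + 1) + h)) ∈ D.region := fun h hh => by
  have := hθ.mem (k + 1) k.2 (θ (k + 1) - h) ⟨by linarith [hh.2], by
    change _ ≤ θ (k + 2); linarith [hh.1]⟩
  rwa [neg_sub, sub_eq_neg_add] at this

/-- Either before or after each crossing there is a time interval without crossing. -/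
theorem lt_or_lt (k : Fin X.length) : θ k < θ (k + 1) ∨ θ (k + 1) < θ (k + 2) := by
  rcases Nat.eq_zero_or_pos (k : ℕ) with h0 | h0
  · rw [h0]
    by_cases h1 : θ 0 < θ 1
    · exact Or.inl h1
    · right
      have e : θ 1 = 0 := le_antisymm (hθ.zero ▸ not_lt.1 h1) (hθ.nonneg (by omega))
      have hr := hθ.length_pos
      rcases Nat.lt_or_ge 1 X.length with h2 | h2
      · exact hθ.lt_succ 1 le_rfl h2
      · have h3 := hθ.last
        rw [show X.length = 1 by omega] at h3
        change θ 1 < θ 2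
        rw [e]
        exact h3 ▸ c.len_pos
  · exact Or.inl (hθ.lt_succ k h0 k.2)

/-- After moving the crossing to the side `y`, exponent `1` means that the geodesic enters the
polygon and exponent `-1` that it leaves it; this fixes the sign of the speed. -/
theorem beyond_sub_beyond (hg : 2 ≤ g) (k : Fin X.length) :
    beyond (Ad (crossElt D X k) c.normal) (D.corner ((X.get k).1.idx + 1)) -
      beyond (Ad (crossElt D X k) c.normal) (D.corner (X.get k).1.idx) =
      (((X.get k).2 : ℤ) : ℝ) := by
  have hx := hθ.crossElt_mem_innerEdge hg k
  have hv := crossElt_mem (D := D) X k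
  refine c.beyond_sub_beyond hx _ ?_
  have h1 := hθ.mem_after k
  have h2 := hθ.mem_before k
  rcases Int.units_eq_one_or (X.get k).2 with h | h
  · rw [h, Units.val_one, Int.cast_one, one_mul]
    rw [← (take_eq_of_pos h).1] at h1
    rw [← (take_eq_of_pos h).2] at h2
    rcases hθ.lt_or_lt k with h3 | h3
    · exact c.speed_pos hg hv hx (sub_pos.2 h3) (Or.inl h1)
    · exact c.speed_pos hg hv hx (sub_pos.2 h3) (Or.inr h2)
  · rw [← (take_eq_of_neg h).2] at h1
    rw [← (take_eq_of_neg h).1] at h2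
    have : c.speed (crossElt D X k) (X.get k).1 (-θ (k + 1)) < 0 := by
      rcases hθ.lt_or_lt k with h3 | h3
      · exact c.speed_neg hg hv hx (sub_pos.2 h3) (Or.inl h1)
      · exact c.speed_neg hg hv hx (sub_pos.2 h3) (Or.inr h2)
    rw [h]
    simpa using this

/-- A crossing of the side `y` at the time of the letter `k` comes from this letter. -/
theorem eq_crossElt (hg : 2 ≤ g) {v : Lorentz} (hv : v ∈ D.group) {y : Gen g} (k : Fin X.length)
    (hx : Ad v (c.lift (-θ (k + 1))) ∈ D.innerEdge y.idx) :
    (X.get k).1 = y ∧ crossElt D X k = v := by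
  have h1 := c.eq_or_eq_gen_mul hg hv hx (evalWord_mem D.gen_mem _) (hθ.mem_left k)
  have h2 := c.eq_or_eq_gen_mul hg hv hx (evalWord_mem D.gen_mem _) (hθ.mem_right k)
  have hz1 := FundamentalPolygon.gen_ne_one (D := D) hg (X.get k).1
  rcases Int.units_eq_one_or (X.get k).2 with h | h
  · rw [← (take_eq_of_pos h).1] at h1
    rw [← (take_eq_of_pos h).2] at h2
    rcases h1 with h1 | h1
    · rw [h1] at h2
      rcases h2 with h2 | h2
      · exact absurd (mul_eq_right.1 h2) hz1
      · exact ⟨FundamentalPolygon.gen_injective hg (mul_right_cancel h2), h1⟩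
    · rw [h1] at h2
      rcases h2 with h2 | h2
      · rw [← mul_assoc, mul_eq_right, mul_eq_one_iff_eq_inv] at h2
        exact absurd h2.symm (FundamentalPolygon.gen_inv_ne_gen hg _ _)
      · exact absurd (mul_eq_right.1 h2) hz1
  · rw [← (take_eq_of_neg h).2] at h1
    rw [← (take_eq_of_neg h).1] at h2
    rcases h2 with h2 | h2
    · rw [h2] at h1
      rcases h1 with h1 | h1
      · exact absurd (mul_eq_right.1 h1) hz1
      · exact ⟨FundamentalPolygon.gen_injective hg (mul_right_cancel h1), h2⟩
    · rw [h2] at h1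
      rcases h1 with h1 | h1
      · rw [← mul_assoc, mul_eq_right, mul_eq_one_iff_eq_inv] at h1
        exact absurd h1.symm (FundamentalPolygon.gen_inv_ne_gen hg _ _)
      · exact absurd (mul_eq_right.1 h1) hz1

theorem injOn (hg : 2 ≤ g) (y : Gen g) :
    Set.InjOn (fun k : Fin X.length => Ad (crossElt D X k) c.normal)
      {k | (X.get k).1 = y} := by
  have key : ∀ k l : Fin X.length, (X.get k).1 = y → (X.get l).1 = y →
      Ad (crossElt D X k) c.normal = Ad (crossElt D X l) c.normal → θ (k + 1) ≤ θ (l + 1) →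
      k = l := by
    intro k l hk hl h hkl
    have hvk := crossElt_mem (D := D) X k
    have hvl := crossElt_mem (D := D) X l
    obtain ⟨b, hb⟩ := c.eq_mul_hol_zpow hvk hvl h
    have hxk := hθ.crossElt_mem_innerEdge hg k
    have hxl := hθ.crossElt_mem_innerEdge hg l
    have hσ : (X.get k).2 = (X.get l).2 := by
      have h1 := hθ.beyond_sub_beyond hg k
      have h2 := hθ.beyond_sub_beyond hg l
      rw [h, hk, ← hl, h2] at h1
      exact Units.ext (by exact_mod_cast h1.symm)
    rw [hk] at hxk
    rw [hl, hb, Ad_mul, c.hol_zpow_lift] at hxl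
    have hh := FundamentalPolygon.height_eq_zero hxl.1
    rw [show -θ (l + 1) + b * c.len = -θ (k + 1) + (θ (k + 1) - θ (l + 1) + b * c.len) by ring,
      c.height_lift hxk] at hh
    have hd : θ (l + 1) - θ (k + 1) = b * c.len := by
      have := (mul_eq_zero.1 hh).resolve_right (c.speed_ne_zero hg hvk hxk)
      rw [Real.sinh_eq_zero] at this
      linarith
    have hk0 := hθ.nonneg (i := k + 1) (by omega)
    have hll := hθ.le_len (i := l + 1) (by omega)
    have hlen := c.len_pos
    have hb0 : 0 ≤ b := by
      by_contra hneg
      have : (b : ℝ) ≤ -1 := by exact_mod_cast (by omega : b ≤ -1)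
      nlinarith
    have hb1 : b ≤ 1 := by
      by_contra hneg
      have : (2 : ℝ) ≤ b := by exact_mod_cast (by omega : 2 ≤ b)
      nlinarith
    -- Both times lie in `[0, len]`. If they differ by a full period, the first and the last letter
    -- describe the same crossing, and comparing prefixes forces the generator to be trivial.
    obtain rfl | rfl : b = 0 ∨ b = 1 := by omega
    · have he : θ (l + 1) = θ (k + 1) := by
        rw [Int.cast_zero, zero_mul] at hd
        linarith
      rcases lt_trichotomy (k : ℕ) l with h1 | h1 | h1
      · exact absurd he (hθ.lt (by omega) (by omega) l.2).ne'
      · exact Fin.ext h1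
      · exact absurd he (hθ.lt (by omega) (by omega) k.2).ne
    · exfalso
      rw [Int.cast_one, one_mul] at hd
      have hk1 : (k : ℕ) = 0 := by
        by_contra h0
        have := hθ.lt (i := k) (j := k + 1) (by omega) (by omega) k.2
        have := hθ.nonneg (i := k) (by omega)
        linarith
      have hl1 : (l : ℕ) + 1 = X.length := by
        by_contra h0
        have := hθ.lt (i := l + 1) (j := l + 2) (by omega) (by omega) (by omega)
        have := hθ.le_len (i := l + 2) (by omega)
        linarith
      have hz1 := FundamentalPolygon.gen_ne_one (D := D) hg y
      rw [zpow_one] at hb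
      rcases Int.units_eq_one_or (X.get k).2 with h1 | h1
      · have e1 := (take_eq_of_pos (D := D) h1).1
        have e2 := (take_eq_of_pos (D := D) (hσ ▸ h1)).2
        rw [hk1, List.take_zero, evalWord_nil] at e1
        rw [hl1, List.take_length, hθ.eval, hb, e1, one_mul, mul_eq_right, hl] at e2
        exact hz1 e2
      · have e1 := (take_eq_of_neg (D := D) h1).2
        have e2 := (take_eq_of_neg (D := D) (hσ ▸ h1)).1
        rw [hk1, List.take_zero, evalWord_nil, hk] at e1
        rw [hl1, List.take_length, hθ.eval, hb, mul_eq_right] at e2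
        rw [e2, mul_one] at e1
        exact hz1 e1
  intro k hk l hl h
  rcases le_total (θ (k + 1)) (θ (l + 1)) with h1 | h1
  · exact key k l hk hl h h1
  · exact (key l k hl hk h.symm h1).symm

theorem exists_crossElt (hg : 2 ≤ g) {y : Gen g} {v : Lorentz} (hv : v ∈ D.group) {t : ℝ}
    (hx : Ad v (c.lift t) ∈ D.innerEdge y.idx) :
    ∃ k : Fin X.length, (X.get k).1 = y ∧ Ad (crossElt D X k) c.normal = Ad v c.normal := by
  have shift : ∀ b : ℤ, Ad (v * c.hol ^ (-b)) (c.lift (t + b * c.len)) = Ad v (c.lift t) := by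
    intro b
    rw [Ad_mul, c.hol_zpow_lift]
    congr 2
    push_cast; ring
  obtain ⟨b, hb, -⟩ := existsUnique_add_zsmul_mem_Ioc c.len_pos t (-c.len)
  rw [neg_add_cancel, zsmul_eq_mul] at hb
  have found : ∀ k : Fin X.length, ∀ b : ℤ, t + b * c.len = -θ (k + 1) →
      ∃ k : Fin X.length, (X.get k).1 = y ∧ Ad (crossElt D X k) c.normal = Ad v c.normal := by
    intro k b hk
    have hmem := D.group.mul_mem hv (c.hol_zpow_mem (-b))
    obtain ⟨h1, h2⟩ := hθ.eq_crossElt hg hmem k (y := y) (by rw [← hk, shift]; exact hx)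
    exact ⟨k, h1, by rw [h2, Ad_mul, c.Ad_hol_zpow_normal]⟩
  have hvb := D.group.mul_mem hv (c.hol_zpow_mem (-b))
  have hxb := hx
  rw [← shift b] at hxb
  set t' := t + b * c.len with ht'
  classical
  -- This selects the interval `θ k ≤ -t' < θ (k + 1)`. At its left end the crossing belongs to
  -- letter `k - 1`; in its inside the lift would cross a side without changing the tile.
  set k := Nat.findGreatest (fun k => θ k ≤ -t') X.length with hk
  have hk1 : θ k ≤ -t' :=
    Nat.findGreatest_spec (P := fun k => θ k ≤ -t') (Nat.zero_le _) (by
      simp only [hθ.zero]; linarith [hb.2])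
  have hkr : k ≤ X.length := Nat.findGreatest_le _
  have hk2 : -t' < θ (k + 1) := by
    rcases hkr.eq_or_lt with h | h
    · rw [h, hθ.last]; linarith [hb.1]
    · exact not_le.1 (Nat.findGreatest_is_greatest (P := fun k => θ k ≤ -t') (Nat.lt_succ_self k) h)
  rcases hk1.eq_or_lt with h1 | h1
  · rcases Nat.eq_zero_or_pos k with h0 | h0
    · rw [h0, hθ.zero] at h1
      rw [h0] at hk2
      rcases (hθ.le_len (i := X.length) (by omega)).eq_or_lt with h2 | h2
      · have hr := hθ.length_pos
        -- A crossing at time zero may be recorded at the end of the period, one length earlier.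
        refine found ⟨X.length - 1, by omega⟩ (b - 1) ?_
        simp only [Nat.sub_add_cancel hr, h2]
        push_cast
        linarith
      -- No change of tile is recorded at either end of the period. The holonomy glues the two ends,
      -- so the lift stays in the polygon on both sides of time zero.
      · exfalso
        refine c.not_stay_in_tile hg hvb hxb D.group.one_mem
          (ε := min (θ 1) (c.len - θ X.length)) (lt_min (by simpa [← h1] using hk2)
            (sub_pos.2 h2)) fun s hs => ?_
        rw [Ad_one]
        have ht0 : t' = 0 := by linarith
        rw [ht0, zero_add]
        have hs1 := hs.1.trans' (neg_le_neg (min_le_left (θ 1) (c.len - θ X.length)))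
        have hs2 := hs.2.trans (min_le_right (θ 1) (c.len - θ X.length))
        rcases le_total s 0 with h3 | h3
        · have := hθ.mem 0 (Nat.zero_le _) (-s) ⟨by rw [hθ.zero]; linarith, by
            change -s ≤ θ 1; linarith⟩
          rwa [List.take_zero, evalWord_nil, Ad_one, neg_neg] at this
        · have := hθ.mem X.length le_rfl (c.len - s) ⟨by linarith, by rw [hθ.last]; linarith⟩
          rw [List.take_length, hθ.eval, c.hol_lift] at this
          simpa using this
    · refine found ⟨k - 1, by omega⟩ b ?_
      simp only [Nat.sub_add_cancel h0]
      linarith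
  · exfalso
    refine c.not_stay_in_tile hg hvb hxb (evalWord_mem D.gen_mem (X.take k))
      (ε := min (-t' - θ k) (θ (k + 1) + t')) (lt_min (by linarith) (by linarith)) fun s hs => ?_
    have hs1 := hs.1.trans' (neg_le_neg (min_le_right (-t' - θ k) (θ (k + 1) + t')))
    have hs2 := hs.2.trans (min_le_left (-t' - θ k) (θ (k + 1) + t'))
    have := hθ.mem k hkr (-(t' + s)) ⟨by linarith, by linarith⟩
    rwa [neg_neg] at this

/-- A geodesic separates the corners of the side exactly when it meets the side in an inner point,
and each such meeting is recorded by exactly one letter. -/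
theorem bijOn (hg : 2 ≤ g) (y : Gen g) :
    Set.BijOn (fun k : Fin X.length => Ad (crossElt D X k) c.normal) {k | (X.get k).1 = y}
      {m | m ∈ c.normals ∧ beyond m (D.corner (y.idx + 1)) - beyond m (D.corner y.idx) ≠ 0} := by
  refine ⟨?_, hθ.injOn hg y, ?_⟩
  · rintro k rfl
    refine ⟨⟨_, crossElt_mem X k, rfl⟩, ?_⟩
    rw [hθ.beyond_sub_beyond hg k]
    exact_mod_cast (X.get k).2.ne_zero
  · rintro m ⟨hm, hne⟩
    have hP := c.mdot_ne_zero (D.corner_mem _) (c.corner_notMem_multicurve hg y.idx_lt.le) hm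
    have hQ := c.mdot_ne_zero (D.corner_mem _) (c.corner_notMem_multicurve hg y.idx_lt) hm
    obtain ⟨x, hx, hmx⟩ := (arc_inter_nonempty_iff (D.corner_mem y.idx)
      (D.corner_mem (y.idx + 1)) hP hQ).2 hne
    have hxi : x ∈ D.innerEdge y.idx := by
      refine ⟨hx, ?_, ?_⟩
      · rintro rfl; exact hP hmx
      · rintro rfl; exact hQ hmx
    obtain ⟨v, hv, rfl⟩ := hm
    have hmx' : mdot c.normal (Ad v⁻¹ x) = 0 := by rw [← mdot_Ad_left]; exact hmx
    obtain ⟨t, ht⟩ := c.exists_lift_eq (Ad_mem_Hyp v⁻¹ hx.1) hmx'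
    obtain ⟨k, hk, hk'⟩ := hθ.exists_crossElt hg hv (t := t) (y := y)
      (by rw [← ht, Ad_Ad_inv]; exact hxi)
    exact ⟨k, hk, hk'⟩

/-- The jump of the translation map along a side is the crossing sum. -/
theorem jump_eq_crossingSum (hg : 2 ≤ g) (y : Gen g) :
    c.jump (D.corner y.idx) (D.corner (y.idx + 1)) = crossingSum D.gen c.normal X y := by
  have h1 : c.jump (D.corner y.idx) (D.corner (y.idx + 1)) = ∑ᶠ m ∈ {m | m ∈ c.normals ∧
      beyond m (D.corner (y.idx + 1)) - beyond m (D.corner y.idx) ≠ 0},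
      (beyond m (D.corner (y.idx + 1)) - beyond m (D.corner y.idx)) • m := by
    rw [jump]
    refine finsum_mem_inter_support_eq _ _ _ (Set.ext fun m => ⟨fun h => ⟨⟨h.1, fun h0 => ?_⟩, h.2⟩,
      fun h => ⟨h.1.1, h.2⟩⟩)
    exact h.2 (by simp only [h0, zero_smul])
  rw [h1, crossingSum_eq, ← finsum_mem_coe_finset]
  symm
  refine finsum_mem_eq_of_bijOn (fun k : Fin X.length => Ad (crossElt D X k) c.normal) ?_ ?_
  · simpa using hθ.bijOn hg y
  · intro k hk
    have hk' : (X.get k).1 = y := by simpa using hk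
    rw [← hθ.beyond_sub_beyond hg k, hk']

end Traversal

end SimpleClosedGeodesic

/-! ### The holonomies of the static and of the grafted spacetime -/

/-- The values at the corners of a trivialising function that satisfies an overlap condition with
transition elements `a`. -/
structure CornerOverlap {g : ℕ} {G : Type*} [Group G] (γ : ℕ → G) (a : Gen g → G) : Prop where
  three : ∀ y : Gen g, γ (y.idx + 3) = a y * γ y.idx
  two : ∀ y : Gen g, γ (y.idx + 2) = a y * γ (y.idx + 1)

section CornerOverlap

variable {g : ℕ} {G : Type*} [Group G] {γ : ℕ → G} {a : Gen g → G}

theorem CornerOverlap.gen_a (h : CornerOverlap γ a) (i : Fin g) :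
    γ (4 * i + 3) = a (.a i) * γ (4 * i) ∧ γ (4 * i + 2) = a (.a i) * γ (4 * i + 1) :=
  ⟨h.three (.a i), h.two (.a i)⟩

theorem CornerOverlap.gen_b (h : CornerOverlap γ a) (i : Fin g) :
    γ (4 * i + 4) = a (.b i) * γ (4 * i + 1) ∧ γ (4 * i + 3) = a (.b i) * γ (4 * i + 2) :=
  ⟨h.three (.b i), h.two (.b i)⟩

theorem CornerOverlap.handle_eq (h : CornerOverlap γ a) (i : Fin g) :
    handle a i = γ (4 * i + 4) * (γ (4 * i))⁻¹ := by
  obtain ⟨h1, h2⟩ := h.gen_a i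
  obtain ⟨h3, h4⟩ := h.gen_b i
  rw [handle, h3, eq_mul_inv_of_mul_eq h1.symm, eq_mul_inv_of_mul_eq h4.symm, h1, h2]
  group

/-- The holonomies along the sides of the polygon. -/
def sideHolonomy (γ : ℕ → G) : Gen g → G
  | .a i => (γ (4 * i + 1))⁻¹ * γ (4 * i)
  | .b i => (γ (4 * i + 1))⁻¹ * γ (4 * i + 2)

/-- The overlap condition gives paired sides the same holonomy. Replacing two factors of the
commutator by their paired versions makes it the holonomy along four consecutive sides. -/
theorem CornerOverlap.handle_sideHolonomy (h : CornerOverlap γ a) (i : Fin g) :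
    handle (sideHolonomy γ : Gen g → G) i = (γ (4 * i + 4))⁻¹ * γ (4 * i) := by
  obtain ⟨h1, h2⟩ := h.gen_a i
  obtain ⟨h3, h4⟩ := h.gen_b i
  have e1 : γ (4 * i) = (a (.a i))⁻¹ * γ (4 * i + 3) := by rw [h1]; group
  have e2 : γ (4 * i + 1) = (a (.a i))⁻¹ * γ (4 * i + 2) := by rw [h2]; group
  have e3 : γ (4 * i + 2) = (a (.b i))⁻¹ * γ (4 * i + 3) := by rw [h4]; group
  have e4 : γ (4 * i + 1) = (a (.b i))⁻¹ * γ (4 * i + 4) := by rw [h3]; group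
  have eA : (γ (4 * i + 1))⁻¹ * γ (4 * i) = (γ (4 * i + 2))⁻¹ * γ (4 * i + 3) := by
    rw [e1, e2]; group
  have eB : (γ (4 * i + 1))⁻¹ * γ (4 * i + 2) = (γ (4 * i + 4))⁻¹ * γ (4 * i + 3) := by
    rw [e3, e4]; group
  calc handle (sideHolonomy γ : Gen g → G) i = (γ (4 * i + 1))⁻¹ * γ (4 * i + 2) *
      ((γ (4 * i + 1))⁻¹ * γ (4 * i))⁻¹ * ((γ (4 * i + 1))⁻¹ * γ (4 * i + 2))⁻¹ *
      ((γ (4 * i + 1))⁻¹ * γ (4 * i)) := rfl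
    _ = (γ (4 * i + 4))⁻¹ * γ (4 * i + 3) * ((γ (4 * i + 2))⁻¹ * γ (4 * i + 3))⁻¹ *
      ((γ (4 * i + 1))⁻¹ * γ (4 * i + 2))⁻¹ * ((γ (4 * i + 1))⁻¹ * γ (4 * i)) := by
        rw [← eB, ← eA]
    _ = _ := by group

theorem CornerOverlap.prod_handle (h : CornerOverlap γ a) (hclosed : γ (4 * g) = γ 0) :
    ((List.finRange g).reverse.map (handle (sideHolonomy γ : Gen g → G))).prod = 1 := by
  rw [prod_reverse_handle, handlesInv_eq_of_handle_eq_inv_mul h.handle_sideHolonomy le_rfl, hclosed,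
    inv_mul_cancel, inv_one]

/-- The transition elements are the dual generators of the holonomies along the sides. -/
theorem CornerOverlap.dual_eq {γ : ℕ → Lorentz} {a : Gen g → Lorentz} (h : CornerOverlap γ a) :
    dual (γ 0) (sideHolonomy γ : Gen g → Lorentz) = a := by
  funext y
  obtain i | i := y
  all_goals
    have key0 := handlesInv_eq_of_handle_eq_inv_mul h.handle_sideHolonomy i.2.le
    have key1 : handlesInv (sideHolonomy γ : Gen g → Lorentz) (i + 1) = (γ 0)⁻¹ * γ (4 * i + 4) :=
      handlesInv_eq_of_handle_eq_inv_mul h.handle_sideHolonomy i.2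
    obtain ⟨h1, -⟩ := h.gen_a i
    obtain ⟨h3, h4⟩ := h.gen_b i
    rw [dual, key0, key1, sideHolonomy, h3]
  · rw [eq_mul_inv_of_mul_eq h1.symm, h4]
    group
  · group

/-- Telescoping the handles shows that the transport factors are the inverse frames at the starting
corners of `a_i` and `b_i`. -/
theorem CornerOverlap.transport_eq {γ : ℕ → Lorentz} {a : Gen g → Lorentz}
    (h : CornerOverlap γ a) (i : Fin g) :
    transport (γ 0) a (.a i) = (γ (4 * i))⁻¹ ∧ transport (γ 0) a (.b i) = (γ (4 * i + 2))⁻¹ := by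
  have key := handlesInv_eq_of_handle_eq_mul_inv h.handle_eq i.2.le
  obtain ⟨h1, -⟩ := h.gen_a i
  obtain ⟨-, h4⟩ := h.gen_b i
  have ha : a (.a i) = γ (4 * i + 3) * (γ (4 * i))⁻¹ := by rw [h1]; group
  have hb : a (.b i) = γ (4 * i + 3) * (γ (4 * i + 2))⁻¹ := by rw [h4]; group
  constructor
  · rw [transport, key]; group
  · rw [transport, key, ha, hb]; group

end CornerOverlap

/-! ### Grafted holonomies of the generators -/

section Main

variable {g : ℕ} {D : FundamentalPolygon g}

theorem FundamentalPolygon.holonomy_eq (γinv : V → Poincare) :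
    D.holonomy γinv = sideHolonomy fun k => γinv (D.corner k) := by
  funext y
  obtain i | i := y <;> rfl

theorem FundamentalPolygon.corner_mem_side (y : Gen g) :
    D.corner y.idx ∈ D.side y ∧ D.corner (y.idx + 1) ∈ D.side y := by
  rw [FundamentalPolygon.side_eq]
  exact ⟨left_mem_arc (D.corner_mem _) _, right_mem_arc _ (D.corner_mem _)⟩

theorem StaticFrame.cornerOverlap (F : StaticFrame D) :
    CornerOverlap (fun k => F.v (D.corner k)) D.gen := by
  refine ⟨fun y => ?_, fun y => ?_⟩
  · rw [← F.overlap y _ (FundamentalPolygon.corner_mem_side y).1,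
      (FundamentalPolygon.gen_corner y).1]
  · rw [← F.overlap y _ (FundamentalPolygon.corner_mem_side y).2,
      (FundamentalPolygon.gen_corner y).2]

namespace SimpleClosedGeodesic

variable (c : SimpleClosedGeodesic D)

theorem cornerOverlap_grafted (hg : 2 ≤ g) (F : StaticFrame D) (w T : ℝ) :
    CornerOverlap (fun k => c.grafted F w T (D.corner k))
      fun y => ⟨D.gen y, c.rho w (Ad (D.gen y) (D.corner 0))⟩ := by
  refine ⟨fun y => ?_, fun y => ?_⟩
  · rw [← c.grafted_gen hg F w T y (FundamentalPolygon.corner_mem_side y).1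
      (c.corner_notMem_multicurve hg y.idx_lt.le), (FundamentalPolygon.gen_corner y).1]
  · rw [← c.grafted_gen hg F w T y (FundamentalPolygon.corner_mem_side y).2
      (c.corner_notMem_multicurve hg y.idx_lt), (FundamentalPolygon.gen_corner y).2]

theorem holonomy_static_u (F : StaticFrame D) (T : ℝ) :
    (fun y => (D.holonomy (F.static T) y).u) =
      (sideHolonomy fun k => F.v (D.corner k) : Gen g → Lorentz) := by
  funext y
  obtain i | i := y <;> rfl

/-- A shift of the translation part of a trivialising function shifts the holonomy. -/
theorem _root_.Grafting.inv_mul_eq_ofJ (h k : Poincare) (x y : V) :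
    (⟨h.u, h.a + x⟩ : Poincare)⁻¹ * ⟨k.u, k.a + y⟩ =
      Poincare.ofJ (h⁻¹ * k).u ((h⁻¹ * k).j + Ad k.u⁻¹ (x - y)) := by
  ext1
  · rfl
  · simp only [Poincare.mul_a, Poincare.inv_a, Poincare.inv_u, Poincare.ofJ, Poincare.j,
      Poincare.mul_u, map_add, map_neg, map_sub, Ad_mul, mul_inv_rev, inv_inv, Ad_Ad_inv]
    abel

theorem holonomy_grafted (hg : 2 ≤ g) (F : StaticFrame D) {X : Word g} (hX : c.IsItinerary X)
    (w T : ℝ) (y : Gen g) : D.holonomy (c.grafted F w T) y =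
      Poincare.ofJ (D.holonomy (F.static T) y).u ((D.holonomy (F.static T) y).j +
        genShift w (F.v (D.corner 0)) D.gen c.normal X y) := by
  obtain ⟨θ, hθ⟩ := hX.exists_traversal
  have hjump : c.rho w (D.corner (y.idx + 1)) - c.rho w (D.corner y.idx) =
      w • crossingSum D.gen c.normal X y := by
    rw [c.rho_sub_rho hg w (D.corner_mem _) (c.corner_notMem_multicurve hg y.idx_lt.le)
      (D.corner_mem _) (c.corner_notMem_multicurve hg y.idx_lt), hθ.jump_eq_crossingSum hg]
  obtain i | i := y
  · refine (inv_mul_eq_ofJ (F.static T (D.corner (4 * i + 1))) (F.static T (D.corner (4 * i)))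
      _ _).trans ?_
    rw [genShift, (F.cornerOverlap.transport_eq i).1, ← map_smul, ← hjump]
    rfl
  -- The side `b_i` runs against the numbering of the corners, whence the minus sign in its shift.
  · refine (inv_mul_eq_ofJ (F.static T (D.corner (4 * i + 1))) (F.static T (D.corner (4 * i + 2)))
      _ _).trans ?_
    rw [genShift, (F.cornerOverlap.transport_eq i).2, ← map_smul, ← hjump, ← map_neg, neg_sub]
    rfl

end SimpleClosedGeodesic

end Main

end

end Grafting

theorem mainTheorem1 {g : ℕ} (hg : 2 ≤ g)
    -- a cocompact Fuchsian group of genus `g` with fundamental polygon,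
    -- and a trivialising function of its static spacetime
    (D : Grafting.FundamentalPolygon g) (F : Grafting.StaticFrame D)
    -- a simple closed geodesic on the surface, the polygons it traverses, and its weight
    (c : Grafting.SimpleClosedGeodesic D) (X : Grafting.Word g) (hX : c.IsItinerary X)
    (w : ℝ) (hw : 0 < w)
    -- a value of the cosmological time
    (T : ℝ) (hT : 0 < T) :
    -- holonomies of the generators before (`st`) and after (`gr`) grafting, base point value `v₀`
    let v₀ : Grafting.Lorentz := F.v (D.corner 0)
    let st : Grafting.Gen g → Grafting.Poincare := D.holonomy (F.static T)
    let gr : Grafting.Gen g → Grafting.Poincare := D.holonomy (c.grafted F w T)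
    -- the sum defining `ρ` is finite
    (∀ x ∈ Grafting.Hyp, (c.crossed x).Finite) ∧
    -- the grafted trivialising function satisfies the overlap condition with the Poincaré elements
    -- `(v_Y, ρ(Ad(v_Y) x₀))`, and the grafted holonomies satisfy the defining relation of
    -- the fundamental group, so that they define holonomies of all elements of `π₁(S_g)`
    (∀ y : Grafting.Gen g, ∀ x ∈ D.side y, x ∉ c.multicurve →
      c.grafted F w T (Grafting.Ad (D.gen y) x) =
        ⟨D.gen y, c.rho w (Grafting.Ad (D.gen y) (D.corner 0))⟩ * c.grafted F w T x) ∧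
    ((List.finRange g).reverse.map (Grafting.handle gr)).prod = 1 ∧
    -- the transformation of the holonomy of a general curve `η`
    (∀ η : Grafting.Word g,
      (Grafting.evalWord gr η).u = (Grafting.evalWord st η).u ∧
      (Grafting.evalWord gr η).j = (Grafting.evalWord st η).j +
        Grafting.graftShift w v₀ D.gen c.normal X (fun y => (st y).u) η) ∧
    -- it is induced by the map `Gr` on `(P₃)^{2g}` …
    gr = Grafting.Gr w v₀ X st ∧
    -- … which acts by the same formula on all of `(P₃)^{2g}`
    (∀ (h : Grafting.Gen g → Grafting.Poincare) (η : Grafting.Word g),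
      let u : Grafting.Gen g → Grafting.Lorentz := fun y => (h y).u
      let v : Grafting.Gen g → Grafting.Lorentz := Grafting.dual v₀ u
      (Grafting.evalWord (Grafting.Gr w v₀ X h) η).u = (Grafting.evalWord h η).u ∧
      (Grafting.evalWord (Grafting.Gr w v₀ X h) η).j = (Grafting.evalWord h η).j +
        Grafting.graftShift w v₀ v (Grafting.axis (Grafting.evalWord v X)) X u η) := by
  intro v₀ st gr
  -- The static holonomies thus determine the generators of Γ, so `Gr` evaluates the itinerary to
  -- the holonomy of λ and uses its actual normal.
  have hdual : Grafting.dual v₀ (fun y => (st y).u) = D.gen := by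
    rw [Grafting.SimpleClosedGeodesic.holonomy_static_u]
    exact F.cornerOverlap.dual_eq
  have hshift := c.holonomy_grafted hg F hX w T
  refine ⟨fun x hx => c.crossed_finite hg hx,
    fun y x hx hxc => c.grafted_gen hg F w T y hx hxc, ?_,
    Grafting.evalWord_shift w v₀ D.gen c.normal X hshift, ?_, Grafting.evalWord_Gr w v₀ X⟩
  · have h := (c.cornerOverlap_grafted hg F w T).prod_handle (by rw [D.corner_closed])
    rwa [← Grafting.FundamentalPolygon.holonomy_eq] at h
  · funext y
    rw [Grafting.Gr, hdual, hX.1, Grafting.axis_eq c.isAxis_hol]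
    exact hshift y
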